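/- Setting. Let $\alpha\in\mathbb{N}_0$, $\lambda\in(0,1]$, and let $f:[0,1]^s\to\mathbb{R}$ be such that all mixed partial derivatives $f^{(\beta)}$, $\beta\in\{0,\dots,\alpha\}^s$, exist and are continuous on $[0,1]^s$. Put $\mu=\int_{[0,1]^s}f$. Variation norm. For $u\subseteq\{1,\dots,s\}$ let $f_u$ be the ANOVA component defined recursively by $f_u(x)=\int_{[0,1]^{s-|u|}}f\,dx_{u^c}-\sum_{v\subsetneq u}f_v(x)$; it is regarded as a function of $x_u$. For a function $g$ on $[0,1]^d$ and a box $J=\prod_j[a_j,b_j)$ let $\Delta(g,J)$ be the alternating sum of the values of $g$ over the vertices of $J$, and let $$V^{(d)}_\lambda(g)=\sup_{\mathcal P}\Big(\sum_{J\in\mathcal P}\mathrm{Vol}(J)\Big|\frac{\Delta(g,J)}{\mathrm{Vol}(J)^\lambda}\Big|^2\Big)^{1/2},$$ the supremum being over all partitions of $[0,1)^d$ into boxes ($V^{(0)}_\lambda(g)=|g|$). For $v\subseteq\{1,\dots,d\}$ let $V^v_\lambda(g)=\sup_\rho V^{(|v|)}_\lambda\big(\int_{[0,1]^{d-|v|}}g\prod_{j\notin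 v}\rho_j(x_j)\,dx_{v^c}\big)$, the supremum being over all continuous $\rho_j:[0,1]\to[0,1]$, $j\notin v$. For nonempty $u$ let $$\|f\|_{u,\alpha,\lambda}=\sup_{v\subseteq u}\ \sup_\beta V^v_\lambda\big(f_u^{(\beta)}\big),$$ where $\beta=(\beta_j)_{j\in u}$ runs over the multi-indices with $\beta_j=\alpha$ for $j\in v$ and $0<\beta_j\le\alpha$ for $j\in u\setminus v$. Let $\|f\|_{\emptyset,\alpha,\lambda}=0$, $\|f\|_{\alpha,\lambda}=\max_u\|f\|_{u,\alpha,\lambda}$ and $\gamma_u=\|f\|_{u,\alpha,\lambda}/\|f\|_{\alpha,\lambda}$ (with $\gamma_u=0$ if $\|f\|_{\alpha,\lambda}=0$). Estimator. Let $m,r\ge1$. In the completely random design all entries of the matrices $C_1,\dots,C_s\in\{0,1\}^{\infty\times m}$ and of the digital shifts $D_1,\dots,D_s\in\{0,1\}^\infty$ are independent Bernoulli$(1/2)$ variables. For $0\le i<2^m$ with binary digit vector $\vec{\imath}\in\{0,1\}^m$ (least significant digit first), the $j$-th coordinate of the point $x_i$ is $\sum_{\ell\ge1}2^{-\ell}\big((C_j\vec{\imath}+D_j)_\ell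 \bmod 2\big)$, and $\hat\mu_\infty=2^{-m}\sum_{i<2^m}f(x_i)$. Let $\hat\mu^{(r)}_\infty$ be the sample median of $2r-1$ independent replicates of $\hat\mu_\infty$. Constants. For $\theta\in(0,1)$ let $$A=\frac{1}{\alpha!\,(2^{1/(\alpha+\lambda)}-1)^\alpha},\qquad B=\sum_{a=1}^{\alpha}\frac{1}{a!\,(2^{1/(\alpha+\lambda)}-1)^a},$$ $$C_\theta=\frac{4^{-\alpha}}{\alpha!\,(4^{(\alpha+\lambda)(1-\theta)}-1)(4^{1-\theta}-1)^\alpha}+\sum_{a=0}^{\alpha}\frac{4^{-a+1}}{a!\,(4^{1-\theta}-1)^a},$$ $$\Gamma(m)=1+\sum_{u\ne\emptyset}\gamma_u^{\frac{1}{\alpha+\lambda+1/2}}(Am+B)^{|u|},\qquad \Gamma_\theta=16^{2\theta(\alpha+\lambda)+1}\sum_{u\ne\emptyset}\gamma_u^{\frac{1+2(1-\theta)(\alpha+\lambda)}{\alpha+\lambda+1/2}}C_\theta^{|u|}.$$ Theorem. Suppose $\|f\|_{\alpha,\lambda}<\infty$. (1) For all $m,r\ge1$ and $\theta\in(0,1)$,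 $$\Pr\Big(|\hat\mu^{(r)}_\infty-\mu|^2>\Gamma_\theta\,\|f\|_{\alpha,\lambda}^2\,\frac{\Gamma(m)^{2\theta(\alpha+\lambda)}}{2^{(2\theta(\alpha+\lambda)+1)m}}\Big)\le2^{-r}.$$ (2) For every $\eta>0$ there is a constant $K$, depending only on $s,\alpha,\lambda,\eta$, such that for all $m,r\ge1$ $$\Pr\Big(|\hat\mu^{(r)}_\infty-\mu|^2>K\,\|f\|_{\alpha,\lambda}^2\,2^{-(2\alpha+2\lambda+1-2\eta)m}\Big)\le2^{-r},$$ that is, with $n=2^m$ points per replicate the error is $O(n^{-\alpha-\lambda-1/2+\eta})$ outside an event of probability at most $2^{-r}$. (3) Let $w_1,w_2,\dots\ge0$ be a sequence with $\sum_{j=1}^\infty w_j^{1/(\alpha+\lambda+1/2)}<\infty$. For every $\eta>0$ there is a constant $K$, depending only on $\alpha,\lambda,\eta$ and the sequence $(w_j)$ but not on $s$, such that the bound in (2) holds for all $s$, all $m,r\ge1$ and all such $f$ on $[0,1]^s$ whose relative variations satisfy $\gamma_u\le\prod_{j\in u}w_j$ for all $u\subseteq\{1,\dots,s\}$. -/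

import Mathlib

open MeasureTheory ProbabilityTheory
open scoped ENNReal Nat

universe u

noncomputable section

namespace MedianNet

/-! ### Mixed partial derivatives on the closed unit cube

A function on `[0,1]^s` is represented by `f : (Fin s → ℝ) → ℝ`; only its values on
`Set.Icc 0 1`, the closed unit cube, matter below. -/

/-- The partial derivative `∂g/∂x_j` on the closed cube (one-sided on the boundary). -/
def partialDeriv {s : ℕ} (j : Fin s) (g : (Fin s → ℝ) → ℝ) : (Fin s → ℝ) → ℝ :=
  fun x => derivWithin (fun t : ℝ => g (Function.update x j t)) (Set.Icc 0 1) (x j)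

/-- The mixed partial derivative `∂^{β₁ + ⋯ + β_s} g / ∂x₁^{β₁} ⋯ ∂x_s^{β_s}`. -/
def mixedDeriv {s : ℕ} (β : Fin s → ℕ) (g : (Fin s → ℝ) → ℝ) : (Fin s → ℝ) → ℝ :=
  (List.finRange s).foldr (fun j h => (partialDeriv j)^[β j] h) g

/-- The class `C^{(α,…,α)}([0,1]^s)`: for every multi-index `β ≤ (α,…,α)` the mixed partial
derivative exists and is continuous on the closed cube. By the symmetry of continuous mixed
partial derivatives the order of differentiation is immaterial, so existence is expressed by
saying that the derivative of order `β` can be differentiated once more in any direction `j`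
with `β j < α`, with the derivative of order `β + e_j` as the result. -/
structure MixedSmooth {s : ℕ} (α : ℕ) (f : (Fin s → ℝ) → ℝ) : Prop where
  hasDeriv : ∀ β : Fin s → ℕ, (∀ j, β j ≤ α) → ∀ j, β j < α →
    ∀ x ∈ Set.Icc (0 : Fin s → ℝ) 1,
      HasDerivWithinAt (fun t : ℝ => mixedDeriv β f (Function.update x j t))
        (mixedDeriv (Function.update β j (β j + 1)) f x) (Set.Icc 0 1) (x j)
  continuousOn : ∀ β : Fin s → ℕ, (∀ j, β j ≤ α) →
    ContinuousOn (mixedDeriv β f) (Set.Icc (0 : Fin s → ℝ) 1)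

/-! ### Partial integrals and ANOVA components -/

/-- The point with coordinates `x` on `v` and `y` off `v`. -/
def glue {ι : Type*} [DecidableEq ι] (v : Finset ι) (x : {j // j ∈ v} → ℝ)
    (y : {j // j ∉ v} → ℝ) : ι → ℝ :=
  fun j => if h : j ∈ v then x ⟨j, h⟩ else y ⟨j, h⟩

/-- `I_v(g)(x_v)`: integrate `g` over the variables outside `v`. -/
def partialIntegral {ι : Type*} [Fintype ι] [DecidableEq ι] (v : Finset ι) (g : (ι → ℝ) → ℝ) :
    ({j // j ∈ v} → ℝ) → ℝ :=
  fun x => ∫ y in Set.Icc (0 : {j // j ∉ v} → ℝ) 1, g (glue v x y)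

/-- The ANOVA component `f_u`, by the recursion
`f_u(x) = ∫ f(x) dx_{uᶜ} - ∑_{v ⊊ u} f_v(x)`. -/
def anova {s : ℕ} (f : (Fin s → ℝ) → ℝ) (u : Finset (Fin s)) : (Fin s → ℝ) → ℝ :=
  fun x => partialIntegral u f (fun j => x j) - ∑ v ∈ u.ssubsets.attach, anova f v.1 x
termination_by u.card
decreasing_by exact Finset.card_lt_card (Finset.mem_ssubsets.1 v.2)

/-- A function on `[0,1]^s` that depends only on the variables in `u`, read as a function of
`|u|` variables. -/
def restrictTo {s : ℕ} (u : Finset (Fin s)) (g : (Fin s → ℝ) → ℝ) :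
    ({j // j ∈ u} → ℝ) → ℝ :=
  fun x => g (glue u x 0)

/-- A multi-index on `u`, extended by zero. -/
def extendIndex {s : ℕ} (u : Finset (Fin s)) (β : {j // j ∈ u} → ℕ) : Fin s → ℕ :=
  fun j => if h : j ∈ u then β ⟨j, h⟩ else 0

/-! ### Fractional Vitali variation -/

/-- The half-open box `∏ [a_j, b_j)` with corners `J = (a, b)`. -/
def box {ι : Type*} (J : (ι → ℝ) × (ι → ℝ)) : Set (ι → ℝ) :=
  {x | ∀ j, J.1 j ≤ x j ∧ x j < J.2 j}

/-- The volume of a box. -/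
def boxVol {ι : Type*} [Fintype ι] (J : (ι → ℝ) × (ι → ℝ)) : ℝ :=
  ∏ j, (J.2 j - J.1 j)

/-- A finite partition of `[0,1)^ι` into nonempty half-open boxes. -/
structure IsBoxPartition {ι : Type*} (Q : Finset ((ι → ℝ) × (ι → ℝ))) : Prop where
  lt : ∀ J ∈ Q, ∀ j, J.1 j < J.2 j
  disjoint : ∀ J ∈ Q, ∀ J' ∈ Q, J ≠ J' → Disjoint (box J) (box J')
  cover : (⋃ J ∈ Q, box J) = box ((0 : ι → ℝ), (1 : ι → ℝ))

/-- The alternating sum `Δ(g, J)` of the values of `g` at the vertices of `J`. -/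
def altSum {ι : Type*} [Fintype ι] [DecidableEq ι] (g : (ι → ℝ) → ℝ)
    (J : (ι → ℝ) × (ι → ℝ)) : ℝ :=
  ∑ v : Finset ι, (-1 : ℝ) ^ (Fintype.card ι - v.card) *
    g (fun j => if j ∈ v then J.1 j else J.2 j)

/-- The fractional Vitali variation `V_λ^{(d)}(g)` of a function of `d = |ι|` variables (for
`d = 0` this is `|g|`). -/
def vitali {ι : Type*} [Fintype ι] [DecidableEq ι] (lam : ℝ) (g : (ι → ℝ) → ℝ) : ℝ≥0∞ :=
  ⨆ (Q : Finset ((ι → ℝ) × (ι → ℝ))) (_ : IsBoxPartition Q),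
    ENNReal.ofReal (Real.sqrt (∑ J ∈ Q, boxVol J * |altSum g J / boxVol J ^ lam| ^ 2))

/-- The partial fractional Vitali variation `V_λ^v(g)`: the supremum of the variation of
`I_v(g ∏_{j ∉ v} ρ_j)` over continuous `ρ_j : [0,1] → [0,1]`. -/
def partialVitali {ι : Type*} [Fintype ι] [DecidableEq ι] (lam : ℝ) (v : Finset ι)
    (g : (ι → ℝ) → ℝ) : ℝ≥0∞ :=
  ⨆ (ρ : {j // j ∉ v} → ℝ → ℝ)
    (_ : ∀ j, ContinuousOn (ρ j) (Set.Icc 0 1) ∧ ∀ t ∈ Set.Icc (0 : ℝ) 1, 0 ≤ ρ j t ∧ ρ j t ≤ 1),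
    vitali lam (partialIntegral v (fun x => g x * ∏ j : {j // j ∉ v}, ρ j (x j)))

/-- `‖f‖_{u,α,λ}`: the supremum of `V_λ^v(f_u^{(β)})` over `v ⊆ u` and multi-indices `β` on `u`
with `β_j = α` on `v` and `0 < β_j ≤ α` on `u \ v`; it is `0` for `u = ∅`. -/
def componentNorm {s : ℕ} (α : ℕ) (lam : ℝ) (f : (Fin s → ℝ) → ℝ) (u : Finset (Fin s)) : ℝ≥0∞ :=
  if u = ∅ then 0 else
    ⨆ (v : Finset {j // j ∈ u}) (β : {j // j ∈ u} → ℕ)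
      (_ : ∀ j, (j ∈ v → β j = α) ∧ (j ∉ v → 0 < β j ∧ β j ≤ α)),
      partialVitali lam v (restrictTo u (mixedDeriv (extendIndex u β) (anova f u)))

/-- The variation norm `‖f‖_{α,λ}`. -/
def variationNorm {s : ℕ} (α : ℕ) (lam : ℝ) (f : (Fin s → ℝ) → ℝ) : ℝ≥0∞ :=
  ⨆ u : Finset (Fin s), componentNorm α lam f u

/-- The relative variation `γ_u = ‖f‖_{u,α,λ} / ‖f‖_{α,λ}` (with `0 / 0 = 0`, which occurs for
constant `f` only). -/
def relVar {s : ℕ} (α : ℕ) (lam : ℝ) (f : (Fin s → ℝ) → ℝ) (u : Finset (Fin s)) : ℝ :=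
  (componentNorm α lam f u / variationNorm α lam f).toReal

/-! ### Constants -/

/-- `A_{α,λ}`. -/
def constA (α : ℕ) (lam : ℝ) : ℝ :=
  1 / ((α ! : ℝ) * ((2 : ℝ) ^ (1 / ((α : ℝ) + lam)) - 1) ^ α)

/-- `B_{α,λ}`. -/
def constB (α : ℕ) (lam : ℝ) : ℝ :=
  ∑ a ∈ Finset.Icc 1 α, 1 / ((a ! : ℝ) * ((2 : ℝ) ^ (1 / ((α : ℝ) + lam)) - 1) ^ a)

/-- `C_{α,λ,θ}`. -/
def constC (α : ℕ) (lam θ : ℝ) : ℝ :=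
  (4 : ℝ) ^ (-(α : ℤ)) /
      ((α ! : ℝ) * ((4 : ℝ) ^ (((α : ℝ) + lam) * (1 - θ)) - 1) * ((4 : ℝ) ^ (1 - θ) - 1) ^ α) +
    ∑ a ∈ Finset.range (α + 1),
      (4 : ℝ) ^ (-(a : ℤ) + 1) / ((a ! : ℝ) * ((4 : ℝ) ^ (1 - θ) - 1) ^ a)

/-- `Γ_{α,λ,γ_u}(m)`. -/
def gammaM {s : ℕ} (α : ℕ) (lam : ℝ) (γ : Finset (Fin s) → ℝ) (m : ℕ) : ℝ :=
  1 + ∑ u ∈ Finset.univ.filter (fun u : Finset (Fin s) => u ≠ ∅),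
    γ u ^ (1 / ((α : ℝ) + lam + 1 / 2)) * (constA α lam * m + constB α lam) ^ u.card

/-- `Γ_{α,λ,γ_u,θ}`. -/
def gammaTheta {s : ℕ} (α : ℕ) (lam : ℝ) (γ : Finset (Fin s) → ℝ) (θ : ℝ) : ℝ :=
  (16 : ℝ) ^ (2 * θ * ((α : ℝ) + lam) + 1) *
    ∑ u ∈ Finset.univ.filter (fun u : Finset (Fin s) => u ≠ ∅),
      γ u ^ ((1 + 2 * (1 - θ) * ((α : ℝ) + lam)) / ((α : ℝ) + lam + 1 / 2)) *
        constC α lam θ ^ u.card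

/-! ### Randomized nets with infinite precision

Row `l` (starting from `0`) of a matrix, or entry `l` of a shift, produces the binary digit of
weight `2^{-(l+1)}`; column `q` belongs to the binary digit of `i` of weight `2^q`. -/

/-- Binary digit number `l` of coordinate `j` of the `i`-th point: row `l` of
`C_j i + D_j mod 2`. -/
def netDigit {s m : ℕ} (C : Fin s → ℕ → Fin m → Bool) (D : Fin s → ℕ → Bool)
    (i : ℕ) (j : Fin s) (l : ℕ) : ℕ :=
  (∑ q : Fin m, (C j l q).toNat * (i.testBit q).toNat + (D j l).toNat) % 2

/-- The `i`-th point of the net. -/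
def netPoint {s m : ℕ} (C : Fin s → ℕ → Fin m → Bool) (D : Fin s → ℕ → Bool) (i : ℕ) :
    Fin s → ℝ :=
  fun j => ∑' l : ℕ, (netDigit C D i j l : ℝ) / 2 ^ (l + 1)

/-- The estimator `μ̂_∞ = 2^{-m} ∑_{i < 2^m} f(x_i)`. -/
def netEstimator {s m : ℕ} (f : (Fin s → ℝ) → ℝ) (C : Fin s → ℕ → Fin m → Bool)
    (D : Fin s → ℕ → Bool) : ℝ :=
  1 / (2 : ℝ) ^ m * ∑ i ∈ Finset.range (2 ^ m), f (netPoint C D i)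

/-- The sample median of `2r - 1` numbers: the `r`-th smallest. -/
def sampleMedian (r : ℕ) (hr : 1 ≤ r) (y : Fin (2 * r - 1) → ℝ) : ℝ :=
  y (Tuple.sort y ⟨r - 1, by omega⟩)

/-- All entries of `R` replicates of the matrices `C_1, …, C_s` (left summand) and of the
digital shifts `D_1, …, D_s` (right summand), as one family of random bits. -/
def designBits {Ω : Type*} {s m R : ℕ} (C : Fin R → Fin s → ℕ → Fin m → Ω → Bool)
    (D : Fin R → Fin s → ℕ → Ω → Bool) :
    (Fin R × Fin s × ℕ × Fin m) ⊕ (Fin R × Fin s × ℕ) → Ω → Bool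
  | Sum.inl (t, j, l, q) => C t j l q
  | Sum.inr (t, j, l) => D t j l

/-- `R` independent replicates of the completely random design: all entries of all matrices and
of all digital shifts are independent Bernoulli(1/2) random variables. -/
structure IsCompletelyRandomDesign {Ω : Type*} [MeasurableSpace Ω] (P : Measure Ω) {s m R : ℕ}
    (C : Fin R → Fin s → ℕ → Fin m → Ω → Bool) (D : Fin R → Fin s → ℕ → Ω → Bool) : Prop where
  measurable : ∀ i, Measurable (designBits C D i)
  indep : iIndepFun (designBits C D) P
  fair : ∀ i b, P {ω | designBits C D i ω = b} = 1 / 2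

/-- Under the completely random design with `2^m` points, the squared error of the median of
`2r - 1` independent replicates of the estimator exceeds `bound` with probability at
most `2^{-r}`. -/
def MedianSqErrorBound {s : ℕ} (f : (Fin s → ℝ) → ℝ) (m r : ℕ) (hr : 1 ≤ r) (bound : ℝ) : Prop :=
  ∀ (Ω : Type u) [MeasurableSpace Ω] (P : Measure Ω) [IsProbabilityMeasure P]
    (C : Fin (2 * r - 1) → Fin s → ℕ → Fin m → Ω → Bool)
    (D : Fin (2 * r - 1) → Fin s → ℕ → Ω → Bool),
    IsCompletelyRandomDesign P C D →
    P {ω | |sampleMedian r hr (fun t =>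
              netEstimator f (fun j l q => C t j l q ω) (fun j l => D t j l ω)) -
            ∫ x in Set.Icc (0 : Fin s → ℝ) 1, f x| ^ 2 > bound} ≤ (1 / 2 : ℝ≥0∞) ^ r

end MedianNet

end

/-!
Expand `f` in Walsh functions. A frequency is a family `k` of finite sets of digit positions, one
set for each coordinate, and the error of one replicate of the estimator is `∑_{k ≠ 0} c_k Y_k`,
where `c_k` is the Walsh coefficient of `f` and `Y_k` is the average of the Walsh function `k` over
the random net.

The variables `Y_k`, `k ≠ 0`, are uncorrelated with second moment `2^{-m}`, and a nonzero `Y_k` has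
modulus one, because Walsh functions are characters on the group underlying the unshifted net
(`integral_netAvg_mul_netAvg`, `one_le_sq_netAvg`); so each `Y_k` vanishes except with probability
`2^{-m}`. If `K` is any set of at most `2^m / 16` frequencies, then, except with probability `1/16`,
no frequency in `K` contributes at all, and by Chebyshev's inequality the others contribute at most
`16 · 2^{-m} ∑_{k ∉ K} c_k²` to the squared error, except with probability `1/16`
(`measure_sum_netAvg_le`). The median of `2r - 1` replicates is off only if `r` of them are, which
has probability at most `binom(2r - 1, r) 8^{-r} ≤ 2^{-r}` (`medianSqErrorBound_of_coeff`).

It remains to choose `K` with a small tail. In each coordinate, split the digit positions of a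
frequency into the `α` largest ones, the next largest one, and the rest. Integration by parts in the
`α` leading digits turns `c_k` into an integral of a mixed derivative of an ANOVA component of `f` against a
Walsh function and against nonnegative periodic profiles with small means (`exists_primitives`).
Summing the squares over the rest of the digits, Parseval's identity on a dyadic grid produces the
alternating sums of the derivative over the boxes of that grid, and the fractional variation bounds
the total (`sum_sq_integral_wal_le`, `sum_sq_coeff_le`). Hence the coefficients whose leading digits
have size `2^{‖k‖}` decay like `2^{-‖k‖}` in the sense of square sums. Taking for `K` the
frequencies whose size is below a threshold depending on the coordinates involved, a count shows
that `K` is small enough and that its complement has the tail in `gammaTheta`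
(`exists_small_freqs`).

All of this is done for the first `N` digits of each coordinate, where every sum is finite and an
event depends on finitely many bits. The truncated Walsh series at a point is an average of `f` over
the dyadic cell with the same first digits, so it converges by continuity (`tendsto_sum_coeff`), and
an error above the threshold is seen at all fine enough resolutions.

For the rates, `gammaM` and `gammaTheta` are at most products over the coordinates. Under summable
weights the first grows more slowly than any positive power of `2^m` and the second is bounded, uniformly in
the dimension (`exists_gammaM_le`, `exists_gammaTheta_le`).
-/

namespace MedianNet

set_option linter.unusedSectionVars false

/-! ### Walsh functions and their iterated integrals -/

/-- The Rademacher function of the binary digit of weight `2^{-(l+1)}`. -/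
noncomputable def rad (l : ℕ) (x : ℝ) : ℝ := (-1 : ℝ) ^ ⌊(2 : ℝ) ^ (l + 1) * x⌋

/-- The Walsh function whose digits of frequency form the finite set `κ`. -/
noncomputable def wal (κ : Finset ℕ) (x : ℝ) : ℝ := ∏ l ∈ κ, rad l x

theorem neg_one_zpow_eq_or (n : ℤ) : (-1 : ℝ) ^ n = 1 ∨ (-1 : ℝ) ^ n = -1 := by
  rcases Int.even_or_odd n with h | h
  · exact Or.inl h.neg_one_zpow
  · exact Or.inr h.neg_one_zpow

theorem rad_eq_or (l : ℕ) (x : ℝ) : rad l x = 1 ∨ rad l x = -1 := neg_one_zpow_eq_or _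

theorem rad_mul_self (l : ℕ) (x : ℝ) : rad l x * rad l x = 1 := by
  rcases rad_eq_or l x with h | h <;> simp [h]

theorem abs_rad (l : ℕ) (x : ℝ) : |rad l x| = 1 := by
  rcases rad_eq_or l x with h | h <;> simp [h]

theorem abs_wal (κ : Finset ℕ) (x : ℝ) : |wal κ x| = 1 := by
  simp [wal, Finset.abs_prod, abs_rad]

theorem measurable_rad (l : ℕ) : Measurable (rad l) := by
  have h : Measurable fun n : ℤ => (-1 : ℝ) ^ n := measurable_from_top
  exact h.comp (Int.measurable_floor.comp (measurable_const_mul _))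

theorem measurable_wal (κ : Finset ℕ) : Measurable (wal κ) :=
  Finset.measurable_fun_prod _ fun l _ => measurable_rad l

/-- A Rademacher function is constant on dyadic cells at least as fine as its own scale. -/
theorem rad_cell {l L : ℕ} (h : l < L) (n : ℤ) {y : ℝ} (hy : 0 ≤ y) (hy' : y < (2 : ℝ)⁻¹ ^ L) :
    rad l (n * (2 : ℝ)⁻¹ ^ L + y) = rad l (n * (2 : ℝ)⁻¹ ^ L) := by
  have key : ⌊(2 : ℝ) ^ (l + 1) * (n * (2 : ℝ)⁻¹ ^ L + y)⌋
      = ⌊(2 : ℝ) ^ (l + 1) * (n * (2 : ℝ)⁻¹ ^ L)⌋ := by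
    obtain ⟨d, rfl⟩ : ∃ d, L = l + 1 + d := ⟨L - (l + 1), by omega⟩
    have e1 : (2 : ℝ) ^ (l + 1) * (n * (2 : ℝ)⁻¹ ^ (l + 1 + d)) = (n : ℝ) / ((2 ^ d : ℕ) : ℝ) := by
      rw [pow_add (2 : ℝ)⁻¹, inv_pow, inv_pow]; push_cast; field_simp
    have e2 : (2 : ℝ) ^ (l + 1) * (n * (2 : ℝ)⁻¹ ^ (l + 1 + d) + y)
        = ((n : ℝ) + 2 ^ (l + 1 + d) * y) / ((2 ^ d : ℕ) : ℝ) := by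
      rw [mul_add, e1, pow_add (2 : ℝ) (l + 1)]; push_cast; field_simp
    rw [e1, e2, Int.floor_div_natCast, Int.floor_div_natCast, Int.floor_intCast,
      Int.floor_intCast_add]
    have : ⌊(2 : ℝ) ^ (l + 1 + d) * y⌋ = 0 := by
      rw [Int.floor_eq_zero_iff]
      refine ⟨by positivity, ?_⟩
      calc (2 : ℝ) ^ (l + 1 + d) * y < 2 ^ (l + 1 + d) * (2 : ℝ)⁻¹ ^ (l + 1 + d) := by gcongr
        _ = 1 := by rw [← mul_pow]; norm_num
    rw [this, add_zero]
  simp only [rad, key]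

theorem wal_cell {κ : Finset ℕ} {L : ℕ} (h : ∀ l ∈ κ, l < L) (n : ℤ) {y : ℝ} (hy : 0 ≤ y)
    (hy' : y < (2 : ℝ)⁻¹ ^ L) : wal κ (n * (2 : ℝ)⁻¹ ^ L + y) = wal κ (n * (2 : ℝ)⁻¹ ^ L) :=
  Finset.prod_congr rfl fun l hl => rad_cell (h l hl) n hy hy'

theorem rad_grid (l : ℕ) (n : ℤ) : rad l (n * (2 : ℝ)⁻¹ ^ (l + 1)) = (-1) ^ n := by
  have : (2 : ℝ) ^ (l + 1) * (n * (2 : ℝ)⁻¹ ^ (l + 1)) = n := by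
    rw [mul_left_comm, ← mul_pow]; norm_num
  rw [rad, this, Int.floor_intCast]

theorem rad_add_half (l : ℕ) (x : ℝ) : rad l (x + (2 : ℝ)⁻¹ ^ (l + 1)) = - rad l x := by
  have : (2 : ℝ) ^ (l + 1) * (x + (2 : ℝ)⁻¹ ^ (l + 1)) = 2 ^ (l + 1) * x + 1 := by
    rw [mul_add, ← mul_pow]; norm_num
  rw [rad, this, Int.floor_add_one, zpow_add_one₀ (by norm_num), rad]; ring

theorem rad_of_lt {l : ℕ} {x : ℝ} (h0 : 0 ≤ x) (h : x < (2 : ℝ)⁻¹ ^ (l + 1)) : rad l x = 1 := by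
  have := rad_cell (Nat.lt_succ_self l) 0 h0 h
  simpa [rad] using this

/-- Profile of an iterated integral of a Walsh function: a continuous function of period
`2^{-l}` with values in `[0, M]` and mean value `c`. -/
structure IsTent (l : ℕ) (c M : ℝ) (g : ℝ → ℝ) : Prop where
  cont : Continuous g
  periodic : Function.Periodic g ((2 : ℝ)⁻¹ ^ l)
  mean : ∫ x in (0 : ℝ)..(2 : ℝ)⁻¹ ^ l, g x = (2 : ℝ)⁻¹ ^ l * c
  nonneg : ∀ x, 0 ≤ g x
  le : ∀ x, g x ≤ M

theorem isTent_one (l : ℕ) : IsTent l 1 1 (fun _ => 1) where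
  cont := continuous_const
  periodic := fun _ => rfl
  mean := by simp
  nonneg := fun _ => zero_le_one
  le := fun _ => le_rfl

theorem IsTent.mono {l l' : ℕ} {c M : ℝ} {g : ℝ → ℝ} (h : IsTent l c M g) (hl : l' ≤ l) :
    IsTent l' c M g := by
  obtain ⟨d, rfl⟩ := Nat.exists_eq_add_of_le hl
  have e : (2 : ℝ)⁻¹ ^ l' = ((2 ^ d : ℕ) : ℤ) • (2 : ℝ)⁻¹ ^ (l' + d) := by
    rw [zsmul_eq_mul, pow_add, inv_pow, inv_pow]; push_cast; field_simp
  refine ⟨h.cont, ?_, ?_, h.nonneg, h.le⟩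
  · rw [e]; exact h.periodic.zsmul _
  · have := h.periodic.intervalIntegral_add_zsmul_eq ((2 ^ d : ℕ) : ℤ) 0
      (fun a b => h.cont.intervalIntegrable a b)
    rw [e]
    simp only [zero_add] at this
    rw [this, h.mean]
    simp [zsmul_eq_mul, mul_assoc]

/-- The primitive of `rad l * g`. -/
noncomputable def tentStep (l : ℕ) (g : ℝ → ℝ) (x : ℝ) : ℝ := ∫ t in (0 : ℝ)..x, rad l t * g t

theorem intervalIntegrable_mul_cont {ψ g : ℝ → ℝ} (hψ : Measurable ψ) {B : ℝ}
    (hB : ∀ x, |ψ x| ≤ B) (hg : Continuous g) (a b : ℝ) :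
    IntervalIntegrable (fun t => ψ t * g t) volume a b := by
  have h1 : IntervalIntegrable g volume a b := hg.intervalIntegrable a b
  exact ⟨h1.1.bdd_mul hψ.aestronglyMeasurable (c := B) (Filter.Eventually.of_forall hB),
    h1.2.bdd_mul hψ.aestronglyMeasurable (c := B) (Filter.Eventually.of_forall hB)⟩

theorem IsTent.step_add {l : ℕ} {c M : ℝ} {g : ℝ → ℝ} (h : IsTent (l + 1) c M g) (x : ℝ) :
    tentStep l g (x + (2 : ℝ)⁻¹ ^ (l + 1)) = (2 : ℝ)⁻¹ ^ (l + 1) * c - tentStep l g x := by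
  have hi := intervalIntegrable_mul_cont (measurable_rad l) (fun x => (abs_rad l x).le) h.cont
  have h1 : tentStep l g ((2 : ℝ)⁻¹ ^ (l + 1)) = (2 : ℝ)⁻¹ ^ (l + 1) * c := by
    rw [← h.mean, tentStep]
    refine intervalIntegral.integral_congr_ae ?_
    have : ∀ᵐ x : ℝ, x ≠ (2 : ℝ)⁻¹ ^ (l + 1) := by simp [ae_iff]
    filter_upwards [this] with t ht ht'
    rw [Set.uIoc_of_le (by positivity)] at ht'
    rw [rad_of_lt ht'.1.le (lt_of_le_of_ne ht'.2 ht), one_mul]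
  have h2 : ∫ t in (2 : ℝ)⁻¹ ^ (l + 1)..x + (2 : ℝ)⁻¹ ^ (l + 1), rad l t * g t
      = - tentStep l g x := by
    have := intervalIntegral.integral_comp_add_right (a := 0) (b := x)
      (fun t => rad l t * g t) ((2 : ℝ)⁻¹ ^ (l + 1))
    rw [zero_add] at this
    rw [← this, tentStep, ← intervalIntegral.integral_neg]
    refine intervalIntegral.integral_congr fun t _ => ?_
    simp only [rad_add_half, h.periodic t]; ring
  rw [sub_eq_add_neg, ← h1, ← h2, tentStep, tentStep,
    intervalIntegral.integral_add_adjacent_intervals (hi _ _) (hi _ _)]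

theorem tentStep_zero (l : ℕ) (g : ℝ → ℝ) : tentStep l g 0 = 0 := by simp [tentStep]

/-- Integrating a profile against the next coarser Rademacher function gives a profile of twice
the period. -/
theorem IsTent.step {l : ℕ} {c M : ℝ} {g : ℝ → ℝ} (h : IsTent (l + 1) c M g) :
    IsTent l ((2 : ℝ)⁻¹ ^ (l + 2) * c) ((2 : ℝ)⁻¹ ^ (l + 1) * c) (tentStep l g) := by
  have hi := intervalIntegrable_mul_cont (measurable_rad l) (fun x => (abs_rad l x).le) h.cont
  have hc : Continuous (tentStep l g) := intervalIntegral.continuous_primitive hi 0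
  have hδ : (0 : ℝ) < (2 : ℝ)⁻¹ ^ (l + 1) := by positivity
  have e : (2 : ℝ)⁻¹ ^ l = (2 : ℝ)⁻¹ ^ (l + 1) + (2 : ℝ)⁻¹ ^ (l + 1) := by ring
  have hbd : ∀ x, 0 ≤ tentStep l g x ∧ tentStep l g x ≤ (2 : ℝ)⁻¹ ^ (l + 1) * c := by
    have hp : Function.Periodic
        (fun x => 0 ≤ tentStep l g x ∧ tentStep l g x ≤ (2 : ℝ)⁻¹ ^ (l + 1) * c)
        ((2 : ℝ)⁻¹ ^ (l + 1)) := by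
      intro x
      simp only [h.step_add x]
      refine propext ⟨fun hx => ⟨by linarith [hx.2], by linarith [hx.1]⟩,
        fun hx => ⟨by linarith [hx.2], by linarith [hx.1]⟩⟩
    intro x
    obtain ⟨y, hy, hxy⟩ := hp.exists_mem_Ico₀ hδ x
    have hxy' := hxy
    simp only [eq_iff_iff] at hxy'
    rw [hxy']
    have e1 : tentStep l g y = ∫ t in (0 : ℝ)..y, g t := by
      refine intervalIntegral.integral_congr fun t ht => ?_
      rw [Set.uIcc_of_le hy.1] at ht
      simp only [rad_of_lt ht.1 (ht.2.trans_lt hy.2), one_mul]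
    have e2 : ∫ t in (0 : ℝ)..y, g t = (2 : ℝ)⁻¹ ^ (l + 1) * c
        - ∫ t in y..(2 : ℝ)⁻¹ ^ (l + 1), g t := by
      rw [← h.mean, ← intervalIntegral.integral_add_adjacent_intervals
        (h.cont.intervalIntegrable 0 y) (h.cont.intervalIntegrable y ((2 : ℝ)⁻¹ ^ (l + 1)))]
      ring
    refine ⟨?_, ?_⟩
    · rw [e1]; exact intervalIntegral.integral_nonneg hy.1 fun t _ => h.nonneg t
    · rw [e1, e2]
      have := intervalIntegral.integral_nonneg (μ := volume) hy.2.le fun t _ => h.nonneg t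
      linarith
  refine ⟨hc, ?_, ?_, fun x => (hbd x).1, fun x => (hbd x).2⟩
  · intro x
    rw [e, ← add_assoc, h.step_add, h.step_add]; ring
  · rw [e, ← intervalIntegral.integral_add_adjacent_intervals
        (hc.intervalIntegrable 0 ((2 : ℝ)⁻¹ ^ (l + 1))) (hc.intervalIntegrable _ _)]
    have := intervalIntegral.integral_comp_add_right (a := 0) (b := (2 : ℝ)⁻¹ ^ (l + 1))
      (tentStep l g) ((2 : ℝ)⁻¹ ^ (l + 1))
    rw [zero_add] at this
    rw [← this, intervalIntegral.integral_congr fun t _ => h.step_add t,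
      intervalIntegral.integral_sub (by simp) (hc.intervalIntegrable _ _)]
    simp
    ring

theorem tentStep_grid {l : ℕ} {c M : ℝ} {g : ℝ → ℝ} (h : IsTent (l + 1) c M g) (n : ℕ) :
    tentStep l g (n * (2 : ℝ)⁻¹ ^ l) = 0 := by
  have := (h.step.periodic).nat_mul_eq n
  rw [this, tentStep_zero]

/-- A factor that is constant on the cells at whose end points a primitive vanishes can be
pulled out of the integral. -/
theorem integral_cell_const {σ η : ℝ → ℝ} {δ : ℝ} (hδ : 0 < δ)
    (hσ : ∀ n : ℕ, ∀ y, 0 ≤ y → y < δ → σ (n * δ + y) = σ (n * δ))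
    (hη : ∀ a b, IntervalIntegrable η volume a b)
    (hση : ∀ a b, IntervalIntegrable (fun t => σ t * η t) volume a b)
    (h0 : ∀ n : ℕ, ∫ t in (0 : ℝ)..n * δ, η t = 0) {x : ℝ} (hx : 0 ≤ x) :
    ∫ t in (0 : ℝ)..x, σ t * η t = σ x * ∫ t in (0 : ℝ)..x, η t := by
  have cell : ∀ n : ℕ, ∀ y, 0 ≤ y → y ≤ δ → ∫ t in (n * δ)..(n * δ + y), σ t * η t
      = σ (n * δ) * ∫ t in (n * δ)..(n * δ + y), η t := by
    intro n y hy hy'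
    rw [← intervalIntegral.integral_const_mul]
    refine intervalIntegral.integral_congr_ae ?_
    have : ∀ᵐ t : ℝ, t ≠ n * δ + δ := by simp [ae_iff]
    filter_upwards [this] with t ht ht'
    rw [Set.uIoc_of_le (by linarith)] at ht'
    have hlt : t < n * δ + δ := lt_of_le_of_ne (ht'.2.trans (by linarith)) ht
    have := hσ n (t - n * δ) (by linarith [ht'.1]) (by linarith)
    rw [add_sub_cancel] at this
    rw [this]
  have sub : ∀ n : ℕ, ∀ y, ∫ t in (n * δ)..(n * δ + y), η t = ∫ t in (0 : ℝ)..(n * δ + y), η t := by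
    intro n y
    rw [← intervalIntegral.integral_add_adjacent_intervals (hη 0 (n * δ)) (hη _ _), h0, zero_add]
  have grid : ∀ n : ℕ, ∫ t in (0 : ℝ)..n * δ, σ t * η t = 0 := by
    intro n
    induction n with
    | zero => simp
    | succ n ih =>
      have e : ((n + 1 : ℕ) : ℝ) * δ = n * δ + δ := by push_cast; ring
      rw [← intervalIntegral.integral_add_adjacent_intervals (hση 0 (n * δ)) (hση _ _), ih, e,
        cell n δ hδ.le le_rfl, sub, ← e, h0]
      simp
  set n := ⌊x / δ⌋₊ with hn
  have h1 : n * δ ≤ x := by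
    rw [← le_div_iff₀ hδ]; exact Nat.floor_le (by positivity)
  have h2 : x < n * δ + δ := by
    have := Nat.lt_floor_add_one (x / δ)
    rw [div_lt_iff₀ hδ] at this
    linarith
  have hxe : x = n * δ + (x - n * δ) := by ring
  rw [← intervalIntegral.integral_add_adjacent_intervals (hση 0 (n * δ)) (hση _ _), grid, zero_add,
    hxe, cell n _ (by linarith) (by linarith), sub, hσ n _ (by linarith) (by linarith)]

/-- Integrating against the largest digit `l` of a Walsh function removes this digit: the digits in
`κ` are constant on the cells of side `2^{-l}`, and `rad l * g` integrates to zero on each. -/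
theorem integral_wal_mul_tent {l : ℕ} {c M : ℝ} {g : ℝ → ℝ} (h : IsTent (l + 1) c M g)
    {κ : Finset ℕ} (hκ : ∀ i ∈ κ, i < l) {x : ℝ} (hx : 0 ≤ x) :
    ∫ t in (0 : ℝ)..x, wal (insert l κ) t * g t = wal κ x * tentStep l g x := by
  have hi := intervalIntegrable_mul_cont (measurable_rad l) (fun x => (abs_rad l x).le) h.cont
  have hl : l ∉ κ := fun hl => lt_irrefl _ (hκ l hl)
  have e : (fun t => wal (insert l κ) t * g t) = fun t => wal κ t * (rad l t * g t) := by
    funext t; rw [wal, Finset.prod_insert hl, wal]; ring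
  have hi2 := intervalIntegrable_mul_cont (measurable_wal (insert l κ))
    (fun x => (abs_wal _ x).le) h.cont
  rw [e] at hi2 ⊢
  refine integral_cell_const (δ := (2 : ℝ)⁻¹ ^ l) (by positivity) ?_ hi hi2
    (fun n => tentStep_grid h n) hx
  intro n y hy hy'
  exact_mod_cast wal_cell hκ n hy hy'

/-- The iterated integral profile of a list of digits, given in increasing order. -/
noncomputable def tent : List ℕ → ℝ → ℝ
  | [] => fun _ => 1
  | l :: L => tentStep l (tent L)

/-- The mean value of `tent L`. -/
noncomputable def tentMean (L : List ℕ) : ℝ := (L.map fun l => (2 : ℝ)⁻¹ ^ (l + 2)).prod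

theorem tentMean_pos (L : List ℕ) : 0 < tentMean L := by
  refine List.prod_pos ?_
  simp only [List.mem_map]
  rintro _ ⟨l, _, rfl⟩
  positivity

theorem isTent_tent : ∀ (L : List ℕ), L.Pairwise (· < ·) → ∀ l : ℕ, (∀ i ∈ L, l ≤ i) →
    IsTent l (tentMean L) (if L = [] then 1 else 2 * tentMean L) (tent L)
  | [], _, l, _ => by simpa [tentMean, tent] using isTent_one l
  | i :: L, hL, l, h => by
    rw [List.pairwise_cons] at hL
    have h1 := isTent_tent L hL.2 (i + 1) fun j hj => hL.1 j hj
    have h2 := h1.step.mono (h i (by simp))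
    have e1 : tentMean (i :: L) = (2 : ℝ)⁻¹ ^ (i + 2) * tentMean L := by simp [tentMean]
    have e2 : 2 * tentMean (i :: L) = (2 : ℝ)⁻¹ ^ (i + 1) * tentMean L := by rw [e1]; ring
    rw [if_neg (by simp), e2, e1]
    exact h2

/-! ### The uniform distribution on the unit cube -/

/-- Bounded measurable functions. -/
def BddMeas {X : Type*} [MeasurableSpace X] (f : X → ℝ) : Prop :=
  Measurable f ∧ ∃ B, ∀ x, |f x| ≤ B

namespace BddMeas

variable {X Y : Type*} [MeasurableSpace X] [MeasurableSpace Y]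

theorem const (c : ℝ) : BddMeas fun _ : X => c := ⟨measurable_const, |c|, fun _ => le_rfl⟩

theorem comp {f : Y → ℝ} (hf : BddMeas f) {g : X → Y} (hg : Measurable g) :
    BddMeas fun x => f (g x) :=
  ⟨hf.1.comp hg, hf.2.imp fun _ hB _ => hB _⟩

theorem mul {f g : X → ℝ} (hf : BddMeas f) (hg : BddMeas g) : BddMeas fun x => f x * g x := by
  obtain ⟨B, hB⟩ := hf.2
  obtain ⟨C, hC⟩ := hg.2
  refine ⟨hf.1.mul hg.1, B * C, fun x => ?_⟩
  rw [abs_mul]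
  exact mul_le_mul (hB x) (hC x) (abs_nonneg _) ((abs_nonneg _).trans (hB x))

theorem add {f g : X → ℝ} (hf : BddMeas f) (hg : BddMeas g) : BddMeas fun x => f x + g x := by
  obtain ⟨B, hB⟩ := hf.2
  obtain ⟨C, hC⟩ := hg.2
  exact ⟨hf.1.add hg.1, B + C, fun x => (abs_add_le _ _).trans (add_le_add (hB x) (hC x))⟩

theorem sum {ι : Type*} (S : Finset ι) {f : ι → X → ℝ} (hf : ∀ i ∈ S, BddMeas (f i)) :
    BddMeas fun x => ∑ i ∈ S, f i x := by
  classical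
  induction S using Finset.induction_on with
  | empty => simpa using BddMeas.const 0
  | insert a S ha ih =>
    simp only [Finset.sum_insert ha]
    exact (hf a (by simp)).add (ih fun i hi => hf i (by simp [hi]))

theorem prod {ι : Type*} (S : Finset ι) {f : ι → X → ℝ} (hf : ∀ i ∈ S, BddMeas (f i)) :
    BddMeas fun x => ∏ i ∈ S, f i x := by
  classical
  induction S using Finset.induction_on with
  | empty => simpa using BddMeas.const 1
  | insert a S ha ih =>
    simp only [Finset.prod_insert ha]
    exact (hf a (by simp)).mul (ih fun i hi => hf i (by simp [hi]))

theorem integrable {f : X → ℝ} (hf : BddMeas f) (μ : Measure X) [IsFiniteMeasure μ] :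
    Integrable f μ := by
  obtain ⟨B, hB⟩ := hf.2
  exact Integrable.of_bound hf.1.aestronglyMeasurable B (Filter.Eventually.of_forall hB)

theorem intervalIntegrable {f : ℝ → ℝ} (hf : BddMeas f) (a b : ℝ) :
    IntervalIntegrable f volume a b :=
  ⟨hf.integrable (volume.restrict _), hf.integrable (volume.restrict _)⟩

end BddMeas

theorem bddMeas_wal (κ : Finset ℕ) : BddMeas (wal κ) :=
  ⟨measurable_wal κ, 1, fun x => (abs_wal κ x).le⟩

theorem IsTent.bddMeas {l : ℕ} {c M : ℝ} {g : ℝ → ℝ} (h : IsTent l c M g) : BddMeas g :=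
  ⟨h.cont.measurable, M, fun x => by rw [abs_of_nonneg (h.nonneg x)]; exact h.le x⟩

/-- The uniform distribution on `[0,1]`. -/
noncomputable def unitMeasure : Measure ℝ := volume.restrict (Set.Icc 0 1)

instance : IsProbabilityMeasure unitMeasure := ⟨by simp [unitMeasure]⟩

/-- The uniform distribution on the unit cube. -/
noncomputable def cubeMeasure (ι : Type*) [Fintype ι] : Measure (ι → ℝ) :=
  Measure.pi fun _ => unitMeasure

section Cube

variable {ι : Type*} [Fintype ι]

instance : IsProbabilityMeasure (cubeMeasure ι) := by unfold cubeMeasure; infer_instance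

theorem restrict_cube : volume.restrict (Set.Icc (0 : ι → ℝ) 1) = cubeMeasure ι := by
  rw [cubeMeasure, volume_pi, ← Set.pi_univ_Icc]
  exact Measure.restrict_pi_pi _ _

theorem ae_mem_cube : ∀ᵐ x ∂(cubeMeasure ι), x ∈ Set.Icc (0 : ι → ℝ) 1 := by
  rw [← restrict_cube]
  exact ae_restrict_mem measurableSet_Icc

theorem integral_unitMeasure (g : ℝ → ℝ) : ∫ t, g t ∂unitMeasure = ∫ t in (0 : ℝ)..1, g t := by
  rw [unitMeasure, intervalIntegral.integral_of_le zero_le_one, integral_Icc_eq_integral_Ioc]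

/-- A function continuous on the closed cube agrees there with a bounded continuous one. -/
theorem exists_continuous_bdd {G : (ι → ℝ) → ℝ} (hG : ContinuousOn G (Set.Icc 0 1)) :
    ∃ H : (ι → ℝ) → ℝ, Continuous H ∧ BddMeas H ∧ Set.EqOn H G (Set.Icc 0 1) := by
  let cl : (ι → ℝ) → ι → ℝ := fun x i => max 0 (min 1 (x i))
  have hcl : Continuous cl := by fun_prop
  have hmem : ∀ x, cl x ∈ Set.Icc (0 : ι → ℝ) 1 := fun x =>
    ⟨fun i => le_max_left _ _, fun i => max_le zero_le_one (min_le_left _ _)⟩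
  have hid : ∀ x ∈ Set.Icc (0 : ι → ℝ) 1, cl x = x := fun x hx => by
    funext i
    have h0 : 0 ≤ x i := hx.1 i
    have h1 : x i ≤ 1 := hx.2 i
    simp [cl, h0, h1]
  have hc : Continuous fun x => G (cl x) := hG.comp_continuous hcl hmem
  refine ⟨fun x => G (cl x), hc, ⟨hc.measurable, ?_⟩, fun x hx => by simp only [hid x hx]⟩
  obtain ⟨B, hB⟩ := isCompact_Icc.exists_bound_of_continuousOn hG
  exact ⟨B, fun x => hB _ (hmem x)⟩

theorem integrable_mul_of_continuousOn {G : (ι → ℝ) → ℝ} (hG : ContinuousOn G (Set.Icc 0 1))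
    {P : (ι → ℝ) → ℝ} (hP : BddMeas P) : Integrable (fun x => G x * P x) (cubeMeasure ι) := by
  obtain ⟨H, -, hH, he⟩ := exists_continuous_bdd hG
  refine ((hH.mul hP).integrable (cubeMeasure ι)).congr ?_
  filter_upwards [ae_mem_cube] with x hx
  rw [he hx]

theorem bddMeas_tensor {ψ : ι → ℝ → ℝ} (hψ : ∀ i, BddMeas (ψ i)) :
    BddMeas fun x : ι → ℝ => ∏ i, ψ i (x i) :=
  BddMeas.prod _ fun i _ => (hψ i).comp (measurable_pi_apply i)

variable [DecidableEq ι]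

theorem update_mem_cube {x : ι → ℝ} (hx : x ∈ Set.Icc (0 : ι → ℝ) 1) (j : ι) {t : ℝ}
    (ht : t ∈ Set.Icc (0 : ℝ) 1) : Function.update x j t ∈ Set.Icc (0 : ι → ℝ) 1 := by
  constructor <;> intro i <;> by_cases h : i = j
  · subst h; simpa using ht.1
  · simpa [h] using hx.1 i
  · subst h; simpa using ht.2
  · simpa [h] using hx.2 i

theorem glue_mem_cube {v : Finset ι} {x : {j // j ∈ v} → ℝ} {y : {j // j ∉ v} → ℝ}
    (hx : x ∈ Set.Icc (0 : {j // j ∈ v} → ℝ) 1) (hy : y ∈ Set.Icc (0 : {j // j ∉ v} → ℝ) 1) :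
    glue v x y ∈ Set.Icc (0 : ι → ℝ) 1 := by
  constructor <;> intro i <;> by_cases h : i ∈ v <;> simp only [glue, h, dite_true, dite_false]
  · exact hx.1 ⟨i, h⟩
  · exact hy.1 ⟨i, h⟩
  · exact hx.2 ⟨i, h⟩
  · exact hy.2 ⟨i, h⟩

theorem measurable_glue (v : Finset ι) :
    Measurable fun p : ({j // j ∈ v} → ℝ) × ({j // j ∉ v} → ℝ) => glue v p.1 p.2 := by
  refine measurable_pi_lambda _ fun i => ?_
  by_cases h : i ∈ v <;> simp only [glue, h, dite_true, dite_false] <;> fun_prop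

theorem continuous_glue (v : Finset ι) :
    Continuous fun p : ({j // j ∈ v} → ℝ) × ({j // j ∉ v} → ℝ) => glue v p.1 p.2 := by
  refine continuous_pi fun i => ?_
  by_cases h : i ∈ v <;> simp only [glue, h, dite_true, dite_false] <;> fun_prop

/-- Resampling one coordinate preserves the uniform distribution on the cube. -/
theorem measurePreserving_update (j : ι) :
    MeasurePreserving (fun p : (ι → ℝ) × ℝ => Function.update p.1 j p.2)
      ((cubeMeasure ι).prod unitMeasure) (cubeMeasure ι) := by
  have hm : Measurable fun p : (ι → ℝ) × ℝ => Function.update p.1 j p.2 := by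
    refine measurable_pi_lambda _ fun i => ?_
    by_cases h : i = j
    · subst h; simpa using measurable_snd
    · simp only [Function.update_of_ne h]; fun_prop
  refine ⟨hm, ?_⟩
  symm
  refine Measure.pi_eq fun s hs => ?_
  rw [Measure.map_apply hm (MeasurableSet.univ_pi hs)]
  have : (fun p : (ι → ℝ) × ℝ => Function.update p.1 j p.2) ⁻¹' Set.univ.pi s
      = (Set.univ.pi (Function.update s j Set.univ)) ×ˢ s j := by
    ext ⟨x, t⟩
    simp only [Set.mem_preimage, Set.mem_pi, Set.mem_univ, true_implies, Set.mem_prod]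
    constructor
    · intro h
      refine ⟨fun i => ?_, by simpa using h j⟩
      by_cases hi : i = j
      · subst hi; simp
      · simpa [hi] using h i
    · rintro ⟨h, ht⟩ i
      by_cases hi : i = j
      · subst hi; simpa using ht
      · simpa [hi] using h i
  rw [this, Measure.prod_prod, cubeMeasure, Measure.pi_pi,
    ← Finset.mul_prod_erase Finset.univ (fun i => unitMeasure (s i)) (Finset.mem_univ j),
    ← Finset.mul_prod_erase Finset.univ (fun i => unitMeasure (Function.update s j Set.univ i))
      (Finset.mem_univ j), mul_comm]
  congr 1
  simp only [Function.update_self, measure_univ, one_mul]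
  exact Finset.prod_congr rfl fun i hi => by rw [Function.update_of_ne (Finset.ne_of_mem_erase hi)]

theorem measurePreserving_glue (v : Finset ι) :
    MeasurePreserving (fun p : ({j // j ∈ v} → ℝ) × ({j // j ∉ v} → ℝ) => glue v p.1 p.2)
      ((cubeMeasure {j // j ∈ v}).prod (cubeMeasure {j // j ∉ v})) (cubeMeasure ι) := by
  refine ⟨measurable_glue v, ?_⟩
  symm
  refine Measure.pi_eq fun s hs => ?_
  rw [Measure.map_apply (measurable_glue v) (MeasurableSet.univ_pi hs)]
  have : (fun p : ({j // j ∈ v} → ℝ) × ({j // j ∉ v} → ℝ) => glue v p.1 p.2) ⁻¹' Set.univ.pi s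
      = (Set.univ.pi fun j : {j // j ∈ v} => s j) ×ˢ (Set.univ.pi fun j : {j // j ∉ v} => s j) := by
    ext ⟨x, y⟩
    simp only [Set.mem_preimage, Set.mem_pi, Set.mem_univ, true_implies, Set.mem_prod]
    constructor
    · intro h
      exact ⟨fun i => by simpa [glue, i.2] using h i, fun i => by simpa [glue, i.2] using h i⟩
    · rintro ⟨h, h'⟩ i
      by_cases hi : i ∈ v
      · simpa [glue, hi] using h ⟨i, hi⟩
      · simpa [glue, hi] using h' ⟨i, hi⟩
  rw [this, Measure.prod_prod, cubeMeasure, cubeMeasure, Measure.pi_pi, Measure.pi_pi]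
  convert Fintype.prod_subtype_mul_prod_subtype (fun i => i ∈ v) fun i => unitMeasure (s i)

theorem integral_update {F : (ι → ℝ) → ℝ} (hF : Integrable F (cubeMeasure ι)) (j : ι) :
    ∫ x, F x ∂(cubeMeasure ι)
      = ∫ x, ∫ t, F (Function.update x j t) ∂unitMeasure ∂(cubeMeasure ι) := by
  have h := measurePreserving_update (ι := ι) j
  rw [← h.map_eq] at hF
  have h2 := (integrable_map_measure hF.1 h.measurable.aemeasurable).1 hF
  refine Eq.trans ?_ (integral_prod _ h2)
  conv_lhs => rw [← h.map_eq]
  rw [integral_map h.measurable.aemeasurable hF.1]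
  rfl

theorem integral_glue {F : (ι → ℝ) → ℝ} (hF : Integrable F (cubeMeasure ι)) (v : Finset ι) :
    ∫ x, F x ∂(cubeMeasure ι) = ∫ x, ∫ y, F (glue v x y) ∂(cubeMeasure {j // j ∉ v})
      ∂(cubeMeasure {j // j ∈ v}) := by
  have h := measurePreserving_glue v
  rw [← h.map_eq] at hF
  have h2 := (integrable_map_measure hF.1 h.measurable.aemeasurable).1 hF
  refine Eq.trans ?_ (integral_prod _ h2)
  conv_lhs => rw [← h.map_eq]
  rw [integral_map h.measurable.aemeasurable hF.1]
  rfl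

theorem partialIntegral_eq (v : Finset ι) (g : (ι → ℝ) → ℝ) (x : {j // j ∈ v} → ℝ) :
    partialIntegral v g x = ∫ y, g (glue v x y) ∂(cubeMeasure {j // j ∉ v}) := by
  rw [partialIntegral, restrict_cube]

/-! ### Integration by parts -/

/-- Integration by parts on `[0,1]` against the primitive of a bounded measurable function. -/
theorem integral_mul_primitive {g g' ψ : ℝ → ℝ}
    (hd : ∀ t ∈ Set.Icc (0 : ℝ) 1, HasDerivWithinAt g (g' t) (Set.Icc 0 1) t)
    (hg' : ContinuousOn g' (Set.Icc 0 1)) (hψ : BddMeas ψ)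
    (h1 : ∫ t in (0 : ℝ)..1, ψ t = 0) :
    ∫ t in (0 : ℝ)..1, g t * ψ t = - ∫ t in (0 : ℝ)..1, g' t * ∫ τ in (0 : ℝ)..t, ψ τ := by
  have hu : Set.uIcc (0 : ℝ) 1 = Set.Icc 0 1 := Set.uIcc_of_le zero_le_one
  have hgi : IntervalIntegrable g' volume 0 1 := by
    refine ContinuousOn.intervalIntegrable ?_
    rwa [hu]
  have hψi := hψ.intervalIntegrable 0 1
  have h0 : (0 : ℝ) ∈ Set.uIcc (0 : ℝ) 1 := by simp
  have hH : ∀ x ∈ Set.Icc (0 : ℝ) 1, g x = g 0 + ∫ t in (0 : ℝ)..x, g' t := by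
    intro x hx
    rw [intervalIntegral.integral_eq_sub_of_hasDerivAt_of_le hx.1]
    · ring
    · exact fun t ht => ((hd t ⟨ht.1, ht.2.trans hx.2⟩).continuousWithinAt).mono
        (Set.Icc_subset_Icc_right hx.2)
    · exact fun t ht => (hd t ⟨ht.1.le, ht.2.le.trans hx.2⟩).hasDerivAt
        (Icc_mem_nhds ht.1 (ht.2.trans_le hx.2))
    · refine hgi.mono_set ?_
      rw [hu, Set.uIcc_of_le hx.1]
      exact Set.Icc_subset_Icc_right hx.2
  have a1 : AbsolutelyContinuousOnInterval (fun x => g 0 + ∫ t in (0 : ℝ)..x, g' t) 0 1 := by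
    have hc : AbsolutelyContinuousOnInterval (fun _ : ℝ => g 0) 0 1 :=
      ContDiffOn.absolutelyContinuousOnInterval contDiffOn_const
    exact hc.add (hgi.absolutelyContinuousOnInterval_intervalIntegral h0)
  have a2 := hψi.absolutelyContinuousOnInterval_intervalIntegral h0
  have key := a1.integral_mul_deriv_eq_deriv_mul a2
  have e1 : ∫ t in (0 : ℝ)..1, g t * ψ t = ∫ x in (0 : ℝ)..1,
      (fun x => g 0 + ∫ t in (0 : ℝ)..x, g' t) x * deriv (fun x => ∫ t in (0 : ℝ)..x, ψ t) x := by
    refine intervalIntegral.integral_congr_ae ?_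
    filter_upwards [hψi.ae_hasDerivAt_integral] with x hx hx'
    have hx2 := Set.uIoc_subset_uIcc hx'
    rw [(hx hx2 0 h0).deriv, hH x (by rwa [hu] at hx2)]
  have e2 : ∫ x in (0 : ℝ)..1, deriv (fun x => g 0 + ∫ t in (0 : ℝ)..x, g' t) x
      * (∫ t in (0 : ℝ)..x, ψ t) = ∫ t in (0 : ℝ)..1, g' t * ∫ τ in (0 : ℝ)..t, ψ τ := by
    refine intervalIntegral.integral_congr_ae ?_
    filter_upwards [hgi.ae_hasDerivAt_integral] with x hx hx'
    rw [((hx (Set.uIoc_subset_uIcc hx') 0 h0).const_add (g 0)).deriv]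
  rw [e1, key, e2, h1]
  simp

/-- Integration by parts in coordinate `j` of the cube, against a product of univariate
functions. -/
theorem integral_tensor_by_parts (j : ι) {G G' : (ι → ℝ) → ℝ}
    (hG : ContinuousOn G (Set.Icc 0 1)) (hG' : ContinuousOn G' (Set.Icc 0 1))
    (hd : ∀ x ∈ Set.Icc (0 : ι → ℝ) 1, HasDerivWithinAt (fun t => G (Function.update x j t)) (G' x)
      (Set.Icc 0 1) (x j))
    {ψ : ι → ℝ → ℝ} (hψ : ∀ i, BddMeas (ψ i)) {Ψ : ℝ → ℝ} (hΨ : BddMeas Ψ)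
    (hp : ∀ x ∈ Set.Icc (0 : ℝ) 1, ∫ t in (0 : ℝ)..x, ψ j t = Ψ x) (h1 : Ψ 1 = 0) :
    ∫ x, G x * ∏ i, ψ i (x i) ∂(cubeMeasure ι)
      = - ∫ x, G' x * ∏ i, (Function.update ψ j Ψ) i (x i) ∂(cubeMeasure ι) := by
  have hψ' : ∀ i, BddMeas ((Function.update ψ j Ψ) i) := by
    intro i
    by_cases h : i = j
    · subst h; simpa using hΨ
    · simpa [h] using hψ i
  rw [integral_update (integrable_mul_of_continuousOn hG (bddMeas_tensor hψ)) j,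
    integral_update (integrable_mul_of_continuousOn hG' (bddMeas_tensor hψ')) j, ← integral_neg]
  refine integral_congr_ae ?_
  filter_upwards [ae_mem_cube] with x hx
  have split : ∀ (χ : ι → ℝ → ℝ) (t : ℝ), ∏ i, χ i (Function.update x j t i)
      = χ j t * ∏ i ∈ Finset.univ.erase j, χ i (x i) := by
    intro χ t
    rw [← Finset.mul_prod_erase Finset.univ _ (Finset.mem_univ j), Function.update_self]
    congr 1
    exact Finset.prod_congr rfl fun i hi => by rw [Function.update_of_ne (Finset.ne_of_mem_erase hi)]
  have e3 : ∏ i ∈ Finset.univ.erase j, (Function.update ψ j Ψ) i (x i)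
      = ∏ i ∈ Finset.univ.erase j, ψ i (x i) :=
    Finset.prod_congr rfl fun i hi => by rw [Function.update_of_ne (Finset.ne_of_mem_erase hi)]
  simp only [split, Function.update_self, e3]
  simp only [← mul_assoc]
  rw [integral_mul_const, integral_mul_const, integral_unitMeasure, integral_unitMeasure,
    integral_mul_primitive (g := fun t => G (Function.update x j t))
      (g' := fun t => G' (Function.update x j t)) ?_ ?_ (hψ j) ?_]
  · rw [neg_mul]
    congr 2
    refine intervalIntegral.integral_congr fun t ht => ?_
    rw [Set.uIcc_of_le zero_le_one] at ht
    simp only [hp t ht]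
  · intro t ht
    have := hd _ (update_mem_cube hx j ht)
    simpa using this
  · refine hG'.comp (Continuous.continuousOn (by fun_prop)) fun t ht => update_mem_cube hx j ht
  · rw [hp 1 (by simp), h1]

/-- A tensor factor of mean zero annihilates functions that do not depend on its coordinate. -/
theorem integral_tensor_eq_zero (j : ι) {G : (ι → ℝ) → ℝ}
    (hG : ContinuousOn G (Set.Icc 0 1)) (hj : ∀ x t, G (Function.update x j t) = G x)
    {ψ : ι → ℝ → ℝ} (hψ : ∀ i, BddMeas (ψ i)) (h0 : ∫ t in (0 : ℝ)..1, ψ j t = 0) :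
    ∫ x, G x * ∏ i, ψ i (x i) ∂(cubeMeasure ι) = 0 := by
  rw [integral_update (integrable_mul_of_continuousOn hG (bddMeas_tensor hψ)) j]
  refine (integral_congr_ae (g := fun _ => (0 : ℝ)) ?_).trans (by simp)
  filter_upwards with x
  have split : ∀ t : ℝ, ∏ i, ψ i (Function.update x j t i)
      = ψ j t * ∏ i ∈ Finset.univ.erase j, ψ i (x i) := by
    intro t
    rw [← Finset.mul_prod_erase Finset.univ _ (Finset.mem_univ j), Function.update_self]
    congr 1
    exact Finset.prod_congr rfl fun i hi => by rw [Function.update_of_ne (Finset.ne_of_mem_erase hi)]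
  simp only [split, hj]
  rw [integral_const_mul, integral_mul_const, integral_unitMeasure, h0]
  simp

end Cube

/-! ### Mixed derivatives of the ANOVA components -/

section Family

variable {s : ℕ}

/-- A family `D β` of continuous functions on the cube in which `D (β + e_j)` is the partial
derivative of `D β` in direction `j`. -/
structure DerivFamily (α : ℕ) (D : (Fin s → ℕ) → (Fin s → ℝ) → ℝ) : Prop where
  cont : ∀ β : Fin s → ℕ, (∀ j, β j ≤ α) → ContinuousOn (D β) (Set.Icc 0 1)
  deriv : ∀ β : Fin s → ℕ, (∀ j, β j ≤ α) → ∀ j, β j < α → ∀ x ∈ Set.Icc (0 : Fin s → ℝ) 1,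
    HasDerivWithinAt (fun t : ℝ => D β (Function.update x j t))
      (D (Function.update β j (β j + 1)) x) (Set.Icc 0 1) (x j)

theorem partialDeriv_congr {g h : (Fin s → ℝ) → ℝ} (H : Set.EqOn g h (Set.Icc 0 1)) (j : Fin s) :
    Set.EqOn (partialDeriv j g) (partialDeriv j h) (Set.Icc 0 1) := by
  intro x hx
  refine derivWithin_congr (fun t ht => H (update_mem_cube hx j ht)) ?_
  simpa using H hx

theorem mem_unit_of_mem_cube {ι : Type*} {x : ι → ℝ} (hx : x ∈ Set.Icc (0 : ι → ℝ) 1) (j : ι) :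
    x j ∈ Set.Icc (0 : ℝ) 1 := ⟨hx.1 j, hx.2 j⟩

theorem DerivFamily.iterate {α : ℕ} {D : (Fin s → ℕ) → (Fin s → ℝ) → ℝ} (hD : DerivFamily α D)
    {γ : Fin s → ℕ} (hγ : ∀ j, γ j ≤ α) {j : Fin s} (hj : γ j = 0) {g : (Fin s → ℝ) → ℝ}
    (hg : Set.EqOn g (D γ) (Set.Icc 0 1)) (n : ℕ) (hn : n ≤ α) :
    Set.EqOn ((partialDeriv j)^[n] g) (D (Function.update γ j n)) (Set.Icc 0 1) := by
  induction n with
  | zero =>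
    have : Function.update γ j 0 = γ := by rw [← hj, Function.update_eq_self]
    rw [this]
    exact hg
  | succ n ih =>
    rw [Function.iterate_succ_apply']
    refine (partialDeriv_congr (ih (by omega)) j).trans fun x hx => ?_
    have hle : ∀ i, Function.update γ j n i ≤ α := by
      intro i
      by_cases h : i = j
      · subst h; simp; omega
      · simpa [h] using hγ i
    have := hD.deriv (Function.update γ j n) hle j (by simp; omega) x hx
    simp only [Function.update_self, Function.update_idem] at this
    exact this.derivWithin (uniqueDiffOn_Icc zero_lt_one _ (mem_unit_of_mem_cube hx j))

/-- The members of such a family are the mixed derivatives of the first one, whatever the values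
of these functions off the cube. -/
theorem DerivFamily.mixedDeriv_eqOn {α : ℕ} {D : (Fin s → ℕ) → (Fin s → ℝ) → ℝ}
    (hD : DerivFamily α D) {g : (Fin s → ℝ) → ℝ} (hg : Set.EqOn g (D 0) (Set.Icc 0 1))
    {β : Fin s → ℕ} (hβ : ∀ j, β j ≤ α) :
    Set.EqOn (mixedDeriv β g) (D β) (Set.Icc 0 1) := by
  have key : ∀ L : List (Fin s), L.Nodup →
      Set.EqOn (L.foldr (fun j h => (partialDeriv j)^[β j] h) g)
        (D fun i => if i ∈ L then β i else 0) (Set.Icc 0 1) := by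
    intro L hL
    induction L with
    | nil => simpa using (show Set.EqOn g (D fun _ => 0) (Set.Icc 0 1) from hg)
    | cons j L ih =>
      rw [List.nodup_cons] at hL
      rw [List.foldr_cons]
      have h1 := hD.iterate (γ := fun i => if i ∈ L then β i else 0) (j := j)
        (fun i => by split_ifs; exacts [hβ i, Nat.zero_le _]) (by simp [hL.1])
        (ih hL.2) (β j) (hβ j)
      convert h1 using 2
      funext i
      by_cases h : i = j
      · subst h; simp
      · simp [h]
  have := key (List.finRange s) (List.nodup_finRange s)
  simpa [mixedDeriv] using this

theorem mixedDeriv_zero (g : (Fin s → ℝ) → ℝ) : mixedDeriv 0 g = g := by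
  have : ∀ L : List (Fin s), L.foldr (fun j h => (partialDeriv j)^[(0 : Fin s → ℕ) j] h) g = g := by
    intro L
    induction L with
    | nil => rfl
    | cons j L ih => rw [List.foldr_cons, ih]; rfl
  exact this _

theorem MixedSmooth.derivFamily {α : ℕ} {f : (Fin s → ℝ) → ℝ} (hf : MixedSmooth α f) :
    DerivFamily α fun β => mixedDeriv β f :=
  ⟨hf.continuousOn, hf.hasDeriv⟩

theorem DerivFamily.mixedSmooth {α : ℕ} {D : (Fin s → ℕ) → (Fin s → ℝ) → ℝ}
    (hD : DerivFamily α D) {g : (Fin s → ℝ) → ℝ} (hg : Set.EqOn g (D 0) (Set.Icc 0 1)) :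
    MixedSmooth α g := by
  refine ⟨fun β hβ j hj x hx => ?_, fun β hβ => (hD.cont β hβ).congr (hD.mixedDeriv_eqOn hg hβ)⟩
  have hβ' : ∀ i, Function.update β j (β j + 1) i ≤ α := by
    intro i
    by_cases h : i = j
    · subst h; simpa using hj
    · simpa [h] using hβ i
  rw [hD.mixedDeriv_eqOn hg hβ' hx]
  refine (hD.deriv β hβ j hj x hx).congr_of_mem (fun t ht => ?_) (mem_unit_of_mem_cube hx j)
  exact hD.mixedDeriv_eqOn hg hβ (update_mem_cube hx j ht)

theorem DerivFamily.sub {α : ℕ} {D E : (Fin s → ℕ) → (Fin s → ℝ) → ℝ} (hD : DerivFamily α D)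
    (hE : DerivFamily α E) : DerivFamily α fun β x => D β x - E β x :=
  ⟨fun β hβ => (hD.cont β hβ).sub (hE.cont β hβ),
    fun β hβ j hj x hx => (hD.deriv β hβ j hj x hx).sub (hE.deriv β hβ j hj x hx)⟩

theorem DerivFamily.sum {α : ℕ} {κ : Type*} (S : Finset κ)
    {D : κ → (Fin s → ℕ) → (Fin s → ℝ) → ℝ} (hD : ∀ i ∈ S, DerivFamily α (D i)) :
    DerivFamily α fun β x => ∑ i ∈ S, D i β x :=
  ⟨fun β hβ => continuousOn_finsetSum _ fun i hi => (hD i hi).cont β hβ,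
    fun β hβ j hj x hx => HasDerivWithinAt.fun_sum fun i hi => (hD i hi).deriv β hβ j hj x hx⟩

end Family

section PartialIntegral

variable {ι : Type*} [Fintype ι] [DecidableEq ι]

/-- The integral of `g` over the variables outside `v`, as a function of all variables. -/
noncomputable def integrateOut (v : Finset ι) (g : (ι → ℝ) → ℝ) (x : ι → ℝ) : ℝ :=
  partialIntegral v g fun j => x j

theorem restrict_mem_cube {x : ι → ℝ} (hx : x ∈ Set.Icc (0 : ι → ℝ) 1) (p : ι → Prop) :
    (fun j : {j // p j} => x j) ∈ Set.Icc (0 : {j // p j} → ℝ) 1 :=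
  ⟨fun j => hx.1 j, fun j => hx.2 j⟩

theorem integrateOut_congr {v : Finset ι} {g h : (ι → ℝ) → ℝ} (H : Set.EqOn g h (Set.Icc 0 1)) :
    Set.EqOn (integrateOut v g) (integrateOut v h) (Set.Icc 0 1) := by
  intro x hx
  rw [integrateOut, integrateOut, partialIntegral_eq, partialIntegral_eq]
  refine integral_congr_ae ?_
  filter_upwards [ae_mem_cube] with y hy
  exact H (glue_mem_cube (restrict_mem_cube hx (· ∈ v)) hy)

theorem continuous_partialIntegral (v : Finset ι) {g : (ι → ℝ) → ℝ} (hg : Continuous g) :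
    Continuous (partialIntegral v g) := by
  have : Continuous (Function.uncurry fun (x : {j // j ∈ v} → ℝ) (y : {j // j ∉ v} → ℝ) =>
      g (glue v x y)) := hg.comp (continuous_glue v)
  exact continuous_parametric_integral_of_continuous this isCompact_Icc

theorem continuous_integrateOut (v : Finset ι) {g : (ι → ℝ) → ℝ} (hg : Continuous g) :
    Continuous (integrateOut v g) :=
  (continuous_partialIntegral v hg).comp (by fun_prop)

theorem continuousOn_integrateOut (v : Finset ι) {g : (ι → ℝ) → ℝ}
    (hg : ContinuousOn g (Set.Icc 0 1)) : ContinuousOn (integrateOut v g) (Set.Icc 0 1) := by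
  obtain ⟨h, hc, -, he⟩ := exists_continuous_bdd hg
  exact (continuous_integrateOut v hc).continuousOn.congr (integrateOut_congr he.symm)

theorem glue_update {v : Finset ι} {j : ι} (hj : j ∈ v) (x : ι → ℝ) (t : ℝ)
    (y : {j // j ∉ v} → ℝ) :
    glue v (fun i : {i // i ∈ v} => Function.update x j t i) y
      = Function.update (glue v (fun i : {i // i ∈ v} => x i) y) j t := by
  funext i
  by_cases h : i = j
  · subst h; simp [glue, hj]
  · by_cases hi : i ∈ v <;> simp [glue, h, hi]

/-- Differentiation under the integral sign. -/
theorem hasDerivWithinAt_integrateOut {v : Finset ι} {j : ι} (hj : j ∈ v)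
    {G G' : (ι → ℝ) → ℝ} (hG : ContinuousOn G (Set.Icc 0 1)) (hG' : ContinuousOn G' (Set.Icc 0 1))
    (hd : ∀ x ∈ Set.Icc (0 : ι → ℝ) 1, HasDerivWithinAt (fun t => G (Function.update x j t)) (G' x)
      (Set.Icc 0 1) (x j)) {x : ι → ℝ} (hx : x ∈ Set.Icc (0 : ι → ℝ) 1) :
    HasDerivWithinAt (fun t => integrateOut v G (Function.update x j t)) (integrateOut v G' x)
      (Set.Icc 0 1) (x j) := by
  obtain ⟨H, hHc, hHb, hHe⟩ := exists_continuous_bdd hG'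
  obtain ⟨K, hKc, hKb, hKe⟩ := exists_continuous_bdd hG
  set h : ℝ → ℝ := fun τ => integrateOut v H (Function.update x j τ) with hh
  have hhc : Continuous h := (continuous_integrateOut v hHc).comp (by fun_prop)
  have key : ∀ t ∈ Set.Icc (0 : ℝ) 1, integrateOut v G (Function.update x j t)
      = integrateOut v G (Function.update x j 0) + ∫ τ in (0 : ℝ)..t, h τ := by
    intro t ht
    have h00 : (0 : ℝ) ∈ Set.Icc (0 : ℝ) 1 := by simp
    have hmG : ∀ τ ∈ Set.Icc (0 : ℝ) 1, integrateOut v G (Function.update x j τ)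
        = ∫ y, K (glue v (fun i : {i // i ∈ v} => Function.update x j τ i) y)
          ∂(cubeMeasure {j // j ∉ v}) := by
      intro τ hτ
      rw [integrateOut_congr hKe.symm (update_mem_cube hx j hτ), integrateOut, partialIntegral_eq]
    have hmg : ∀ τ, BddMeas fun y : {j // j ∉ v} → ℝ =>
        K (glue v (fun i : {i // i ∈ v} => Function.update x j τ i) y) := fun τ =>
      BddMeas.comp (g := fun y => glue v (fun i : {i // i ∈ v} => Function.update x j τ i) y) hKb
        (Measurable.comp (f := fun y : {j // j ∉ v} → ℝ =>
          ((fun i : {i // i ∈ v} => Function.update x j τ i), y))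
          (measurable_glue v) (measurable_const.prodMk measurable_id))
    rw [hmG t ht, hmG 0 h00, ← sub_eq_iff_eq_add',
      ← integral_sub ((hmg t).integrable _) ((hmg 0).integrable _)]
    have e1 : ∫ y, (K (glue v (fun i : {i // i ∈ v} => Function.update x j t i) y)
        - K (glue v (fun i : {i // i ∈ v} => Function.update x j 0 i) y))
          ∂(cubeMeasure {j // j ∉ v})
        = ∫ y, ∫ τ in Set.Ioc (0 : ℝ) t, H (glue v (fun i : {i // i ∈ v} => Function.update x j τ i) y)
          ∂volume ∂(cubeMeasure {j // j ∉ v}) := by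
      refine integral_congr_ae ?_
      filter_upwards [ae_mem_cube] with y hy
      have hz := glue_mem_cube (restrict_mem_cube hx (· ∈ v)) hy
      set z := glue v (fun i : {i // i ∈ v} => x i) y with hzdef
      simp only [glue_update hj]
      rw [← hzdef, ← intervalIntegral.integral_of_le ht.1,
        hKe (update_mem_cube hz j ht), hKe (update_mem_cube hz j h00)]
      refine (intervalIntegral.integral_eq_sub_of_hasDerivAt_of_le
        (f := fun τ => G (Function.update z j τ)) ht.1 ?_ ?_ ?_).symm
      · exact hG.comp (Continuous.continuousOn (by fun_prop))
          fun τ hτ => update_mem_cube hz j ⟨hτ.1, hτ.2.trans ht.2⟩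
      · intro τ hτ
        have hτ' : τ ∈ Set.Icc (0 : ℝ) 1 := ⟨hτ.1.le, hτ.2.le.trans ht.2⟩
        have := hd _ (update_mem_cube hz j hτ')
        rw [hHe (update_mem_cube hz j hτ')]
        simp only [Function.update_self, Function.update_idem] at this
        exact this.hasDerivAt (Icc_mem_nhds hτ.1 (hτ.2.trans_le ht.2))
      · exact (hHc.comp (by fun_prop)).intervalIntegrable _ _
    rw [e1, integral_integral_swap, intervalIntegral.integral_of_le ht.1]
    · refine integral_congr_ae (Filter.Eventually.of_forall fun τ => ?_)
      simp only [hh, integrateOut, partialIntegral_eq]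
    · have : BddMeas (Function.uncurry fun (y : {j // j ∉ v} → ℝ) (τ : ℝ) =>
          H (glue v (fun i : {i // i ∈ v} => Function.update x j τ i) y)) := by
        refine BddMeas.comp (g := fun p : ({j // j ∉ v} → ℝ) × ℝ =>
          glue v (fun i : {i // i ∈ v} => Function.update x j p.2 i) p.1) hHb
          (Measurable.comp (f := fun p : ({j // j ∉ v} → ℝ) × ℝ =>
            ((fun i : {i // i ∈ v} => Function.update x j p.2 i), p.1))
          (measurable_glue v) (Measurable.prodMk ?_ measurable_fst))
        refine measurable_pi_lambda _ fun i => ?_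
        by_cases hi : (i : ι) = j
        · simp only [hi, Function.update_self]; exact measurable_snd
        · simp only [Function.update_of_ne hi]; exact measurable_const
      exact this.integrable _
  have hval : h (x j) = integrateOut v G' x := by
    simp only [hh, Function.update_eq_self]
    exact integrateOut_congr hHe hx
  rw [← hval]
  refine HasDerivWithinAt.congr_of_mem ?_ key (mem_unit_of_mem_cube hx j)
  exact ((hhc.integral_hasStrictDerivAt 0 (x j)).hasDerivAt.const_add _).hasDerivWithinAt

theorem dependsOn_integrateOut (v : Finset ι) (g : (ι → ℝ) → ℝ) :
    DependsOn (integrateOut v g) (v : Set ι) := by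
  intro x y h
  have : (fun j : {j // j ∈ v} => x j) = fun j : {j // j ∈ v} => y j :=
    funext fun j => h j j.2
  rw [integrateOut, integrateOut, this]

theorem dependsOn_update {g : (ι → ℝ) → ℝ} {v : Finset ι} (hg : DependsOn g (v : Set ι)) {j : ι}
    (hj : j ∉ v) (x : ι → ℝ) (t : ℝ) : g (Function.update x j t) = g x :=
  hg fun i hi => Function.update_of_ne (by rintro rfl; exact hj hi) _ _

/-- Tensor functions that depend only on the variables in `v` can be integrated against `g` or
against its partial integral. -/
theorem integral_integrateOut_mul {v : Finset ι} {g P : (ι → ℝ) → ℝ}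
    (hg : ContinuousOn g (Set.Icc 0 1)) (hP : BddMeas P) (hPv : DependsOn P (v : Set ι)) :
    ∫ x, integrateOut v g x * P x ∂(cubeMeasure ι) = ∫ x, g x * P x ∂(cubeMeasure ι) := by
  rw [integral_glue (integrable_mul_of_continuousOn (continuousOn_integrateOut v hg) hP) v,
    integral_glue (integrable_mul_of_continuousOn hg hP) v]
  refine integral_congr_ae (Filter.Eventually.of_forall fun x => ?_)
  dsimp only
  have e1 : ∀ y, P (glue v x y) = P (glue v x 0) := fun y => hPv fun i hi => by
    have : i ∈ v := hi
    simp [glue, this]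
  have e2 : ∀ y, integrateOut v g (glue v x y) = integrateOut v g (glue v x 0) := fun y =>
    dependsOn_integrateOut v g fun i hi => by
      have : i ∈ v := hi
      simp [glue, this]
  have e3 : integrateOut v g (glue v x 0) = ∫ y, g (glue v x y) ∂(cubeMeasure {j // j ∉ v}) := by
    rw [integrateOut, partialIntegral_eq]
    have : (fun j : {j // j ∈ v} => glue v x 0 j) = x := by funext j; simp [glue]
    rw [this]
  simp only [e1, e2]
  rw [integral_mul_const, integral_mul_const, integral_const, e3, probReal_univ, one_smul]

end PartialIntegral

section Anova

variable {s : ℕ}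

/-- The partial integral of a smooth function is smooth; it has no derivatives in the directions
that are integrated out, hence the zeros. -/
theorem DerivFamily.integrateOut {α : ℕ} {D : (Fin s → ℕ) → (Fin s → ℝ) → ℝ}
    (hD : DerivFamily α D) (v : Finset (Fin s)) :
    DerivFamily α fun β => if ∀ j, j ∉ v → β j = 0 then MedianNet.integrateOut v (D β) else 0 := by
  refine ⟨fun β hβ => ?_, fun β hβ j hj x hx => ?_⟩
  · split_ifs
    · exact continuousOn_integrateOut v (hD.cont β hβ)
    · exact continuousOn_const
  · have hle : ∀ i, Function.update β j (β j + 1) i ≤ α := by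
      intro i
      by_cases h : i = j
      · subst h; simpa using hj
      · simpa [h] using hβ i
    by_cases h : ∀ i, i ∉ v → β i = 0
    · by_cases hjv : j ∈ v
      · have h' : ∀ i, i ∉ v → Function.update β j (β j + 1) i = 0 := by
          intro i hi
          rw [Function.update_of_ne (by rintro rfl; exact hi hjv)]
          exact h i hi
        rw [if_pos h, if_pos h']
        exact hasDerivWithinAt_integrateOut hjv (hD.cont β hβ) (hD.cont _ hle)
          (hD.deriv β hβ j hj) hx
      · have h' : ¬ ∀ i, i ∉ v → Function.update β j (β j + 1) i = 0 := by
          intro h'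
          simpa using h' j hjv
        rw [if_pos h, if_neg h']
        simp only [dependsOn_update (dependsOn_integrateOut v (D β)) hjv x]
        exact hasDerivWithinAt_const _ _ _
    · have h' : ¬ ∀ i, i ∉ v → Function.update β j (β j + 1) i = 0 := by
        intro h'
        refine h fun i hi => ?_
        have := h' i hi
        by_cases hij : i = j
        · subst hij; simp at this
        · simpa [hij] using this
      rw [if_neg h, if_neg h']
      exact hasDerivWithinAt_const _ _ _

theorem anova_eq (f : (Fin s → ℝ) → ℝ) (u : Finset (Fin s)) (x : Fin s → ℝ) :
    anova f u x = integrateOut u f x - ∑ v ∈ u.ssubsets, anova f v x := by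
  rw [anova, integrateOut, Finset.sum_attach u.ssubsets fun v => anova f v x]

theorem dependsOn_anova (f : (Fin s → ℝ) → ℝ) (u : Finset (Fin s)) :
    DependsOn (anova f u) (u : Set (Fin s)) := by
  induction u using Finset.strongInduction with
  | H u ih =>
    intro x y h
    rw [anova_eq, anova_eq, dependsOn_integrateOut u f h]
    congr 1
    refine Finset.sum_congr rfl fun v hv => ?_
    rw [Finset.mem_ssubsets] at hv
    exact ih v hv fun i hi => h i (hv.1 hi)

theorem MixedSmooth.anova {α : ℕ} {f : (Fin s → ℝ) → ℝ} (hf : MixedSmooth α f)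
    (u : Finset (Fin s)) : MixedSmooth α (anova f u) := by
  induction u using Finset.strongInduction with
  | H u ih =>
    have h1 := hf.derivFamily.integrateOut u
    have h2 := DerivFamily.sum (α := α) u.ssubsets.attach
      (D := fun v β => mixedDeriv β (MedianNet.anova f v.1))
      fun v _ => (ih v.1 (Finset.mem_ssubsets.1 v.2)).derivFamily
    refine (h1.sub h2).mixedSmooth fun x _ => ?_
    simp only [mixedDeriv_zero, Pi.zero_apply, implies_true, if_true]
    rw [anova_eq, Finset.sum_attach u.ssubsets fun v => MedianNet.anova f v x]

theorem dependsOn_mixedDeriv {g : (Fin s → ℝ) → ℝ} {u : Finset (Fin s)}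
    (hg : DependsOn g (u : Set (Fin s))) {β : Fin s → ℕ} (hβ : ∀ j, j ∉ u → β j = 0) :
    DependsOn (mixedDeriv β g) (u : Set (Fin s)) := by
  have h1 : ∀ (j : Fin s) (h : (Fin s → ℝ) → ℝ), j ∈ u → DependsOn h (u : Set (Fin s)) →
      DependsOn (partialDeriv j h) (u : Set (Fin s)) := by
    intro j h hj hh x y hxy
    have : (fun t : ℝ => h (Function.update x j t)) = fun t => h (Function.update y j t) := by
      funext t
      refine hh fun i hi => ?_
      by_cases hij : i = j
      · subst hij; simp
      · simp [hij, hxy i hi]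
    rw [partialDeriv, partialDeriv, this, hxy j hj]
  have h2 : ∀ (j : Fin s) (n : ℕ) (h : (Fin s → ℝ) → ℝ), j ∈ u → DependsOn h (u : Set (Fin s)) →
      DependsOn ((partialDeriv j)^[n] h) (u : Set (Fin s)) := by
    intro j n h hj hh
    induction n with
    | zero => simpa using hh
    | succ n ih => rw [Function.iterate_succ_apply']; exact h1 j _ hj ih
  have key : ∀ L : List (Fin s),
      DependsOn (L.foldr (fun j h => (partialDeriv j)^[β j] h) g) (u : Set (Fin s)) := by
    intro L
    induction L with
    | nil => exact hg
    | cons j L ih =>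
      rw [List.foldr_cons]
      by_cases hj : j ∈ u
      · exact h2 j _ _ hj ih
      · rw [hβ j hj]; exact ih
  exact key _

/-- The integral of `f` against a tensor product whose nonconstant factors have mean zero and
occupy exactly the coordinates in `u` only sees the ANOVA component `f_u`. -/
theorem integral_anova {f : (Fin s → ℝ) → ℝ} (hf : MixedSmooth 0 f)
    {u : Finset (Fin s)} {ψ : Fin s → ℝ → ℝ} (hψ : ∀ i, BddMeas (ψ i))
    (h0 : ∀ j ∈ u, ∫ t in (0 : ℝ)..1, ψ j t = 0) (h1 : ∀ j, j ∉ u → ψ j = fun _ => 1) :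
    ∫ x, f x * ∏ i, ψ i (x i) ∂(cubeMeasure (Fin s))
      = ∫ x, anova f u x * ∏ i, ψ i (x i) ∂(cubeMeasure (Fin s)) := by
  have hc : ∀ v, ContinuousOn (anova f v) (Set.Icc 0 1) := fun v => by
    simpa [mixedDeriv_zero] using (hf.anova v).continuousOn 0 (by simp)
  have hfc : ContinuousOn f (Set.Icc 0 1) := by
    simpa [mixedDeriv_zero] using hf.continuousOn 0 (by simp)
  have hP := bddMeas_tensor hψ
  have hdep : DependsOn (fun x : Fin s → ℝ => ∏ i, ψ i (x i)) (u : Set (Fin s)) := by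
    intro x y hxy
    refine Finset.prod_congr rfl fun i _ => ?_
    by_cases hi : i ∈ u
    · rw [hxy i hi]
    · rw [h1 i hi]
  simp only [anova_eq f u, sub_mul, Finset.sum_mul]
  rw [integral_sub (integrable_mul_of_continuousOn (continuousOn_integrateOut u hfc) hP)
      (integrable_finsetSum _ fun v _ => integrable_mul_of_continuousOn (hc v) hP),
    integral_integrateOut_mul hfc hP hdep,
    integral_finsetSum _ fun v _ => integrable_mul_of_continuousOn (hc v) hP,
    Finset.sum_eq_zero, sub_zero]
  intro v hv
  rw [Finset.mem_ssubsets] at hv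
  obtain ⟨j, hju, hjv⟩ := Finset.exists_of_ssubset hv
  exact integral_tensor_eq_zero j (hc v) (fun x t => dependsOn_update (dependsOn_anova f v) hjv x t) hψ
    (h0 j hju)

end Anova

/-! ### Product partitions and the Vitali variation -/

section Grid

/-- Intervals of the partition of `[0,1)` by the points `y + i δ`, `0 ≤ i < N`. -/
noncomputable def gridInterval (δ y : ℝ) (i : ℕ) : ℝ × ℝ :=
  (max 0 (y + (i - 1) * δ), min 1 (y + i * δ))

theorem gridInterval_lt {N : ℕ} {δ y : ℝ} (hδ : 0 < δ) (hN : N * δ = 1) (hy : 0 < y) (hy' : y < δ)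
    {i : ℕ} (hi : i ≤ N) : (gridInterval δ y i).1 < (gridInterval δ y i).2 := by
  have h1 : (i : ℝ) * δ ≤ N * δ := by gcongr
  have h2 : 0 ≤ (i : ℝ) * δ := by positivity
  simp only [gridInterval, max_lt_iff, lt_min_iff]
  refine ⟨⟨zero_lt_one, by linarith⟩, by linarith, by linarith⟩

theorem eq_of_mem_gridInterval {δ y t : ℝ} (hδ : 0 < δ) {i i' : ℕ}
    (h : (gridInterval δ y i).1 ≤ t ∧ t < (gridInterval δ y i).2)
    (h' : (gridInterval δ y i').1 ≤ t ∧ t < (gridInterval δ y i').2) : i = i' := by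
  simp only [gridInterval, max_le_iff, lt_min_iff] at h h'
  have key : ∀ a b : ℕ, y + ((a : ℝ) - 1) * δ ≤ t → t < y + b * δ → a ≤ b := by
    intro a b h1 h2
    have : ((a : ℝ) - 1) * δ < b * δ := by linarith
    have := lt_of_mul_lt_mul_right this hδ.le
    have : (a : ℝ) < b + 1 := by linarith
    exact Nat.lt_succ_iff.1 (by exact_mod_cast this)
  exact le_antisymm (key _ _ h.1.2 h'.2.2) (key _ _ h'.1.2 h.2.2)

theorem exists_mem_gridInterval {N : ℕ} {δ y t : ℝ} (hδ : 0 < δ) (hN : N * δ = 1)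
    (hy : 0 < y) (hy' : y < δ) :
    (∃ i ≤ N, (gridInterval δ y i).1 ≤ t ∧ t < (gridInterval δ y i).2) ↔ 0 ≤ t ∧ t < 1 := by
  constructor
  · rintro ⟨i, -, h⟩
    simp only [gridInterval, max_le_iff, lt_min_iff] at h
    exact ⟨h.1.1, h.2.1⟩
  · rintro ⟨h0, h1⟩
    set i := ⌊(t - y) / δ + 1⌋₊ with hi
    have hpos : 0 ≤ (t - y) / δ + 1 := by
      have : -1 ≤ (t - y) / δ := by rw [le_div_iff₀ hδ]; linarith
      linarith
    have e1 : (i : ℝ) ≤ (t - y) / δ + 1 := Nat.floor_le hpos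
    have e2 : (t - y) / δ + 1 < i + 1 := Nat.lt_floor_add_one _
    have e3 : ((i : ℝ) - 1) * δ ≤ t - y := by rw [← le_div_iff₀ hδ]; linarith
    have e4 : t - y < i * δ := by rw [← div_lt_iff₀ hδ]; linarith
    refine ⟨i, ?_, ?_, ?_⟩
    · have : ((i : ℝ) - 1) * δ < N * δ := by linarith
      have := lt_of_mul_lt_mul_right this hδ.le
      have : (i : ℝ) < N + 1 := by linarith
      exact Nat.lt_succ_iff.1 (by exact_mod_cast this)
    · simp only [gridInterval, max_le_iff]; exact ⟨h0, by linarith⟩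
    · simp only [gridInterval, lt_min_iff]; exact ⟨h1, by linarith⟩

variable {ι : Type*} [Fintype ι] [DecidableEq ι]

/-- The box of the product grid with index `e`. -/
noncomputable def gridBox (δ y : ι → ℝ) (e : ι → ℕ) : (ι → ℝ) × (ι → ℝ) :=
  (fun j => (gridInterval (δ j) (y j) (e j)).1, fun j => (gridInterval (δ j) (y j) (e j)).2)

theorem gridBox_partition {N : ι → ℕ} {δ y : ι → ℝ} (hδ : ∀ j, 0 < δ j)
    (hN : ∀ j, N j * δ j = 1) (hy : ∀ j, 0 < y j) (hy' : ∀ j, y j < δ j) :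
    IsBoxPartition
      ((Fintype.piFinset fun j => Finset.range (N j + 1)).image (gridBox δ y)) := by
  refine ⟨?_, ?_, ?_⟩
  · intro J hJ j
    obtain ⟨e, he, rfl⟩ := Finset.mem_image.1 hJ
    rw [Fintype.mem_piFinset] at he
    exact gridInterval_lt (hδ j) (hN j) (hy j) (hy' j) (Nat.lt_succ_iff.1 (Finset.mem_range.1 (he j)))
  · intro J hJ J' hJ' hne
    obtain ⟨e, he, rfl⟩ := Finset.mem_image.1 hJ
    obtain ⟨e', he', rfl⟩ := Finset.mem_image.1 hJ'
    rw [Set.disjoint_left]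
    intro x hx hx'
    refine hne (congrArg _ (funext fun j => ?_))
    exact eq_of_mem_gridInterval (hδ j) (hx j) (hx' j)
  · ext x
    simp only [Set.mem_iUnion, Finset.mem_image, exists_prop, exists_exists_and_eq_and,
      Fintype.mem_piFinset, Finset.mem_range, Nat.lt_succ_iff]
    constructor
    · rintro ⟨e, he, hx⟩ j
      exact (exists_mem_gridInterval (hδ j) (hN j) (hy j) (hy' j)).1 ⟨e j, he j, hx j⟩
    · intro hx
      have := fun j => (exists_mem_gridInterval (hδ j) (hN j) (hy j) (hy' j)).2 (hx j)
      choose e he h1 using this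
      exact ⟨e, he, h1⟩

theorem sum_le_vitali {lam : ℝ} {h : (ι → ℝ) → ℝ} (hV : vitali lam h < ⊤)
    {Q : Finset ((ι → ℝ) × (ι → ℝ))} (hQ : IsBoxPartition Q) :
    ∑ J ∈ Q, boxVol J * |altSum h J / boxVol J ^ lam| ^ 2 ≤ (vitali lam h).toReal ^ 2 := by
  have h1 : ENNReal.ofReal (Real.sqrt (∑ J ∈ Q, boxVol J * |altSum h J / boxVol J ^ lam| ^ 2))
      ≤ vitali lam h := by
    unfold vitali
    exact le_iSup₂_of_le Q hQ le_rfl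
  have h2 := (ENNReal.ofReal_le_iff_le_toReal hV.ne).1 h1
  exact (Real.sqrt_le_left ENNReal.toReal_nonneg).1 h2

/-- The alternating sums over a family of congruent boxes, translated by a common offset `y`, are
controlled by the variation. -/
theorem sum_altSum_sq_le {lam : ℝ} {h : (ι → ℝ) → ℝ} (hV : vitali lam h < ⊤) {n : ι → ℕ}
    {δ y : ι → ℝ} (hδ : ∀ j, 0 < δ j) (hn : ∀ j, (2 * n j : ℕ) * δ j = 1) (hy : ∀ j, 0 < y j)
    (hy' : ∀ j, y j < δ j) :
    ∑ c ∈ Fintype.piFinset fun j => Finset.range (n j),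
      altSum h (fun j => (2 * c j : ℕ) * δ j + y j, fun j => (2 * c j + 1 : ℕ) * δ j + y j) ^ 2
      ≤ (vitali lam h).toReal ^ 2 * (∏ j, δ j) ^ (2 * lam - 1) := by
  set v := ∏ j, δ j with hv
  have hvpos : 0 < v := Finset.prod_pos fun j _ => hδ j
  have hbox : ∀ c ∈ Fintype.piFinset fun j => Finset.range (n j),
      gridBox δ y (fun j => 2 * c j + 1)
        = (fun j => (2 * c j : ℕ) * δ j + y j, fun j => (2 * c j + 1 : ℕ) * δ j + y j) := by
    intro c hc
    rw [Fintype.mem_piFinset] at hc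
    have e1 : ∀ j, (gridInterval (δ j) (y j) (2 * c j + 1)).1 = (2 * c j : ℕ) * δ j + y j := by
      intro j
      have : 0 ≤ ((2 * c j : ℕ) : ℝ) * δ j + y j :=
        add_nonneg (mul_nonneg (Nat.cast_nonneg _) (hδ j).le) (hy j).le
      simp only [gridInterval]
      rw [max_eq_right] <;> push_cast at * <;> linarith
    have e2 : ∀ j, (gridInterval (δ j) (y j) (2 * c j + 1)).2 = (2 * c j + 1 : ℕ) * δ j + y j := by
      intro j
      have h1 : ((2 * c j + 2 : ℕ) : ℝ) * δ j ≤ (2 * n j : ℕ) * δ j := by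
        have := Finset.mem_range.1 (hc j)
        gcongr
        · exact (hδ j).le
        · omega
      rw [hn j] at h1
      simp only [gridInterval]
      rw [min_eq_right]
      · ring
      · push_cast at *; linarith [hy' j]
    simp only [gridBox, e1, e2]
  have hvol : ∀ c : ι → ℕ,
      boxVol (fun j => (2 * c j : ℕ) * δ j + y j, fun j => (2 * c j + 1 : ℕ) * δ j + y j) = v := by
    intro c
    rw [boxVol, hv]
    refine Finset.prod_congr rfl fun j _ => ?_
    push_cast; ring
  have hQ := gridBox_partition (N := fun j => 2 * n j) hδ hn hy hy'
  have h1 := sum_le_vitali hV hQ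
  have hinj : Set.InjOn (fun c : ι → ℕ => gridBox δ y (fun j => 2 * c j + 1))
      (Fintype.piFinset fun j => Finset.range (n j) : Finset (ι → ℕ)) := by
    intro c hc c' hc' he
    simp only [hbox c hc, hbox c' hc', Prod.mk.injEq] at he
    funext j
    have := congrFun he.1 j
    have h3 : ((2 * c j : ℕ) : ℝ) * δ j = (2 * c' j : ℕ) * δ j := by linarith
    have := mul_right_cancel₀ (hδ j).ne' h3
    have : 2 * c j = 2 * c' j := by exact_mod_cast this
    omega
  have h2 : ∑ c ∈ Fintype.piFinset fun j => Finset.range (n j),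
      v * |altSum h (fun j => (2 * c j : ℕ) * δ j + y j, fun j => (2 * c j + 1 : ℕ) * δ j + y j)
        / v ^ lam| ^ 2
      ≤ (vitali lam h).toReal ^ 2 := by
    refine le_trans ?_ h1
    have hsub : (Fintype.piFinset fun j => Finset.range (n j)).image
        (fun c : ι → ℕ => gridBox δ y (fun j => 2 * c j + 1))
        ⊆ (Fintype.piFinset fun j => Finset.range (2 * n j + 1)).image (gridBox δ y) := by
      intro J hJ
      obtain ⟨c, hc, rfl⟩ := Finset.mem_image.1 hJ
      rw [Fintype.mem_piFinset] at hc
      refine Finset.mem_image_of_mem _ (Fintype.mem_piFinset.2 fun j => ?_)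
      have := Finset.mem_range.1 (hc j)
      exact Finset.mem_range.2 (by omega)
    refine le_trans (le_of_eq ?_) (Finset.sum_le_sum_of_subset_of_nonneg hsub fun J hJ _ => ?_)
    · rw [Finset.sum_image hinj]
      refine Finset.sum_congr rfl fun c hc => ?_
      rw [hbox c hc, hvol c]
    · refine mul_nonneg (Finset.prod_nonneg fun j _ => ?_) (by positivity)
      exact sub_nonneg.2 (hQ.lt J hJ j).le
  have e : v ^ (2 * lam - 1) = (v ^ lam) ^ 2 / v := by
    rw [Real.rpow_sub hvpos, Real.rpow_one, mul_comm, Real.rpow_mul hvpos.le, Real.rpow_two]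
  rw [e, mul_div_assoc']
  rw [le_div_iff₀ hvpos, ← div_le_iff₀ (by positivity), Finset.sum_mul, Finset.sum_div]
  refine le_trans (le_of_eq (Finset.sum_congr rfl fun c _ => ?_)) h2
  rw [sq_abs, div_pow]; ring

end Grid

section Decomposition

variable {ι : Type*} [Fintype ι] [DecidableEq ι]

theorem cubeMeasure_eq_Ico :
    cubeMeasure ι = volume.restrict (Set.univ.pi fun _ : ι => Set.Ico (0 : ℝ) 1) := by
  rw [volume_pi, Measure.restrict_pi_pi, cubeMeasure]
  simp only [unitMeasure, Measure.restrict_congr_set (Ico_ae_eq_Icc (μ := volume) (a := (0 : ℝ)) (b := 1))]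

/-- The cube is tiled by the translates of a small box. -/
theorem integral_cube_eq_sum {N : ι → ℕ} {δ : ι → ℝ} (hδ : ∀ j, 0 < δ j)
    (hN : ∀ j, N j * δ j = 1) {F : (ι → ℝ) → ℝ} (hF : Integrable F (cubeMeasure ι)) :
    ∫ x, F x ∂(cubeMeasure ι) = ∑ e ∈ Fintype.piFinset fun j => Finset.range (N j),
      ∫ y in Set.univ.pi fun j => Set.Ico 0 (δ j), F (fun j => e j * δ j + y j) := by
  have hcover : (Set.univ.pi fun _ : ι => Set.Ico (0 : ℝ) 1)
      = ⋃ e ∈ Fintype.piFinset fun j => Finset.range (N j),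
        Set.univ.pi fun j => Set.Ico ((e j : ℝ) * δ j) (e j * δ j + δ j) := by
    ext x
    simp only [Set.mem_pi, Set.mem_univ, true_implies, Set.mem_iUnion, Fintype.mem_piFinset,
      exists_prop, Finset.mem_range, Set.mem_Ico]
    constructor
    · intro hx
      refine ⟨fun j => ⌊x j / δ j⌋₊, fun j => ?_, fun j => ⟨?_, ?_⟩⟩
      · rw [Nat.floor_lt (div_nonneg (hx j).1 (hδ j).le), div_lt_iff₀ (hδ j), hN j]
        exact (hx j).2
      · rw [← le_div_iff₀ (hδ j)]
        exact Nat.floor_le (div_nonneg (hx j).1 (hδ j).le)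
      · have := Nat.lt_floor_add_one (x j / δ j)
        rw [div_lt_iff₀ (hδ j)] at this
        linarith
    · rintro ⟨e, he, hx⟩ j
      refine ⟨le_trans (mul_nonneg (Nat.cast_nonneg _) (hδ j).le) (hx j).1, (hx j).2.trans_le ?_⟩
      have : ((e j + 1 : ℕ) : ℝ) * δ j ≤ N j * δ j := by
        have := he j
        gcongr
        · exact (hδ j).le
        · omega
      rw [hN j] at this
      push_cast at this
      linarith
  have hI : IntegrableOn F (Set.univ.pi fun _ : ι => Set.Ico (0 : ℝ) 1) := by
    rw [IntegrableOn, ← cubeMeasure_eq_Ico]; exact hF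
  rw [cubeMeasure_eq_Ico, hcover, integral_biUnion_finset]
  · refine Finset.sum_congr rfl fun e _ => ?_
    have := (measurePreserving_add_left (volume : Measure (ι → ℝ))
      (fun j => (e j : ℝ) * δ j)).setIntegral_preimage_emb (measurableEmbedding_addLeft _) F
      (Set.univ.pi fun j => Set.Ico ((e j : ℝ) * δ j) (e j * δ j + δ j))
    rw [← this]
    have hpre : (fun x : ι → ℝ => (fun j => (e j : ℝ) * δ j) + x) ⁻¹'
        (Set.univ.pi fun j => Set.Ico ((e j : ℝ) * δ j) (e j * δ j + δ j))
        = Set.univ.pi fun j => Set.Ico 0 (δ j) := by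
      ext x
      simp [Set.mem_pi]
    rw [hpre]
    rfl
  · exact fun e _ => MeasurableSet.univ_pi fun j => measurableSet_Ico
  · intro e _ e' _ hne
    simp only [Function.onFun]
    rw [Set.disjoint_left]
    intro x hx hx'
    refine hne (funext fun j => ?_)
    have key : ∀ a b : ℕ, (a : ℝ) * δ j ≤ x j → x j < b * δ j + δ j → a ≤ b := by
      intro a b h1 h2
      have : (a : ℝ) * δ j < (b + 1) * δ j := by linarith
      have := lt_of_mul_lt_mul_right this (hδ j).le
      exact Nat.lt_succ_iff.1 (by exact_mod_cast this)
    have h1 := hx j (Set.mem_univ j)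
    have h2 := hx' j (Set.mem_univ j)
    exact le_antisymm (key _ _ h1.1 h2.2) (key _ _ h2.1 h1.2)
  · intro e he
    refine hI.mono_set ?_
    rw [hcover]
    exact Set.subset_biUnion_of_mem (u := fun e : ι → ℕ =>
      Set.univ.pi fun j => Set.Ico ((e j : ℝ) * δ j) (e j * δ j + δ j)) he

theorem sum_parity_split {n : ι → ℕ} (G : (ι → ℕ) → ℝ) :
    ∑ e ∈ Fintype.piFinset fun j => Finset.range (2 * n j), G e
      = ∑ c ∈ Fintype.piFinset fun j => Finset.range (n j), ∑ v : Finset ι,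
        G fun j => if j ∈ v then 2 * c j else 2 * c j + 1 := by
  rw [← Finset.sum_product']
  refine Finset.sum_nbij' (fun e => (fun j => e j / 2, Finset.univ.filter fun j => e j % 2 = 0))
    (fun p j => if j ∈ p.2 then 2 * p.1 j else 2 * p.1 j + 1) ?_ ?_ ?_ ?_ ?_
  · intro e he
    simp only [Finset.mem_product, Fintype.mem_piFinset, Finset.mem_range, Finset.mem_univ,
      and_true] at he ⊢
    intro j
    have := he j
    omega
  · rintro ⟨c, v⟩ hp
    simp only [Finset.mem_product, Fintype.mem_piFinset, Finset.mem_range, Finset.mem_univ,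
      and_true] at hp ⊢
    intro j
    have := hp j
    split_ifs <;> omega
  · intro e _
    funext j
    simp only [Finset.mem_filter, Finset.mem_univ, true_and]
    split_ifs <;> omega
  · rintro ⟨c, v⟩ _
    simp only [Prod.mk.injEq]
    constructor
    · funext j; split_ifs <;> omega
    · ext j
      simp only [Finset.mem_filter, Finset.mem_univ, true_and]
      split_ifs with h <;> simp [h]
  · intro e _
    congr 1
    funext j
    simp only [Finset.mem_filter, Finset.mem_univ, true_and]
    split_ifs <;> omega

/-! ### Finite Parseval identity for Walsh functions -/

theorem rad_nat_grid {l i : ℕ} (h : i < l) (c : ℕ) :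
    rad i (c * (2 : ℝ)⁻¹ ^ l) = if c.testBit (l - 1 - i) then -1 else 1 := by
  obtain ⟨d, rfl⟩ : ∃ d, l = i + 1 + d := ⟨l - (i + 1), by omega⟩
  have e1 : (2 : ℝ) ^ (i + 1) * (c * (2 : ℝ)⁻¹ ^ (i + 1 + d)) = (c : ℝ) / ((2 ^ d : ℕ) : ℝ) := by
    rw [pow_add (2 : ℝ)⁻¹, inv_pow, inv_pow]; push_cast; field_simp
  have e2 : i + 1 + d - 1 - i = d := by omega
  rw [rad, e1, Int.floor_div_natCast, Int.floor_natCast, e2, Nat.testBit_eq_decide_div_mod_eq]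
  norm_cast
  rcases Nat.mod_two_eq_zero_or_one (c / 2 ^ d) with h | h
  · simp [h, (Nat.even_iff.2 h).neg_one_pow]
  · simp [h, (Nat.odd_iff.2 h).neg_one_pow]

/-- Orthogonality of the rows of the Walsh matrix of order `2 ^ l`. -/
theorem sum_wal_mul_wal {l c c' : ℕ} (hc : c < 2 ^ l) (hc' : c' < 2 ^ l) :
    ∑ R ∈ (Finset.range l).powerset, wal R (c * (2 : ℝ)⁻¹ ^ l) * wal R (c' * (2 : ℝ)⁻¹ ^ l)
      = if c = c' then 2 ^ l else 0 := by
  simp only [wal, ← Finset.prod_mul_distrib]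
  rw [← Finset.prod_one_add]
  split_ifs with h
  · subst h
    simp only [rad_mul_self]
    norm_num
  · obtain ⟨k, hk⟩ : ∃ k, c.testBit k ≠ c'.testBit k := by
      by_contra! H
      exact h (Nat.eq_of_testBit_eq H)
    have hkl : k < l := by
      by_contra! H
      have h2 : 2 ^ l ≤ 2 ^ k := Nat.pow_le_pow_right (by norm_num) H
      exact hk (by rw [Nat.testBit_eq_false_of_lt (hc.trans_le h2),
        Nat.testBit_eq_false_of_lt (hc'.trans_le h2)])
    refine Finset.prod_eq_zero (i := l - 1 - k) (Finset.mem_range.2 (by omega)) ?_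
    have e : l - 1 - (l - 1 - k) = k := by omega
    rw [rad_nat_grid (by omega), rad_nat_grid (by omega), e]
    cases h1 : c.testBit k <;> cases h2 : c'.testBit k <;> simp_all

theorem parseval_wal (l : ι → ℕ) (a : (ι → ℕ) → ℝ) :
    ∑ R ∈ Fintype.piFinset fun j => (Finset.range (l j)).powerset,
      (∑ c ∈ Fintype.piFinset fun j => Finset.range (2 ^ l j),
        (∏ j, wal (R j) (c j * (2 : ℝ)⁻¹ ^ l j)) * a c) ^ 2
      = (∏ j, (2 : ℝ) ^ l j) * ∑ c ∈ Fintype.piFinset fun j => Finset.range (2 ^ l j), a c ^ 2 := by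
  simp only [pow_two (Finset.sum _ _), Finset.sum_mul_sum]
  rw [Finset.sum_comm, Finset.mul_sum]
  refine Finset.sum_congr rfl fun c hc => ?_
  rw [Finset.sum_comm]
  rw [Fintype.mem_piFinset] at hc
  rw [Finset.sum_eq_single c]
  · have : ∀ R : ι → Finset ℕ, (∏ j, wal (R j) (c j * (2 : ℝ)⁻¹ ^ l j)) * a c
        * ((∏ j, wal (R j) (c j * (2 : ℝ)⁻¹ ^ l j)) * a c) = (∏ j, wal (R j) (c j * (2 : ℝ)⁻¹ ^ l j)
          * wal (R j) (c j * (2 : ℝ)⁻¹ ^ l j)) * a c ^ 2 := by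
      intro R; rw [Finset.prod_mul_distrib]; ring
    simp only [this]
    rw [← Finset.sum_mul, ← Finset.prod_univ_sum (fun j => (Finset.range (l j)).powerset)
      fun j R => wal R (c j * (2 : ℝ)⁻¹ ^ l j) * wal R (c j * (2 : ℝ)⁻¹ ^ l j)]
    congr 1
    refine Finset.prod_congr rfl fun j _ => ?_
    rw [sum_wal_mul_wal (Finset.mem_range.1 (hc j)) (Finset.mem_range.1 (hc j)), if_pos rfl]
  · intro c' hc' hne
    rw [Fintype.mem_piFinset] at hc'
    have : ∀ R : ι → Finset ℕ, (∏ j, wal (R j) (c j * (2 : ℝ)⁻¹ ^ l j)) * a c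
        * ((∏ j, wal (R j) (c' j * (2 : ℝ)⁻¹ ^ l j)) * a c')
        = (∏ j, wal (R j) (c j * (2 : ℝ)⁻¹ ^ l j)
          * wal (R j) (c' j * (2 : ℝ)⁻¹ ^ l j)) * (a c * a c') := by
      intro R; rw [Finset.prod_mul_distrib]; ring
    simp only [this]
    rw [← Finset.sum_mul, ← Finset.prod_univ_sum (fun j => (Finset.range (l j)).powerset)
      fun j R => wal R (c j * (2 : ℝ)⁻¹ ^ l j) * wal R (c' j * (2 : ℝ)⁻¹ ^ l j)]
    obtain ⟨j, hj⟩ := Function.ne_iff.1 hne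
    rw [Finset.prod_eq_zero (Finset.mem_univ j), zero_mul]
    rw [sum_wal_mul_wal (Finset.mem_range.1 (hc j)) (Finset.mem_range.1 (hc' j)), if_neg hj.symm]
  · intro h
    exact absurd (Fintype.mem_piFinset.2 hc) h

end Decomposition

/-! ### Walsh coefficients and fractional variation -/

/-- Jensen's inequality for the square with respect to a weight `w`. -/
theorem sq_integral_mul_le {X : Type*} [MeasurableSpace X] {μ : Measure X} [IsFiniteMeasure μ]
    {w S : X → ℝ} (hw : BddMeas w) (hS : BddMeas S) (h0 : ∀ x, 0 ≤ w x) (hI : 0 < ∫ x, w x ∂μ) :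
    (∫ x, w x * S x ∂μ) ^ 2 ≤ (∫ x, w x ∂μ) * ∫ x, w x * S x ^ 2 ∂μ := by
  set I := ∫ x, w x ∂μ
  set m := ∫ x, w x * S x ∂μ with hm
  have hS2 : BddMeas fun x => w x * S x ^ 2 := by
    have := hw.mul (hS.mul hS)
    simpa only [← pow_two] using this
  have h1 : 0 ≤ ∫ x, w x * (S x - m / I) ^ 2 ∂μ :=
    integral_nonneg fun x => mul_nonneg (h0 x) (sq_nonneg _)
  have h2 : ∀ x, w x * (S x - m / I) ^ 2
      = w x * S x ^ 2 - 2 * (m / I) * (w x * S x) + (m / I) ^ 2 * w x := fun x => by ring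
  simp only [h2] at h1
  rw [integral_add, integral_sub, integral_const_mul, integral_const_mul, ← hm] at h1
  · have h3 : (m / I) * I = m := div_mul_cancel₀ _ hI.ne'
    have h4 : m / I * m ≤ ∫ x, w x * S x ^ 2 ∂μ := by
      have : (m / I) ^ 2 * ∫ x, w x ∂μ = m / I * m := by
        rw [pow_two, mul_assoc]; exact congrArg _ h3
      rw [this] at h1
      linarith
    calc m ^ 2 = I * (m / I * m) := by rw [← mul_assoc, mul_comm I, h3, pow_two]
      _ ≤ _ := by gcongr
  · exact hS2.integrable μ
  · exact ((hw.mul hS).integrable μ).const_mul _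
  · exact (hS2.integrable μ).sub (((hw.mul hS).integrable μ).const_mul _)
  · exact (hw.integrable μ).const_mul _

theorem prod_sign {ι : Type*} [Fintype ι] [DecidableEq ι] (v : Finset ι) :
    ∏ j, (if j ∈ v then (1 : ℝ) else -1) = (-1) ^ (Fintype.card ι - v.card) := by
  rw [Finset.prod_ite]
  simp only [Finset.prod_const_one, one_mul, Finset.prod_const]
  congr 1
  rw [← Finset.card_compl]
  congr 1
  ext; simp

theorem wal_insert_grid {l : ℕ} {R : Finset ℕ} (hR : R ⊆ Finset.range l) (c b : ℕ) (hb : b ≤ 1)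
    {y : ℝ} (hy : 0 ≤ y) (hy' : y < (2 : ℝ)⁻¹ ^ (l + 1)) :
    wal (insert l R) ((2 * c + b : ℕ) * (2 : ℝ)⁻¹ ^ (l + 1) + y)
      = wal R (c * (2 : ℝ)⁻¹ ^ l) * (-1) ^ b := by
  have hl : l ∉ R := fun h => by simpa using hR h
  have e2 : (2 : ℝ)⁻¹ ^ l = 2 * (2 : ℝ)⁻¹ ^ (l + 1) := by rw [pow_succ]; ring
  have e1 : ((2 * c + b : ℕ) : ℝ) * (2 : ℝ)⁻¹ ^ (l + 1) + y
      = ((c : ℤ) : ℝ) * (2 : ℝ)⁻¹ ^ l + (b * (2 : ℝ)⁻¹ ^ (l + 1) + y) := by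
    rw [e2]; push_cast; ring
  have e3 : rad l (((2 * c + b : ℕ) : ℝ) * (2 : ℝ)⁻¹ ^ (l + 1) + y) = (-1) ^ b := by
    have := rad_cell (Nat.lt_succ_self l) ((2 * c + b : ℕ) : ℤ) hy hy'
    rw [Int.cast_natCast] at this
    rw [this, ← Int.cast_natCast (R := ℝ), rad_grid, zpow_natCast, pow_add, pow_mul]
    simp
  have e4 : wal R (((2 * c + b : ℕ) : ℝ) * (2 : ℝ)⁻¹ ^ (l + 1) + y) = wal R (c * (2 : ℝ)⁻¹ ^ l) := by
    have hb' : (b : ℝ) ≤ 1 := by exact_mod_cast hb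
    have h0 : (0 : ℝ) < (2 : ℝ)⁻¹ ^ (l + 1) := by positivity
    rw [e1, wal_cell (fun i hi => Finset.mem_range.1 (hR hi)) _ (by positivity)]
    · simp
    · rw [e2]; nlinarith
  rw [wal, Finset.prod_insert hl, e3, ← e4, wal]
  ring

variable {ι : Type*} [Fintype ι] [DecidableEq ι]

set_option maxHeartbeats 1000000 in
/-- Sum over all Walsh functions with prescribed leading digits `l j`: each integral is an average
of alternating sums of `h`, weighted by the profiles `W j`, and the remaining digits are summed by
the Parseval identity. -/
theorem sum_sq_integral_wal_le {lam : ℝ} {h : (ι → ℝ) → ℝ} (hh : ContinuousOn h (Set.Icc 0 1))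
    (hV : vitali lam h < ⊤) {l : ι → ℕ} {W : ι → ℝ → ℝ} {c M : ι → ℝ}
    (hW : ∀ j, IsTent (l j + 1) (c j) (M j) (W j)) (hc : ∀ j, 0 < c j) :
    ∑ R ∈ Fintype.piFinset fun j => (Finset.range (l j)).powerset,
      (∫ x, h x * ∏ j, (wal (insert (l j) (R j)) (x j) * W j (x j)) ∂(cubeMeasure ι)) ^ 2
      ≤ (vitali lam h).toReal ^ 2 * ∏ j, (c j ^ 2 * ((2 : ℝ)⁻¹ ^ (l j + 1)) ^ (2 * lam)) := by
  obtain ⟨H, -, hHb, hHe⟩ := exists_continuous_bdd hh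
  set δ : ι → ℝ := fun j => (2 : ℝ)⁻¹ ^ (l j + 1) with hδdef
  have hδ : ∀ j, 0 < δ j := fun j => by positivity
  have hδ2 : ∀ j, 2 ^ l j * δ j = 1 / 2 := fun j => by
    simp only [hδdef, pow_succ, inv_pow]; field_simp
  have hn : ∀ j, ((2 * 2 ^ l j : ℕ) : ℝ) * δ j = 1 := fun j => by
    push_cast; rw [mul_assoc, hδ2]; norm_num
  set B : Set (ι → ℝ) := Set.univ.pi fun j => Set.Ico 0 (δ j) with hB
  have hBm : MeasurableSet B := MeasurableSet.univ_pi fun j => measurableSet_Ico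
  set μ : Measure (ι → ℝ) := volume.restrict B with hμ
  have hμpi : μ = Measure.pi fun j => volume.restrict (Set.Ico 0 (δ j)) := by
    rw [hμ, hB, volume_pi, Measure.restrict_pi_pi]
  have : IsFiniteMeasure μ := by rw [hμpi]; infer_instance
  set w : (ι → ℝ) → ℝ := fun y => ∏ j, W j (y j) with hw
  have hwb : BddMeas w := bddMeas_tensor fun j => (hW j).bddMeas
  have hw0 : ∀ y, 0 ≤ w y := fun y => Finset.prod_nonneg fun j _ => (hW j).nonneg _
  have hI : ∫ y, w y ∂μ = ∏ j, (δ j * c j) := by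
    rw [hμpi, hw, integral_fintype_prod_eq_prod (f := W)]
    refine Finset.prod_congr rfl fun j _ => ?_
    rw [← (hW j).mean, intervalIntegral.integral_of_le (hδ j).le, integral_Ico_eq_integral_Ioo,
      integral_Ioc_eq_integral_Ioo]
  have hIpos : 0 < ∫ y, w y ∂μ := by
    rw [hI]; exact Finset.prod_pos fun j _ => mul_pos (hδ j) (hc j)
  -- Pairs of neighbouring small boxes form the cells of side `2^{-l j}`; on a cell the digit `l j`
  -- changes sign between the two halves, which turns values of `h` into alternating sums.
  set a : (ι → ℕ) → (ι → ℝ) → ℝ := fun k y => altSum H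
    (fun j => (2 * k j : ℕ) * δ j + y j, fun j => (2 * k j + 1 : ℕ) * δ j + y j) with ha
  have hab : ∀ k, BddMeas (a k) := by
    intro k
    simp only [ha, altSum]
    refine BddMeas.sum _ fun v _ => (BddMeas.const _).mul (hHb.comp ?_)
    refine measurable_pi_lambda _ fun j => ?_
    split_ifs <;> fun_prop
  set ω : (ι → Finset ℕ) → (ι → ℕ) → ℝ :=
    fun R k => ∏ j, wal (R j) (k j * (2 : ℝ)⁻¹ ^ l j) with hω
  set S : (ι → Finset ℕ) → (ι → ℝ) → ℝ := fun R y =>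
    ∑ k ∈ Fintype.piFinset fun j => Finset.range (2 ^ l j), ω R k * a k y with hS
  have hSb : ∀ R, BddMeas (S R) := fun R => BddMeas.sum _ fun k _ => (BddMeas.const _).mul (hab k)
  have hfull : ∀ R : ι → Finset ℕ, BddMeas fun x : ι → ℝ => ∏ j, (wal (insert (l j) (R j)) (x j) * W j (x j)) :=
    fun R => bddMeas_tensor (ψ := fun j t => wal (insert (l j) (R j)) t * W j t)
      fun j => (bddMeas_wal _).mul (hW j).bddMeas
  have hcoef : ∀ R ∈ Fintype.piFinset fun j => (Finset.range (l j)).powerset,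
      ∫ x, h x * ∏ j, (wal (insert (l j) (R j)) (x j) * W j (x j)) ∂(cubeMeasure ι)
        = ∫ y, w y * S R y ∂μ := by
    intro R hR
    rw [Fintype.mem_piFinset] at hR
    have e1 : ∫ x, h x * ∏ j, (wal (insert (l j) (R j)) (x j) * W j (x j)) ∂(cubeMeasure ι)
        = ∫ x, H x * ∏ j, (wal (insert (l j) (R j)) (x j) * W j (x j)) ∂(cubeMeasure ι) := by
      refine integral_congr_ae ?_
      filter_upwards [ae_mem_cube] with x hx
      rw [hHe hx]
    have hshift : ∀ e : ι → ℕ, Measurable fun y : ι → ℝ => fun j => (e j : ℝ) * δ j + y j :=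
      fun e => by fun_prop
    rw [e1, integral_cube_eq_sum hδ hn ((hHb.mul (hfull R)).integrable _),
      ← integral_finsetSum _ fun e _ => ((hHb.mul (hfull R)).comp (hshift e)).integrable μ]
    refine setIntegral_congr_fun hBm fun y hy => ?_
    dsimp only
    rw [sum_parity_split (n := fun j => 2 ^ l j)
      (fun e => H (fun j => (e j : ℝ) * δ j + y j) * ∏ j, (wal (insert (l j) (R j))
        ((e j : ℝ) * δ j + y j) * W j ((e j : ℝ) * δ j + y j))), hS]
    dsimp only
    rw [Finset.mul_sum]
    refine Finset.sum_congr rfl fun k _ => ?_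
    simp only [ha, altSum, Finset.mul_sum]
    refine Finset.sum_congr rfl fun v _ => ?_
    have e2 : (fun j => ((if j ∈ v then 2 * k j else 2 * k j + 1 : ℕ) : ℝ) * δ j + y j)
        = fun j => if j ∈ v then ((2 * k j : ℕ) : ℝ) * δ j + y j
          else ((2 * k j + 1 : ℕ) : ℝ) * δ j + y j := by
      funext j; split_ifs <;> rfl
    have e3 : ∀ j, wal (insert (l j) (R j))
        (((if j ∈ v then 2 * k j else 2 * k j + 1 : ℕ) : ℝ) * δ j + y j)
        * W j (((if j ∈ v then 2 * k j else 2 * k j + 1 : ℕ) : ℝ) * δ j + y j)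
        = wal (R j) (k j * (2 : ℝ)⁻¹ ^ l j) * (if j ∈ v then 1 else -1) * W j (y j) := by
      intro j
      have hy1 := hy j (Set.mem_univ j)
      have hp : ∀ e : ℕ, W j ((e : ℝ) * δ j + y j) = W j (y j) := fun e => by
        rw [add_comm]
        exact ((hW j).periodic.nat_mul e) (y j)
      rw [hp]
      congr 1
      have hRj := Finset.mem_powerset.1 (hR j)
      split_ifs
      · have := wal_insert_grid hRj (k j) 0 (by norm_num) hy1.1 hy1.2
        rw [pow_zero, mul_one] at this
        rw [mul_one, ← this]; rfl
      · have := wal_insert_grid hRj (k j) 1 le_rfl hy1.1 hy1.2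
        rw [this]; simp
    rw [e2]
    simp only [e3, Finset.prod_mul_distrib, prod_sign, hω, hw]
    ring
  -- For each offset `y` with positive coordinates the boxes in question belong to one partition of
  -- the cube, so Parseval's identity in the cell index reduces the sum over `R` to the variation.
  have hbound : ∀ᵐ y ∂μ, ∑ R ∈ Fintype.piFinset fun j => (Finset.range (l j)).powerset, S R y ^ 2
      ≤ (∏ j, (2 : ℝ) ^ l j) * ((vitali lam h).toReal ^ 2 * (∏ j, δ j) ^ (2 * lam - 1)) := by
    have hne : ∀ᵐ y ∂μ, ∀ j, y j ≠ 0 := by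
      rw [hμpi, Filter.eventually_all]
      intro j
      have : ∀ᵐ t ∂(volume.restrict (Set.Ico 0 (δ j))), t ≠ 0 :=
        ae_restrict_of_ae (by simp [ae_iff])
      exact (Measure.quasiMeasurePreserving_eval
        (fun j => volume.restrict (Set.Ico 0 (δ j))) j).ae this
    filter_upwards [hne, ae_restrict_mem hBm] with y hy0 hyB
    have hy : ∀ j, 0 < y j := fun j =>
      lt_of_le_of_ne (hyB j (Set.mem_univ j)).1 (hy0 j).symm
    have hy' : ∀ j, y j < δ j := fun j => (hyB j (Set.mem_univ j)).2
    rw [hS]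
    simp only [hω]
    rw [parseval_wal l fun k => a k y]
    refine mul_le_mul_of_nonneg_left ?_ (by positivity)
    refine le_trans (le_of_eq (Finset.sum_congr rfl fun k hk => ?_))
      (sum_altSum_sq_le hV hδ hn hy hy')
    simp only [ha, altSum]
    congr 1
    refine Finset.sum_congr rfl fun v _ => ?_
    congr 1
    refine hHe ?_
    rw [Fintype.mem_piFinset] at hk
    have hle : ∀ j (e : ℕ), e ≤ 2 * k j + 1 →
        0 ≤ (e : ℝ) * δ j + y j ∧ (e : ℝ) * δ j + y j ≤ 1 := by
      intro j e he
      have hkj := Finset.mem_range.1 (hk j)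
      have h1 : ((e + 1 : ℕ) : ℝ) * δ j ≤ (2 * 2 ^ l j : ℕ) * δ j := by
        exact mul_le_mul_of_nonneg_right (by exact_mod_cast (by omega)) (hδ j).le
      rw [hn j] at h1
      push_cast at h1
      exact ⟨add_nonneg (mul_nonneg (Nat.cast_nonneg _) (hδ j).le) (hy j).le,
        by linarith [hy' j]⟩
    constructor
    · intro j
      show (0 : ℝ) ≤ if j ∈ v then _ else _
      split_ifs
      exacts [(hle j _ (by omega)).1, (hle j _ (by omega)).1]
    · intro j
      show (if j ∈ v then _ else _) ≤ (1 : ℝ)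
      split_ifs
      exacts [(hle j _ (by omega)).2, (hle j _ (by omega)).2]
  have hS2 : ∀ R, BddMeas fun y => w y * S R y ^ 2 := fun R => by
    simpa only [← pow_two] using hwb.mul ((hSb R).mul (hSb R))
  set I := ∫ y, w y ∂μ with hIdef
  set V := (vitali lam h).toReal
  set v := ∏ j, δ j with hv
  have hvpos : 0 < v := Finset.prod_pos fun j _ => hδ j
  calc _ = ∑ R ∈ Fintype.piFinset fun j => (Finset.range (l j)).powerset,
        (∫ y, w y * S R y ∂μ) ^ 2 := Finset.sum_congr rfl fun R hR => by rw [hcoef R hR]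
    _ ≤ ∑ R ∈ Fintype.piFinset fun j => (Finset.range (l j)).powerset,
        I * ∫ y, w y * S R y ^ 2 ∂μ :=
      Finset.sum_le_sum fun R _ => sq_integral_mul_le hwb (hSb R) hw0 hIpos
    _ = I * ∫ y, w y * ∑ R ∈ Fintype.piFinset fun j => (Finset.range (l j)).powerset,
        S R y ^ 2 ∂μ := by
      rw [← Finset.mul_sum, ← integral_finsetSum _ fun R _ => (hS2 R).integrable μ]
      simp only [Finset.mul_sum]
    _ ≤ I * ∫ y, w y * ((∏ j, (2 : ℝ) ^ l j) * (V ^ 2 * v ^ (2 * lam - 1))) ∂μ := by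
      refine mul_le_mul_of_nonneg_left (integral_mono_ae ?_ ?_ ?_) hIpos.le
      · simp only [Finset.mul_sum]
        exact integrable_finsetSum _ fun R _ => (hS2 R).integrable μ
      · exact (hwb.integrable μ).mul_const _
      · filter_upwards [hbound] with y hy
        exact mul_le_mul_of_nonneg_left hy (hw0 y)
    _ = V ^ 2 * ((∏ j, c j ^ 2) * v ^ (2 * lam)) * (v * ∏ j, (2 : ℝ) ^ l j) := by
      rw [integral_mul_const, ← hIdef, hI, Finset.prod_mul_distrib, ← hv, Finset.prod_pow,
        Real.rpow_sub hvpos, Real.rpow_one]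
      field_simp
    _ ≤ V ^ 2 * ((∏ j, c j ^ 2) * v ^ (2 * lam)) * 1 := by
      refine mul_le_mul_of_nonneg_left ?_ (by positivity)
      rw [hv, ← Finset.prod_mul_distrib]
      refine Finset.prod_le_one (fun j _ => by positivity) fun j _ => ?_
      rw [mul_comm, hδ2]; norm_num
    _ = _ := by
      rw [mul_one, Finset.prod_mul_distrib, hv,
        ← Real.finsetProd_rpow _ _ fun j _ => (hδ j).le]

/-! ### Walsh coefficients with prescribed leading digits -/

section Reduction

variable {ι : Type*} [Fintype ι] [DecidableEq ι]

theorem prod_mem_mul_prod_notMem (v : Finset ι) (g : ι → ℝ) :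
    (∏ j : {j // j ∈ v}, g j) * ∏ j : {j // j ∉ v}, g j = ∏ j, g j := by
  convert Fintype.prod_subtype_mul_prod_subtype (fun i => i ∈ v) g

theorem prod_mem_of_eq_one {v : Finset ι} {g : ι → ℝ} (h : ∀ j, j ∉ v → g j = 1) :
    ∏ j : {j // j ∈ v}, g j = ∏ j, g j := by
  have : ∏ j : {j // j ∉ v}, g j = 1 := Finset.prod_eq_one fun j _ => h j.1 j.2
  rw [← prod_mem_mul_prod_notMem v g, this, mul_one]

theorem sum_piFinset_restrict_le {v : Finset ι} {κ : Type*} {S : ι → Finset κ}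
    {c : κ} (hS : ∀ j, j ∉ v → S j = {c}) (F : ({j // j ∈ v} → κ) → ℝ) (hF : ∀ R, 0 ≤ F R) :
    ∑ R ∈ Fintype.piFinset S, F (fun j => R j)
      ≤ ∑ R ∈ Fintype.piFinset fun j : {j // j ∈ v} => S j, F R := by
  classical
  have hinj : Set.InjOn (fun (R : ι → κ) (j : {j // j ∈ v}) => R j)
      (Fintype.piFinset S : Finset (ι → κ)) := by
    intro R hR R' hR' he
    have hR := Fintype.mem_piFinset.1 (Finset.mem_coe.1 hR)
    have hR' := Fintype.mem_piFinset.1 (Finset.mem_coe.1 hR')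
    funext j
    by_cases hj : j ∈ v
    · exact congrFun he ⟨j, hj⟩
    · have h1 := hR j
      have h2 := hR' j
      rw [hS j hj, Finset.mem_singleton] at h1 h2
      rw [h1, h2]
  rw [← Finset.sum_image (f := F) hinj]
  refine Finset.sum_le_sum_of_subset_of_nonneg (fun R' hR' => ?_) fun R _ _ => hF R
  obtain ⟨R, hR, rfl⟩ := Finset.mem_image.1 hR'
  exact Fintype.mem_piFinset.2 fun j => Fintype.mem_piFinset.1 hR j

theorem integral_eq_of_dependsOn {v : Finset ι} {F : (ι → ℝ) → ℝ}
    (hF : Integrable F (cubeMeasure ι)) (hd : DependsOn F (v : Set ι)) :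
    ∫ x, F x ∂(cubeMeasure ι) = ∫ z, F (glue v z 0) ∂(cubeMeasure {j // j ∈ v}) := by
  rw [integral_glue hF v]
  refine integral_congr_ae (Filter.Eventually.of_forall fun z => ?_)
  have : ∀ y, F (glue v z y) = F (glue v z 0) := fun y => hd fun i hi => by
    have : i ∈ v := hi
    simp [glue, this]
  simp only [this]
  simp

theorem integral_tensor_factor (v : Finset ι) {G : (ι → ℝ) → ℝ} (hG : ContinuousOn G (Set.Icc 0 1))
    {Ω ρ : ι → ℝ → ℝ} (hΩ : ∀ j, BddMeas (Ω j)) {M : ι → ℝ}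
    (hM : ∀ j, j ∉ v → ∀ t, Ω j t = M j * ρ j t) :
    ∫ x, G x * ∏ j, Ω j (x j) ∂(cubeMeasure ι)
      = (∏ j : {j // j ∉ v}, M j) * ∫ a, partialIntegral v
        (fun x => G x * ∏ j : {j // j ∉ v}, ρ j (x j)) a * ∏ j : {j // j ∈ v}, Ω j (a j)
        ∂(cubeMeasure {j // j ∈ v}) := by
  rw [integral_glue (integrable_mul_of_continuousOn hG (bddMeas_tensor hΩ)) v, ← integral_const_mul]
  refine integral_congr_ae (Filter.Eventually.of_forall fun a => ?_)
  dsimp only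
  rw [partialIntegral_eq, ← integral_mul_const, ← integral_const_mul]
  refine integral_congr_ae (Filter.Eventually.of_forall fun b => ?_)
  dsimp only
  rw [← prod_mem_mul_prod_notMem v fun j => Ω j (glue v a b j)]
  have e1 : ∏ j : {j // j ∈ v}, Ω j (glue v a b j) = ∏ j : {j // j ∈ v}, Ω j (a j) :=
    Finset.prod_congr rfl fun j _ => by simp [glue]
  have e2 : ∏ j : {j // j ∉ v}, Ω j (glue v a b j)
      = (∏ j : {j // j ∉ v}, M j) * ∏ j : {j // j ∉ v}, ρ j (glue v a b j) := by
    rw [← Finset.prod_mul_distrib]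
    exact Finset.prod_congr rfl fun j _ => hM j j.2 _
  rw [e1, e2]
  ring

theorem vitali_le_partialVitali {lam : ℝ} {v : Finset ι} {G : (ι → ℝ) → ℝ}
    (ρ : {j // j ∉ v} → ℝ → ℝ) (hρ : ∀ j, ContinuousOn (ρ j) (Set.Icc 0 1) ∧
      ∀ t ∈ Set.Icc (0 : ℝ) 1, 0 ≤ ρ j t ∧ ρ j t ≤ 1) :
    vitali lam (partialIntegral v fun x => G x * ∏ j : {j // j ∉ v}, ρ j (x j))
      ≤ partialVitali lam v G := by
  unfold partialVitali
  exact le_iSup₂_of_le ρ hρ le_rfl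

/-- Bound for Walsh integrals against profiles: in the coordinates outside `v` the Walsh function
has been integrated out completely, in those in `v` a remainder with leading digit `l j` is
left. -/
theorem sum_sq_integral_profile_le {lam : ℝ} {v : Finset ι} {G : (ι → ℝ) → ℝ}
    (hG : ContinuousOn G (Set.Icc 0 1)) (hV : partialVitali lam v G < ⊤)
    {l : ι → ℕ} {W : ι → ℝ → ℝ} {c M : ι → ℝ}
    (hW : ∀ j, IsTent (if j ∈ v then l j + 1 else 0) (c j) (M j) (W j))
    (hc : ∀ j, 0 < c j) (hM : ∀ j, 0 < M j)
    {S : ι → Finset (Finset ℕ)} {rem : ι → Finset ℕ → Finset ℕ}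
    (hS : ∀ j ∈ v, S j = (Finset.range (l j)).powerset) (hS' : ∀ j, j ∉ v → S j = {∅})
    (hr : ∀ j ∈ v, ∀ R, rem j R = insert (l j) R) (hr' : ∀ j, j ∉ v → ∀ R, rem j R = ∅) :
    ∑ R ∈ Fintype.piFinset S,
      (∫ x, G x * ∏ j, (wal (rem j (R j)) (x j) * W j (x j)) ∂(cubeMeasure ι)) ^ 2
      ≤ (partialVitali lam v G).toReal ^ 2 *
        ∏ j, (if j ∈ v then c j ^ 2 * ((2 : ℝ)⁻¹ ^ (l j + 1)) ^ (2 * lam) else M j ^ 2) := by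
  -- Off `v`, the normalized profiles are admissible test functions `ρ_j` for the partial variation.
  obtain ⟨ρ, hρ⟩ : ∃ ρ : ι → ℝ → ℝ, ∀ j t, ρ j t = W j t / M j := ⟨_, fun _ _ => rfl⟩
  have hρc : ∀ j, Continuous (ρ j) := fun j => by
    rw [funext (hρ j)]; exact (hW j).cont.div_const _
  have hρ' : ∀ j : {j // j ∉ v}, ContinuousOn (ρ j) (Set.Icc 0 1) ∧
      ∀ t ∈ Set.Icc (0 : ℝ) 1, 0 ≤ ρ j t ∧ ρ j t ≤ 1 := fun j =>
    ⟨(hρc j).continuousOn, fun t _ => by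
      rw [hρ]
      exact ⟨div_nonneg ((hW j).nonneg t) (hM j).le, (div_le_one (hM j)).2 ((hW j).le t)⟩⟩
  set h := partialIntegral v fun x => G x * ∏ j : {j // j ∉ v}, ρ j (x j) with hh
  have hVh : vitali lam h ≤ partialVitali lam v G := by
    have := vitali_le_partialVitali (lam := lam) (v := v) (G := G) (fun j => ρ j) hρ'
    rw [hh]
    exact this
  have hhc : ContinuousOn h (Set.Icc 0 1) := by
    have h1 : ContinuousOn (fun x => G x * ∏ j : {j // j ∉ v}, ρ j (x j)) (Set.Icc (0 : ι → ℝ) 1) :=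
      hG.mul (Continuous.continuousOn (continuous_finsetProd _ fun (j : {j // j ∉ v}) _ =>
        (hρc j).comp (continuous_apply (j : ι))))
    obtain ⟨K, hK, -, hKe⟩ := exists_continuous_bdd h1
    refine (continuous_partialIntegral v hK).continuousOn.congr fun a ha => ?_
    rw [hh, partialIntegral_eq, partialIntegral_eq]
    refine integral_congr_ae ?_
    filter_upwards [ae_mem_cube] with b hb
    exact (hKe (glue_mem_cube ha hb)).symm
  have hterm : ∀ R : ι → Finset ℕ,
      (∫ x, G x * ∏ j, (wal (rem j (R j)) (x j) * W j (x j)) ∂(cubeMeasure ι)) ^ 2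
      = (∏ j : {j // j ∉ v}, M j) ^ 2 * (∫ a, h a * ∏ j : {j // j ∈ v},
        (wal (insert (l j) (R j)) (a j) * W j (a j)) ∂(cubeMeasure {j // j ∈ v})) ^ 2 := by
    intro R
    rw [← mul_pow]
    congr 1
    rw [integral_tensor_factor v hG (Ω := fun j t => wal (rem j (R j)) t * W j t) (ρ := ρ) (M := M)]
    · congr 1
      refine integral_congr_ae (Filter.Eventually.of_forall fun a => ?_)
      dsimp only
      congr 1
      exact Finset.prod_congr rfl fun j _ => by rw [hr j j.2]
    · exact fun j => (bddMeas_wal _).mul (hW j).bddMeas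
    · intro j hj t
      rw [hr' j hj]
      simp only [wal, Finset.prod_empty, hρ]
      field_simp [(hM j).ne']
  simp only [hterm]
  rw [← Finset.mul_sum]
  have h1 := sum_piFinset_restrict_le hS' (fun R : {j // j ∈ v} → Finset ℕ =>
    (∫ a, h a * ∏ j : {j // j ∈ v}, (wal (insert (l j) (R j)) (a j) * W j (a j))
      ∂(cubeMeasure {j // j ∈ v})) ^ 2) fun _ => sq_nonneg _
  have hSv : (fun j : {j // j ∈ v} => S j)
      = fun j : {j // j ∈ v} => (Finset.range (l j)).powerset := funext fun j => hS j j.2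
  rw [hSv] at h1
  have h2 := sum_sq_integral_wal_le hhc (hVh.trans_lt hV) (l := fun j => l j) (W := fun j => W j)
    (c := fun j => c j) (M := fun j => M j) (fun j => by simpa [j.2] using hW j) (fun j => hc j)
  have h3 : (vitali lam h).toReal ≤ (partialVitali lam v G).toReal :=
    ENNReal.toReal_mono hV.ne hVh
  have e : ∏ j, (if j ∈ v then c j ^ 2 * ((2 : ℝ)⁻¹ ^ (l j + 1)) ^ (2 * lam) else M j ^ 2)
      = (∏ j : {j // j ∈ v}, (c j ^ 2 * ((2 : ℝ)⁻¹ ^ (l j + 1)) ^ (2 * lam)))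
        * (∏ j : {j // j ∉ v}, M j) ^ 2 := by
    rw [← prod_mem_mul_prod_notMem v, ← Finset.prod_pow]
    congr 1
    · exact Finset.prod_congr rfl fun j _ => if_pos j.2
    · exact Finset.prod_congr rfl fun j _ => if_neg j.2
  rw [e]
  calc _ ≤ (∏ j : {j // j ∉ v}, M j) ^ 2 * ((vitali lam h).toReal ^ 2 *
        ∏ j : {j // j ∈ v}, (c j ^ 2 * ((2 : ℝ)⁻¹ ^ (l j + 1)) ^ (2 * lam))) :=
      mul_le_mul_of_nonneg_left (h1.trans h2) (sq_nonneg _)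
    _ ≤ (∏ j : {j // j ∉ v}, M j) ^ 2 * ((partialVitali lam v G).toReal ^ 2 *
        ∏ j : {j // j ∈ v}, (c j ^ 2 * ((2 : ℝ)⁻¹ ^ (l j + 1)) ^ (2 * lam))) := by
      gcongr
    _ = _ := by ring

end Reduction

/-! ### Repeated integration by parts -/

/-- The successive primitives of a Walsh function, obtained by removing its digits in decreasing
order. -/
theorem exists_primitives : ∀ (L : List ℕ), L.Pairwise (· < ·) → ∀ κ : Finset ℕ,
    (∀ i ∈ κ, ∀ l ∈ L, i < l) → ∃ Ψ : ℕ → ℝ → ℝ, Ψ 0 = wal (κ ∪ L.toFinset) ∧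
      (Ψ L.length = fun x => wal κ x * tent L x) ∧ (∀ b, BddMeas (Ψ b)) ∧
      (∀ b < L.length, ∀ x ∈ Set.Icc (0 : ℝ) 1, ∫ t in (0 : ℝ)..x, Ψ b t = Ψ (b + 1) x) ∧
      ∀ b < L.length, Ψ (b + 1) 1 = 0
  | [], _, κ, _ => ⟨fun _ => wal κ, by simp, by simp [tent], fun _ => bddMeas_wal κ, by simp,
      by simp⟩
  | l :: L, hL, κ, hκ => by
    rw [List.pairwise_cons] at hL
    obtain ⟨Ψ, h0, hlen, hb, hint, hone⟩ := exists_primitives L hL.2 (insert l κ) (by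
      intro i hi l' hl'
      rcases Finset.mem_insert.1 hi with rfl | hi
      · exact hL.1 l' hl'
      · exact hκ i hi l' (by simp [hl']))
    have ht := isTent_tent L hL.2 (l + 1) fun j hj => hL.1 j hj
    have hlast : BddMeas fun x => wal κ x * tent (l :: L) x :=
      (bddMeas_wal κ).mul ht.step.bddMeas
    have hstep : ∀ x ∈ Set.Icc (0 : ℝ) 1, ∫ t in (0 : ℝ)..x, Ψ L.length t
        = wal κ x * tent (l :: L) x := by
      intro x hx
      rw [hlen]
      exact integral_wal_mul_tent ht (fun i hi => hκ i hi l (by simp)) hx.1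
    have hend : wal κ 1 * tent (l :: L) 1 = 0 := by
      have := tentStep_grid ht (2 ^ l)
      have e : ((2 ^ l : ℕ) : ℝ) * (2 : ℝ)⁻¹ ^ l = 1 := by
        push_cast; rw [← mul_pow]; norm_num
      rw [e] at this
      rw [tent, this, mul_zero]
    refine ⟨fun b => if b ≤ L.length then Ψ b else fun x => wal κ x * tent (l :: L) x, ?_, ?_, ?_,
      ?_, ?_⟩
    · simp only [zero_le, if_true, h0, List.toFinset_cons]
      congr 1
      ext; simp only [Finset.mem_union, Finset.mem_insert]; tauto
    · simp
    · intro b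
      dsimp only
      split_ifs
      exacts [hb b, hlast]
    · intro b hb' x hx
      simp only [List.length_cons] at hb'
      dsimp only
      rw [if_pos (by omega : b ≤ L.length)]
      split_ifs with h
      · exact hint b (by omega) x hx
      · have : b = L.length := by omega
        subst this
        exact hstep x hx
    · intro b hb'
      dsimp only
      split_ifs with h
      · exact hone b (by omega)
      · exact hend

theorem integral_wal_eq_zero {κ : Finset ℕ} (hκ : κ.Nonempty) :
    ∫ t in (0 : ℝ)..1, wal κ t = 0 := by
  have hl := κ.max'_mem hκ
  have h := exists_primitives [κ.max' hκ] (by simp) (κ.erase (κ.max' hκ)) (by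
    intro i hi l hl
    rw [List.mem_singleton] at hl
    subst hl
    exact lt_of_le_of_ne (κ.le_max' _ (Finset.mem_of_mem_erase hi)) (Finset.ne_of_mem_erase hi))
  obtain ⟨Ψ, h0, -, -, hint, hone⟩ := h
  have e : κ.erase (κ.max' hκ) ∪ [κ.max' hκ].toFinset = κ := by
    ext i
    by_cases h : i = κ.max' hκ
    · rw [h]; simp [hl]
    · simp [h]
  rw [e] at h0
  rw [← h0, hint 0 (by simp) 1 (by simp), hone 0 (by simp)]

/-- Repeated integration by parts, up to sign. -/
theorem sq_integral_by_parts {s α : ℕ} {F : (Fin s → ℝ) → ℝ} (hF : MixedSmooth α F)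
    {n : Fin s → ℕ} (hn : ∀ j, n j ≤ α) {Ψ : Fin s → ℕ → ℝ → ℝ} (hb : ∀ j b, BddMeas (Ψ j b))
    (hint : ∀ j, ∀ b < n j, ∀ x ∈ Set.Icc (0 : ℝ) 1, ∫ t in (0 : ℝ)..x, Ψ j b t = Ψ j (b + 1) x)
    (hone : ∀ j, ∀ b < n j, Ψ j (b + 1) 1 = 0) :
    (∫ x, F x * ∏ j, Ψ j 0 (x j) ∂(cubeMeasure (Fin s))) ^ 2
      = (∫ x, mixedDeriv n F x * ∏ j, Ψ j (n j) (x j) ∂(cubeMeasure (Fin s))) ^ 2 := by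
  have key : ∀ N : ℕ, ∀ β : Fin s → ℕ, (∀ j, β j ≤ n j) → ∑ j, β j = N →
      (∫ x, F x * ∏ j, Ψ j 0 (x j) ∂(cubeMeasure (Fin s))) ^ 2
      = (∫ x, mixedDeriv β F x * ∏ j, Ψ j (β j) (x j) ∂(cubeMeasure (Fin s))) ^ 2 := by
    intro N
    induction N with
    | zero =>
      intro β _ hβ
      have : β = 0 := by
        funext j
        exact (Finset.sum_eq_zero_iff.1 hβ) j (Finset.mem_univ j)
      subst this
      simp [mixedDeriv_zero]
    | succ N ih =>
      intro β hβn hβ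
      obtain ⟨j, -, hj⟩ : ∃ j ∈ Finset.univ, β j ≠ 0 := Finset.exists_ne_zero_of_sum_ne_zero
        (by omega)
      obtain ⟨b, hbj⟩ := Nat.exists_eq_succ_of_ne_zero hj
      set β' := Function.update β j b with hβ'
      have hup : Function.update β' j (β' j + 1) = β := by
        funext i
        by_cases h : i = j
        · subst h; simp [hβ', hbj]
        · simp [hβ', h]
      have hle' : ∀ i, β' i ≤ n i := by
        intro i
        by_cases h : i = j
        · subst h
          have := hβn i
          simp only [hβ', Function.update_self]; omega
        · simpa [hβ', h] using hβn i
      have hsum : ∑ i, β' i = N := by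
        have h1 := Finset.add_sum_erase Finset.univ β (Finset.mem_univ j)
        have h2 := Finset.add_sum_erase Finset.univ β' (Finset.mem_univ j)
        have h3 : ∑ i ∈ Finset.univ.erase j, β' i = ∑ i ∈ Finset.univ.erase j, β i :=
          Finset.sum_congr rfl fun i hi => by
            rw [hβ', Function.update_of_ne (Finset.ne_of_mem_erase hi)]
        have h4 : β' j = b := by simp [hβ']
        omega
      have hbn : β' j < n j := by
        have := hβn j
        have h4 : β' j = b := by simp [hβ']
        omega
      rw [ih β' hle' hsum]
      have hα : ∀ i, β' i ≤ α := fun i => (hle' i).trans (hn i)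
      have hα2 : ∀ i, β i ≤ α := fun i => (hβn i).trans (hn i)
      have h5 := hF.hasDeriv β' hα j (hbn.trans_le (hn j))
      rw [hup] at h5
      rw [integral_tensor_by_parts j (hF.continuousOn β' hα) (hF.continuousOn β hα2) h5
        (ψ := fun i => Ψ i (β' i)) (fun i => hb i _) (hb j (β' j + 1)) (hint j _ hbn)
        (hone j _ hbn), neg_sq]
      congr 2
      funext x
      congr 1
      refine Finset.prod_congr rfl fun i _ => ?_
      by_cases h : i = j
      · subst h
        have : β' i + 1 = β i := by simp [hβ', hbj]
        rw [Function.update_self, this]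
      · rw [Function.update_of_ne h, hβ', Function.update_of_ne h]
  exact key _ n (fun _ => le_rfl) rfl

/-! ### Leading digits of a frequency -/

/-- Leading digits of a frequency: the digits that are integrated out, and, if any digits are left,
the largest one of those. -/
abbrev Lead := Finset ℕ × Option ℕ

namespace Lead

/-- Leading digits that occur for smoothness `α`: at most `α` digits that are integrated out, and
exactly `α` if there are others. -/
def Valid (α : ℕ) (o : Lead) : Prop :=
  match o.2 with
  | none => o.1.card ≤ α
  | some l => o.1.card = α ∧ ∀ t ∈ o.1, l < t

/-- The digits that are not integrated out, when `R` is the set of nonleading ones. -/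
def rem (o : Lead) (R : Finset ℕ) : Finset ℕ :=
  match o.2 with
  | none => ∅
  | some l => insert l R

/-- The possible sets of nonleading digits. -/
def rests (o : Lead) : Finset (Finset ℕ) :=
  match o.2 with
  | none => {∅}
  | some l => (Finset.range l).powerset

/-- The frequency with leading digits `o` and nonleading digits `R`. -/
def join (o : Lead) (R : Finset ℕ) : Finset ℕ := o.rem R ∪ o.1

/-- Bound for the total squared contribution of the frequencies with leading digits `o`. -/
noncomputable def weight (lam : ℝ) (o : Lead) : ℝ :=
  match o.2 with
  | none => if o.1 = ∅ then 1 else (2 * ∏ t ∈ o.1, (2 : ℝ)⁻¹ ^ (t + 2)) ^ 2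
  | some l => (∏ t ∈ o.1, (2 : ℝ)⁻¹ ^ (t + 2)) ^ 2 * ((2 : ℝ)⁻¹ ^ (l + 1)) ^ (2 * lam)

end Lead

theorem tentMean_sort (T : Finset ℕ) : tentMean (T.sort (· ≤ ·)) = ∏ t ∈ T, (2 : ℝ)⁻¹ ^ (t + 2) := by
  rw [tentMean, ← List.prod_toFinset _ (T.sort_nodup _), Finset.sort_toFinset]

theorem partialVitali_le_componentNorm {s α : ℕ} {lam : ℝ} {f : (Fin s → ℝ) → ℝ}
    {u : Finset (Fin s)} (hu : u.Nonempty) (v : Finset {j // j ∈ u}) (β : {j // j ∈ u} → ℕ)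
    (hβ : ∀ j, (j ∈ v → β j = α) ∧ (j ∉ v → 0 < β j ∧ β j ≤ α)) :
    partialVitali lam v (restrictTo u (mixedDeriv (extendIndex u β) (anova f u)))
      ≤ componentNorm α lam f u := by
  rw [componentNorm, if_neg hu.ne_empty]
  exact le_iSup_of_le v (le_iSup₂_of_le β hβ le_rfl)

/-- The Walsh coefficients of `f` with given leading digits are controlled by the variation of a
mixed derivative of the ANOVA component of `f` with the corresponding variables. -/
theorem sum_sq_coeff_le {s α : ℕ} {lam : ℝ} {f : (Fin s → ℝ) → ℝ} (hf : MixedSmooth α f)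
    {u : Finset (Fin s)} (hV : componentNorm α lam f u < ⊤) {o : Fin s → Lead}
    (ho : ∀ j, (o j).Valid α) (hu : ∀ j, j ∈ u ↔ o j ≠ (∅, none)) (hne : u.Nonempty) :
    ∑ R ∈ Fintype.piFinset fun j => (o j).rests,
      (∫ x, f x * ∏ j, wal ((o j).join (R j)) (x j) ∂(cubeMeasure (Fin s))) ^ 2
      ≤ (componentNorm α lam f u).toReal ^ 2 * ∏ j, (o j).weight lam := by
  classical
  set L : Fin s → List ℕ := fun j => (o j).1.sort (· ≤ ·) with hL
  have hLp : ∀ j, (L j).Pairwise (· < ·) := fun j => ((o j).1.sortedLT_sort).pairwise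
  have hLm : ∀ j t, t ∈ L j ↔ t ∈ (o j).1 := fun j t => Finset.mem_sort _
  have hLf : ∀ j, (L j).toFinset = (o j).1 := fun j => Finset.sort_toFinset _ _
  have hLlen : ∀ j, (L j).length = (o j).1.card := fun j => Finset.length_sort _
  set n : Fin s → ℕ := fun j => (o j).1.card with hn
  have hnα : ∀ j, n j ≤ α := by
    intro j
    have := ho j
    simp only [Lead.Valid] at this
    simp only [hn]
    split at this
    · exact this
    · exact this.1.le
  have hnu : ∀ j, j ∉ u → o j = (∅, none) := fun j hj => by
    by_contra h; exact hj ((hu j).2 h)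
  set F := anova f u with hF
  have hFs : MixedSmooth α F := hf.anova u
  set g := mixedDeriv n F with hg
  have hgc : ContinuousOn g (Set.Icc 0 1) := hFs.continuousOn n hnα
  have hgd : DependsOn g (u : Set (Fin s)) :=
    dependsOn_mixedDeriv (dependsOn_anova f u) fun j hj => by simp [hn, hnu j hj]
  set W : Fin s → ℝ → ℝ := fun j => tent (L j) with hW
  have hWb : ∀ j, BddMeas (W j) := fun j =>
    (isTent_tent (L j) (hLp j) 0 fun _ _ => Nat.zero_le _).bddMeas
  -- `v` consists of the coordinates with a digit left after `α` integrations by parts; in these the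
  -- order of differentiation is `α`, in the others it is the number of digits.
  set v : Finset {j // j ∈ u} := Finset.univ.filter fun j => (o j).2 ≠ none with hv
  have hvm : ∀ j : {j // j ∈ u}, j ∈ v ↔ (o j).2 ≠ none := fun j => by simp [hv]
  set G := restrictTo u g with hG
  have h0 : (0 : {j // j ∉ u} → ℝ) ∈ Set.Icc (0 : {j // j ∉ u} → ℝ) 1 :=
    ⟨le_rfl, zero_le_one⟩
  have hGc : ContinuousOn G (Set.Icc 0 1) :=
    hgc.comp (((continuous_glue u).comp (continuous_id.prodMk continuous_const)).continuousOn)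
      fun z hz => glue_mem_cube hz h0
  have hβ : extendIndex u (fun j : {j // j ∈ u} => n j) = n := by
    funext j
    by_cases hj : j ∈ u
    · simp [extendIndex, hj]
    · simp [extendIndex, hj, hn, hnu j hj]
  have hpv : partialVitali lam v G ≤ componentNorm α lam f u := by
    have := partialVitali_le_componentNorm (α := α) (lam := lam) (f := f) hne v (fun j => n j) (by
      intro j
      have hj := ho j
      simp only [Lead.Valid] at hj
      rw [hvm]
      constructor
      · intro h
        split at hj
        · rename_i h2; exact absurd h2 h
        · exact hj.1
      · intro h
        refine ⟨?_, hnα j⟩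
        rw [not_not] at h
        have h2 := (hu j).1 j.2
        rw [Finset.card_pos, Finset.nonempty_iff_ne_empty]
        intro h3
        exact h2 (Prod.ext h3 h))
    rw [hβ] at this
    exact this
  have hterm : ∀ R ∈ Fintype.piFinset fun j => (o j).rests,
      (∫ x, f x * ∏ j, wal ((o j).join (R j)) (x j) ∂(cubeMeasure (Fin s))) ^ 2
        = (∫ z, G z * ∏ j : {j // j ∈ u}, (wal ((o j).rem (R j)) (z j) * W j (z j))
          ∂(cubeMeasure {j // j ∈ u})) ^ 2 := by
    intro R hR
    rw [Fintype.mem_piFinset] at hR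
    have hex : ∀ j, _ := fun j => exists_primitives (L j) (hLp j) ((o j).rem (R j)) (by
      intro i hi l hl
      rw [hLm] at hl
      have hj := ho j
      have hRj := hR j
      simp only [Lead.Valid] at hj
      simp only [Lead.rem] at hi
      simp only [Lead.rests] at hRj
      split at hi
      · simp at hi
      · rename_i l0 h0
        rw [h0] at hj hRj
        have h2 := hj.2 l hl
        rcases Finset.mem_insert.1 hi with rfl | hi
        · exact h2
        · exact (Finset.mem_range.1 (Finset.mem_powerset.1 hRj hi)).trans h2)
    choose Ψ hΨ0 hΨn hΨb hΨi hΨ1 using hex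
    have hjoin : ∀ j, Ψ j 0 = wal ((o j).join (R j)) := fun j => by
      rw [hΨ0, hLf]; rfl
    have e1 : ∫ x, f x * ∏ j, wal ((o j).join (R j)) (x j) ∂(cubeMeasure (Fin s))
        = ∫ x, F x * ∏ j, Ψ j 0 (x j) ∂(cubeMeasure (Fin s)) := by
      simp only [hjoin]
      refine integral_anova (ψ := fun j => wal ((o j).join (R j))) ?_
        (fun j => bddMeas_wal _) (fun j hj => integral_wal_eq_zero ?_) fun j hj => ?_
      · exact ⟨fun β _ j hj => absurd hj (by omega),
          fun β hβ => hf.continuousOn β fun j => (hβ j).trans (Nat.zero_le _)⟩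
      · have h2 := (hu j).1 hj
        rw [Finset.nonempty_iff_ne_empty]
        intro h3
        rw [Lead.join, Finset.union_eq_empty] at h3
        refine h2 (Prod.ext h3.2 ?_)
        have h4 := h3.1
        simp only [Lead.rem] at h4
        split at h4
        · assumption
        · simp at h4
      · rw [hnu j hj]
        funext t
        simp [Lead.join, Lead.rem, wal]
    have hlast : ∀ j, Ψ j (n j) = fun x => wal ((o j).rem (R j)) x * W j x := fun j => by
      rw [← hΨn, hLlen]
    rw [e1, sq_integral_by_parts hFs hnα hΨb (fun j b hb => hΨi j b (by rw [hLlen]; exact hb))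
      fun j b hb => hΨ1 j b (by rw [hLlen]; exact hb)]
    congr 1
    simp only [hlast]
    have hone : ∀ j, j ∉ u → ∀ t, wal ((o j).rem (R j)) t * W j t = 1 := by
      intro j hj t
      simp [hnu j hj, Lead.rem, wal, hW, hL, tent]
    have hTb : BddMeas fun x : Fin s → ℝ => ∏ j, (wal ((o j).rem (R j)) (x j) * W j (x j)) :=
      bddMeas_tensor (ψ := fun j t => wal ((o j).rem (R j)) t * W j t)
        fun j => (bddMeas_wal _).mul (hWb j)
    rw [integral_eq_of_dependsOn (v := u) (integrable_mul_of_continuousOn hgc hTb)]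
    · refine integral_congr_ae (Filter.Eventually.of_forall fun z => ?_)
      dsimp only
      congr 1
      rw [← prod_mem_of_eq_one (v := u) fun j hj => hone j hj _]
      refine Finset.prod_congr rfl fun j _ => ?_
      have : glue u z 0 (j : Fin s) = z j := by simp [glue]
      rw [this]
    · intro x y hxy
      dsimp only
      rw [hgd hxy]
      congr 1
      refine Finset.prod_congr rfl fun j _ => ?_
      by_cases hj : j ∈ u
      · rw [hxy j hj]
      · rw [hone j hj, hone j hj]
  rw [Finset.sum_congr rfl hterm]
  have hres := sum_piFinset_restrict_le (v := u) (S := fun j => (o j).rests) (c := ∅)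
    (fun j hj => by simp [hnu j hj, Lead.rests])
    (fun R : {j // j ∈ u} → Finset ℕ => (∫ z, G z * ∏ j : {j // j ∈ u},
      (wal ((o j).rem (R j)) (z j) * W j (z j)) ∂(cubeMeasure {j // j ∈ u})) ^ 2)
    fun _ => sq_nonneg _
  refine hres.trans ?_
  set l : {j // j ∈ u} → ℕ := fun j => ((o j).2).getD 0 with hl
  have hlv : ∀ j ∈ v, (o j).2 = some (l j) := by
    intro j hj
    rw [hvm] at hj
    obtain ⟨a, ha⟩ := Option.ne_none_iff_exists'.1 hj
    simp [hl, ha]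
  have hnv : ∀ j : {j // j ∈ u}, j ∉ v → (o j).2 = none := fun j hj => by
    rw [hvm, not_not] at hj; exact hj
  have hmain := sum_sq_integral_profile_le (lam := lam) (v := v) hGc (hpv.trans_lt hV) (l := l)
    (W := fun j => W j) (c := fun j => tentMean (L j))
    (M := fun j => if L j = [] then 1 else 2 * tentMean (L j))
    (S := fun j => (o j).rests) (rem := fun j => (o j).rem) (by
      intro j
      refine isTent_tent (L j) (hLp j) _ fun t ht => ?_
      split_ifs with h
      · have hj := ho j
        simp only [Lead.Valid, hlv j h] at hj
        exact hj.2 t ((hLm j t).1 ht)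
      · exact Nat.zero_le _) (fun j => tentMean_pos _) (by
      intro j
      split_ifs
      · exact one_pos
      · exact mul_pos two_pos (tentMean_pos _)) (by
      intro j hj; simp only [Lead.rests, hlv j hj]) (by
      intro j hj; simp only [Lead.rests, hnv j hj]) (by
      intro j hj R; simp only [Lead.rem, hlv j hj]) (by
      intro j hj R; simp only [Lead.rem, hnv j hj])
  refine hmain.trans ?_
  have hwt : ∏ j, (o j).weight lam = ∏ j : {j // j ∈ u}, (if j ∈ v then tentMean (L j) ^ 2
      * ((2 : ℝ)⁻¹ ^ (l j + 1)) ^ (2 * lam)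
      else (if L j = [] then 1 else 2 * tentMean (L j)) ^ 2) := by
    rw [← prod_mem_of_eq_one (v := u) (g := fun j => (o j).weight lam) fun j hj => by
      simp [hnu j hj, Lead.weight]]
    refine Finset.prod_congr rfl fun j _ => ?_
    split_ifs with h h2
    · simp only [Lead.weight, hlv j h, hL, tentMean_sort]
    · exfalso
      refine (hu j).1 j.2 (Prod.ext ?_ (hnv j h))
      rw [← hLf, h2]; rfl
    · have h3 : (o j).1 ≠ ∅ := fun h3 => h2 (by simp [hL, h3])
      simp only [Lead.weight, hnv j h, hL, tentMean_sort, if_neg h3]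
  rw [hwt]
  have hnn : 0 ≤ ∏ j : {j // j ∈ u}, (if j ∈ v then tentMean (L j) ^ 2
      * ((2 : ℝ)⁻¹ ^ (l j + 1)) ^ (2 * lam)
      else (if L j = [] then 1 else 2 * tentMean (L j)) ^ 2) := by
    refine Finset.prod_nonneg fun j _ => ?_
    split_ifs <;> positivity
  refine mul_le_mul_of_nonneg_right ?_ hnn
  exact pow_le_pow_left₀ ENNReal.toReal_nonneg (ENNReal.toReal_mono hV.ne hpv) 2

/-! ### Sums over leading digits -/

/-- An elementary symmetric function is at most a power of the sum, divided by a factorial. -/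
theorem sum_powersetCard_prod_le {κ : Type*} [DecidableEq κ] (S : Finset κ) {x : κ → ℝ}
    (hx : ∀ i ∈ S, 0 ≤ x i) (a : ℕ) :
    ∑ T ∈ S.powersetCard a, ∏ t ∈ T, x t ≤ (∑ i ∈ S, x i) ^ a / (a ! : ℝ) := by
  induction S using Finset.induction_on generalizing a with
  | empty =>
    cases a with
    | zero => simp
    | succ a => rw [Finset.powersetCard_eq_empty.2 (by simp)]; simp
  | insert i S hi ih =>
    have hS : ∀ j ∈ S, 0 ≤ x j := fun j hj => hx j (by simp [hj])
    have hxi : 0 ≤ x i := hx i (by simp)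
    cases a with
    | zero => simp
    | succ a =>
      rw [Finset.powersetCard_succ_insert hi, Finset.sum_union, Finset.sum_insert hi]
      · rw [Finset.sum_image]
        · have e : ∑ T ∈ S.powersetCard a, ∏ t ∈ insert i T, x t
              = x i * ∑ T ∈ S.powersetCard a, ∏ t ∈ T, x t := by
            rw [Finset.mul_sum]
            refine Finset.sum_congr rfl fun T hT => ?_
            rw [Finset.prod_insert fun h => hi ((Finset.mem_powersetCard.1 hT).1 h)]
          rw [e]
          set P := ∑ j ∈ S, x j
          have hP : 0 ≤ P := Finset.sum_nonneg hS
          have hb : P ^ (a + 1) + (a + 1) * x i * P ^ a ≤ (x i + P) ^ (a + 1) := by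
            have h1 := add_pow (x i) P (a + 1)
            rw [h1, Finset.sum_range_succ', Finset.sum_range_succ']
            have h2 : 0 ≤ ∑ k ∈ Finset.range a, x i ^ (k + 1 + 1) * P ^ (a - (k + 1))
                * ((a + 1).choose (k + 1 + 1) : ℝ) := Finset.sum_nonneg fun k _ => by positivity
            simp only [zero_add, pow_one, pow_zero, Nat.sub_zero, Nat.choose_zero_right,
              Nat.choose_one_right, Nat.add_sub_cancel, Nat.add_sub_add_right]
            push_cast
            linarith
          calc _ ≤ P ^ (a + 1) / ((a + 1)! : ℝ) + x i * (P ^ a / (a ! : ℝ)) :=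
                add_le_add (ih hS _) (mul_le_mul_of_nonneg_left (ih hS _) hxi)
            _ = (P ^ (a + 1) + (a + 1) * x i * P ^ a) / ((a + 1)! : ℝ) := by
                rw [Nat.factorial_succ]; push_cast; field_simp
            _ ≤ _ := by gcongr
        · intro T hT T' hT' h
          have h1 : i ∉ T := fun h => hi ((Finset.mem_powersetCard.1 hT).1 h)
          have h2 : i ∉ T' := fun h => hi ((Finset.mem_powersetCard.1 hT').1 h)
          rw [← Finset.erase_insert h1, h, Finset.erase_insert h2]
      · rw [Finset.disjoint_left]
        intro T hT hT'
        obtain ⟨T', hT', rfl⟩ := Finset.mem_image.1 hT'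
        exact hi ((Finset.mem_powersetCard.1 hT).1 (by simp))

theorem sum_geom_Ico_le {q : ℝ} (h0 : 0 < q) (h1 : q < 1) (a N : ℕ) :
    ∑ t ∈ Finset.Ico a N, q ^ (t + 1) ≤ q ^ a * (1 / q - 1)⁻¹ := by
  have hpos : 0 < 1 - q := by linarith
  have e : (1 / q - 1)⁻¹ = q / (1 - q) := by
    rw [div_sub_one h0.ne', inv_div]
  rcases le_total a N with h | h
  · simp only [pow_succ]
    rw [← Finset.sum_mul, geom_sum_Ico' h1.ne h, e, div_mul_eq_mul_div, mul_div_assoc']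
    gcongr
    have := pow_pos h0 N
    linarith
  · rw [Finset.Ico_eq_empty_of_le h, e]
    simp only [Finset.sum_empty]
    positivity

theorem sum_powersetCard_geom_le {q : ℝ} (h0 : 0 < q) (h1 : q < 1) (b N a : ℕ) :
    ∑ T ∈ (Finset.Ico b N).powersetCard a, ∏ t ∈ T, q ^ (t + 1)
      ≤ (q ^ b) ^ a / ((a ! : ℝ) * (1 / q - 1) ^ a) := by
  have hpos : 0 < 1 / q - 1 := by rw [sub_pos, lt_div_iff₀ h0]; linarith
  refine (sum_powersetCard_prod_le _ (fun t _ => by positivity) a).trans ?_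
  calc _ ≤ (q ^ b * (1 / q - 1)⁻¹) ^ a / (a ! : ℝ) := by
        gcongr
        exact sum_geom_Ico_le h0 h1 b N
    _ = _ := by rw [mul_pow, inv_pow]; field_simp

theorem sum_biUnion_le {κ ι : Type*} [DecidableEq κ] (S : Finset ι) (t : ι → Finset κ) {F : κ → ℝ}
    (hF : ∀ x, 0 ≤ F x) : ∑ x ∈ S.biUnion t, F x ≤ ∑ i ∈ S, ∑ x ∈ t i, F x := by
  classical
  induction S using Finset.induction_on with
  | empty => simp
  | insert i S hi ih =>
    rw [Finset.biUnion_insert, Finset.sum_insert hi]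
    have := Finset.sum_union_inter (s₁ := t i) (s₂ := S.biUnion t) (f := F)
    have h2 : 0 ≤ ∑ x ∈ t i ∩ S.biUnion t, F x := Finset.sum_nonneg fun x _ => hF x
    linarith

namespace Lead

/-- The leading digits of the nonempty subsets of `{0, …, N - 1}`. -/
def upTo (α N : ℕ) : Finset Lead :=
  ((Finset.Icc 1 α).biUnion fun a => ((Finset.range N).powersetCard a).image fun T => (T, none)) ∪
    (Finset.range N).biUnion fun l =>
      ((Finset.Ico (l + 1) N).powersetCard α).image fun T => (T, some l)

theorem sum_upTo_le (α N : ℕ) {F : Lead → ℝ} (hF : ∀ o, 0 ≤ F o) :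
    ∑ o ∈ upTo α N, F o
      ≤ ∑ a ∈ Finset.Icc 1 α, ∑ T ∈ (Finset.Ico 0 N).powersetCard a, F (T, none)
        + ∑ l ∈ Finset.range N, ∑ T ∈ (Finset.Ico (l + 1) N).powersetCard α, F (T, some l) := by
  have h := Finset.sum_union_inter (f := F)
    (s₁ := (Finset.Icc 1 α).biUnion fun a => ((Finset.range N).powersetCard a).image
      fun T => ((T, none) : Lead))
    (s₂ := (Finset.range N).biUnion fun l =>
      ((Finset.Ico (l + 1) N).powersetCard α).image fun T => ((T, some l) : Lead))
  have h0 := Finset.sum_nonneg (s := ((Finset.Icc 1 α).biUnion fun a =>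
    ((Finset.range N).powersetCard a).image fun T => ((T, none) : Lead)) ∩
      (Finset.range N).biUnion fun l => ((Finset.Ico (l + 1) N).powersetCard α).image
        fun T => ((T, some l) : Lead)) fun o _ => hF o
  have h1 := sum_biUnion_le (Finset.Icc 1 α) (fun a => ((Finset.range N).powersetCard a).image
      fun T => ((T, none) : Lead)) hF
  have h2 := sum_biUnion_le (Finset.range N) (fun l =>
      ((Finset.Ico (l + 1) N).powersetCard α).image fun T => ((T, some l) : Lead)) hF
  have e1 : ∀ a, ∑ o ∈ ((Finset.range N).powersetCard a).image (fun T => ((T, none) : Lead)), F o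
      = ∑ T ∈ (Finset.Ico 0 N).powersetCard a, F (T, none) := fun a => by
    rw [Finset.sum_image fun T _ T' _ h => (Prod.mk.inj h).1, Finset.range_eq_Ico]
  have e2 : ∀ l, ∑ o ∈ ((Finset.Ico (l + 1) N).powersetCard α).image
      (fun T => ((T, some l) : Lead)), F o
      = ∑ T ∈ (Finset.Ico (l + 1) N).powersetCard α, F (T, some l) := fun l =>
    Finset.sum_image fun T _ T' _ h => (Prod.mk.inj h).1
  simp only [e1] at h1
  simp only [e2] at h2
  rw [upTo]
  linarith

theorem valid_of_mem_upTo {α N : ℕ} {o : Lead} (h : o ∈ upTo α N) : o.Valid α := by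
  simp only [upTo, Finset.mem_union, Finset.mem_biUnion, Finset.mem_image, Finset.mem_powersetCard,
    Finset.mem_Icc] at h
  rcases h with ⟨a, ha, T, hT, rfl⟩ | ⟨l, hl, T, hT, rfl⟩
  · simp only [Valid]; omega
  · refine ⟨hT.2, fun t ht => ?_⟩
    have := Finset.mem_Ico.1 (hT.1 ht)
    omega

theorem ne_of_mem_upTo {α N : ℕ} {o : Lead} (h : o ∈ upTo α N) : o ≠ (∅, none) := by
  simp only [upTo, Finset.mem_union, Finset.mem_biUnion, Finset.mem_image, Finset.mem_powersetCard,
    Finset.mem_Icc] at h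
  rcases h with ⟨a, ha, T, hT, rfl⟩ | ⟨l, hl, T, hT, rfl⟩
  · intro h
    have h1 : T = ∅ := (Prod.mk.inj h).1
    rw [h1, Finset.card_empty] at hT
    omega
  · intro h; exact absurd (Prod.mk.inj h).2 (by simp)

/-- Every set of naturals with at least `a` elements has a set `T` of `a` largest elements. -/
theorem exists_top (κ : Finset ℕ) : ∀ a ≤ κ.card, ∃ T ⊆ κ, T.card = a ∧ ∀ t ∈ T, ∀ x ∈ κ \ T, x < t
  | 0, _ => ⟨∅, by simp⟩
  | a + 1, h => by
    obtain ⟨T, hT, hc, ht⟩ := exists_top κ a (by omega)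
    have hne : (κ \ T).Nonempty := by
      rw [← Finset.card_pos, Finset.card_sdiff_of_subset hT]; omega
    have hm := (κ \ T).max'_mem hne
    set M := (κ \ T).max' hne
    have hm2 := Finset.mem_sdiff.1 hm
    refine ⟨insert M T, Finset.insert_subset hm2.1 hT, ?_, ?_⟩
    · rw [Finset.card_insert_of_notMem hm2.2, hc]
    · intro t htm x hx
      rw [Finset.mem_sdiff, Finset.mem_insert, not_or] at hx
      have hx' : x ∈ κ \ T := Finset.mem_sdiff.2 ⟨hx.1, hx.2.2⟩
      rcases Finset.mem_insert.1 htm with rfl | htm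
      · exact lt_of_le_of_ne ((κ \ T).le_max' x hx') hx.2.1
      · exact ht t htm x hx'

/-- Every nonempty frequency arises from leading digits and a set of nonleading ones. -/
theorem exists_join_eq (α : ℕ) {N : ℕ} {κ : Finset ℕ} (hκ : κ ⊆ Finset.range N)
    (hne : κ.Nonempty) : ∃ o ∈ upTo α N, ∃ R ∈ o.rests, o.join R = κ := by
  by_cases hc : κ.card ≤ α
  · refine ⟨(κ, none), ?_, ∅, by simp [rests], by simp [join, rem]⟩
    simp only [upTo, Finset.mem_union, Finset.mem_biUnion, Finset.mem_image,
      Finset.mem_powersetCard, Finset.mem_Icc]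
    exact Or.inl ⟨κ.card, ⟨Finset.card_pos.2 hne, hc⟩, κ, ⟨hκ, rfl⟩, rfl⟩
  · push Not at hc
    obtain ⟨T, hT, hcard, ht⟩ := exists_top κ α hc.le
    have hne' : (κ \ T).Nonempty := by
      rw [← Finset.card_pos, Finset.card_sdiff_of_subset hT]; omega
    have hm := (κ \ T).max'_mem hne'
    set M := (κ \ T).max' hne' with hM
    have hm2 := Finset.mem_sdiff.1 hm
    refine ⟨(T, some M), ?_, (κ \ T).erase M, ?_, ?_⟩
    · simp only [upTo, Finset.mem_union, Finset.mem_biUnion, Finset.mem_image,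
        Finset.mem_powersetCard, Finset.mem_Icc]
      refine Or.inr ⟨M, hκ hm2.1, T, ⟨fun t htT => Finset.mem_Ico.2 ⟨?_, ?_⟩, hcard⟩, rfl⟩
      · exact ht t htT M hm
      · exact Finset.mem_range.1 (hκ (hT htT))
    · simp only [rests, Finset.mem_powerset]
      intro x hx
      rw [Finset.mem_erase] at hx
      exact Finset.mem_range.2 (lt_of_le_of_ne ((κ \ T).le_max' x hx.2) hx.1)
    · simp only [join, rem]
      rw [Finset.insert_erase hm, Finset.sdiff_union_of_subset hT]

/-- The size `2^{‖κ‖}` of a frequency, where `‖κ‖` is the sum of the positions of the digits that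
are integrated out plus `λ` times the position of the next digit. -/
noncomputable def size (lam : ℝ) (o : Lead) : ℝ :=
  (∏ t ∈ o.1, (2 : ℝ) ^ (t + 1)) *
    match o.2 with
    | none => 1
    | some l => ((2 : ℝ) ^ (l + 1)) ^ lam

theorem prod_two_pow_ge_one (T : Finset ℕ) : 1 ≤ ∏ t ∈ T, (2 : ℝ) ^ (t + 1) :=
  Finset.prod_induction _ (fun x => (1 : ℝ) ≤ x) (fun _ _ => one_le_mul_of_one_le_of_one_le) le_rfl
    fun _ _ => one_le_pow₀ one_le_two

theorem one_le_size {lam : ℝ} (hlam : 0 < lam) (o : Lead) : 1 ≤ o.size lam := by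
  rw [size]
  refine one_le_mul_of_one_le_of_one_le (prod_two_pow_ge_one _) ?_
  split
  · exact le_rfl
  · exact Real.one_le_rpow (one_le_pow₀ one_le_two) hlam.le

theorem two_pow_rpow_neg (t : ℕ) (τ : ℝ) : ((2 : ℝ) ^ (t + 1)) ^ (-τ) = ((2 : ℝ) ^ (-τ)) ^ (t + 1) := by
  rw [← Real.rpow_natCast, ← Real.rpow_natCast, ← Real.rpow_mul two_pos.le,
    ← Real.rpow_mul two_pos.le, mul_comm]

theorem size_none_rpow (lam τ : ℝ) (T : Finset ℕ) :
    (size lam (T, none)) ^ (-τ) = ∏ t ∈ T, ((2 : ℝ) ^ (-τ)) ^ (t + 1) := by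
  simp only [size, mul_one]
  rw [← Real.finsetProd_rpow _ _ fun t _ => by positivity]
  exact Finset.prod_congr rfl fun t _ => two_pow_rpow_neg t τ

theorem size_some_rpow (lam τ : ℝ) (T : Finset ℕ) (l : ℕ) :
    (size lam (T, some l)) ^ (-τ)
      = (∏ t ∈ T, ((2 : ℝ) ^ (-τ)) ^ (t + 1)) * (((2 : ℝ) ^ (-τ)) ^ (l + 1)) ^ lam := by
  simp only [size]
  rw [Real.mul_rpow (Finset.prod_nonneg fun t _ => by positivity) (by positivity),
    ← Real.finsetProd_rpow _ _ fun t _ => by positivity]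
  congr 1
  · exact Finset.prod_congr rfl fun t _ => two_pow_rpow_neg t τ
  · rw [← two_pow_rpow_neg, ← Real.rpow_mul (by positivity), ← Real.rpow_mul (by positivity),
      mul_comm]

theorem prod_inv_sq (T : Finset ℕ) : (∏ t ∈ T, (2 : ℝ)⁻¹ ^ (t + 2)) ^ 2
    = (4 : ℝ) ^ (-(T.card : ℤ)) * (∏ t ∈ T, (2 : ℝ) ^ (t + 1)) ^ (-2 : ℝ) := by
  rw [← Finset.prod_pow, ← Real.finsetProd_rpow _ _ fun t _ => by positivity, zpow_neg,
    zpow_natCast, ← inv_pow, ← Finset.prod_const, ← Finset.prod_mul_distrib]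
  refine Finset.prod_congr rfl fun t _ => ?_
  rw [Real.rpow_neg (by positivity), Real.rpow_two, inv_pow]
  have : (2 : ℝ) ^ (t + 2) = 2 * 2 ^ (t + 1) := by ring
  rw [this]
  field_simp
  norm_num

theorem weight_none (lam : ℝ) {T : Finset ℕ} (hT : T ≠ ∅) :
    weight lam (T, none) = (4 : ℝ) ^ (-(T.card : ℤ) + 1) * size lam (T, none) ^ (-2 : ℝ) := by
  simp only [weight, if_neg hT, mul_pow, prod_inv_sq, size, mul_one]
  rw [zpow_add_one₀ (by norm_num)]
  ring

theorem weight_some (lam : ℝ) (T : Finset ℕ) (l : ℕ) :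
    weight lam (T, some l) = (4 : ℝ) ^ (-(T.card : ℤ)) * size lam (T, some l) ^ (-2 : ℝ) := by
  simp only [weight, size, prod_inv_sq]
  rw [Real.mul_rpow (Finset.prod_nonneg fun t _ => by positivity) (by positivity), mul_assoc]
  congr 2
  rw [← Real.rpow_mul (by positivity), inv_pow, Real.inv_rpow (by positivity),
    ← Real.rpow_neg (by positivity)]
  congr 1; ring

theorem weight_nonneg (lam : ℝ) (o : Lead) : 0 ≤ o.weight lam := by
  simp only [weight]
  split
  · split_ifs <;> positivity
  · positivity

theorem sum_rpow_geom_le {q β : ℝ} (h0 : 0 < q) (h1 : q < 1) (hβ : 0 < β) (N : ℕ) :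
    ∑ l ∈ Finset.range N, (q ^ (l + 1)) ^ β ≤ 1 / ((1 / q) ^ β - 1) := by
  have hq : 0 < q ^ β := Real.rpow_pos_of_pos h0 _
  have hq1 : q ^ β < 1 := Real.rpow_lt_one h0.le h1 hβ
  have e : ∀ l, (q ^ (l + 1)) ^ β = (q ^ β) ^ (l + 1) := fun l => by
    rw [← Real.rpow_natCast, ← Real.rpow_natCast, ← Real.rpow_mul h0.le, ← Real.rpow_mul h0.le,
      mul_comm]
  simp only [e]
  have := sum_geom_Ico_le hq hq1 0 N
  rw [pow_zero, one_mul, ← Finset.range_eq_Ico] at this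
  refine this.trans (le_of_eq ?_)
  rw [Real.div_rpow zero_le_one h0.le, Real.one_rpow, one_div ((1 : ℝ) / q ^ β - 1)]

theorem geom_pow_mul {q lam : ℝ} (h0 : 0 < q) (α l : ℕ) :
    (q ^ (l + 1)) ^ α * (q ^ (l + 1)) ^ lam = (q ^ (l + 1)) ^ ((α : ℝ) + lam) := by
  rw [Real.rpow_add (by positivity), Real.rpow_natCast]

/-- The weights of the leading digits in one coordinate, discounted by a power of the size. -/
theorem sum_weight_mul_size_le (α N : ℕ) {lam θ : ℝ} (hlam : 0 < lam) (hθ1 : θ < 1) :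
    ∑ o ∈ upTo α N, o.weight lam * o.size lam ^ (2 * θ) ≤ constC α lam θ := by
  have hτ : 0 < 1 - θ := by linarith
  set q : ℝ := (2 : ℝ) ^ (-(2 * (1 - θ))) with hq
  have hq0 : 0 < q := Real.rpow_pos_of_pos two_pos _
  have hq1 : q < 1 := Real.rpow_lt_one_of_one_lt_of_neg one_lt_two (by linarith)
  have hqi : 1 / q = (4 : ℝ) ^ (1 - θ) := by
    rw [hq, one_div, ← Real.rpow_neg two_pos.le, neg_neg, Real.rpow_mul two_pos.le]; norm_num
  have h41 : 0 < (4 : ℝ) ^ (1 - θ) - 1 := sub_pos.2 (Real.one_lt_rpow (by norm_num) hτ)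
  have hpos : 0 < (α : ℝ) + lam := by positivity
  have h42 : 0 < (4 : ℝ) ^ (((α : ℝ) + lam) * (1 - θ)) - 1 :=
    sub_pos.2 (Real.one_lt_rpow (by norm_num) (by positivity))
  have hsz : ∀ o : Lead, o.size lam ^ (-2 : ℝ) * o.size lam ^ (2 * θ)
      = o.size lam ^ (-(2 * (1 - θ))) := fun o => by
    rw [← Real.rpow_add (zero_lt_one.trans_le (one_le_size hlam o))]
    congr 1; ring
  refine (sum_upTo_le α N fun o => mul_nonneg (weight_nonneg lam o)
    (Real.rpow_nonneg (zero_le_one.trans (one_le_size hlam o)) _)).trans ?_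
  rw [constC, add_comm]
  refine add_le_add ?_ ?_
  · have e : ∀ l, ∀ T ∈ (Finset.Ico (l + 1) N).powersetCard α,
        weight lam (T, some l) * size lam (T, some l) ^ (2 * θ)
          = (4 : ℝ) ^ (-(α : ℤ)) * (q ^ (l + 1)) ^ lam * ∏ t ∈ T, q ^ (t + 1) := by
      intro l T hT
      rw [weight_some, (Finset.mem_powersetCard.1 hT).2, mul_assoc, hsz, size_some_rpow]
      ring
    rw [Finset.sum_congr rfl fun l _ => Finset.sum_congr rfl (e l)]
    simp only [← Finset.mul_sum]
    calc _ ≤ ∑ l ∈ Finset.range N, (4 : ℝ) ^ (-(α : ℤ)) * (q ^ (l + 1)) ^ lam *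
          ((q ^ (l + 1)) ^ α / ((α ! : ℝ) * (1 / q - 1) ^ α)) :=
          Finset.sum_le_sum fun l _ => mul_le_mul_of_nonneg_left
            (sum_powersetCard_geom_le hq0 hq1 _ _ _) (by positivity)
      _ = (4 : ℝ) ^ (-(α : ℤ)) / ((α ! : ℝ) * (1 / q - 1) ^ α)
          * ∑ l ∈ Finset.range N, (q ^ (l + 1)) ^ ((α : ℝ) + lam) := by
          rw [Finset.mul_sum]
          refine Finset.sum_congr rfl fun l _ => ?_
          rw [← geom_pow_mul hq0]; ring
      _ ≤ (4 : ℝ) ^ (-(α : ℤ)) / ((α ! : ℝ) * (1 / q - 1) ^ α)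
          * (1 / ((1 / q) ^ ((α : ℝ) + lam) - 1)) := by
          refine mul_le_mul_of_nonneg_left (sum_rpow_geom_le hq0 hq1 hpos N) ?_
          rw [hqi]; positivity
      _ = _ := by
          rw [hqi, ← Real.rpow_mul (by norm_num), mul_comm (1 - θ)]
          rw [div_mul_div_comm, mul_one]
          congr 1; ring
  · have e : ∀ a ∈ Finset.Icc 1 α, ∀ T ∈ (Finset.Ico 0 N).powersetCard a,
        weight lam (T, none) * size lam (T, none) ^ (2 * θ)
          = (4 : ℝ) ^ (-(a : ℤ) + 1) * ∏ t ∈ T, q ^ (t + 1) := by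
      intro a ha T hT
      have hc := (Finset.mem_powersetCard.1 hT).2
      have hne : T ≠ ∅ := by
        rintro rfl
        rw [Finset.card_empty] at hc
        have := (Finset.mem_Icc.1 ha).1
        omega
      rw [weight_none lam hne, hc, mul_assoc, hsz, size_none_rpow]
    rw [Finset.sum_congr rfl fun a ha => Finset.sum_congr rfl (e a ha)]
    simp only [← Finset.mul_sum]
    calc _ ≤ ∑ a ∈ Finset.Icc 1 α, (4 : ℝ) ^ (-(a : ℤ) + 1)
            / ((a ! : ℝ) * ((4 : ℝ) ^ (1 - θ) - 1) ^ a) := by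
          refine Finset.sum_le_sum fun a _ => ?_
          rw [← hqi]
          have := sum_powersetCard_geom_le hq0 hq1 0 N a
          rw [pow_zero, one_pow] at this
          refine (mul_le_mul_of_nonneg_left this (by positivity)).trans (le_of_eq ?_)
          rw [mul_one_div]
      _ ≤ _ := by
          refine Finset.sum_le_sum_of_subset_of_nonneg (fun a ha => ?_) fun a _ _ => by positivity
          have := (Finset.mem_Icc.1 ha).2
          exact Finset.mem_range.2 (by omega)

/-- The number of frequencies with leading digits `o` in one coordinate, discounted by their size;
leading digits whose pivot is not below `m` are left out. -/
noncomputable def count (lam p : ℝ) (m : ℕ) (o : Lead) : ℝ :=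
  match o.2 with
  | none => o.size lam ^ (-(1 / p))
  | some l => if l < m then 2 ^ l * o.size lam ^ (-(1 / p)) else 0

theorem count_nonneg {lam : ℝ} (hlam : 0 < lam) (p : ℝ) (m : ℕ) (o : Lead) :
    0 ≤ o.count lam p m := by
  have := Real.rpow_nonneg (zero_le_one.trans (one_le_size hlam o)) (-(1 / p))
  simp only [count]
  split
  · exact this
  · split_ifs
    · positivity
    · exact le_rfl

/-- The discounted count over all leading digits in one coordinate: each of the `m` admissible pivots
contributes at most `constA`, the frequencies without pivot at most `constB`. -/
theorem sum_count_le (α N m : ℕ) {lam : ℝ} (hlam : 0 < lam) :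
    ∑ o ∈ upTo α N, o.count lam ((α : ℝ) + lam) m ≤ constA α lam * m + constB α lam := by
  have hp : 0 < (α : ℝ) + lam := by positivity
  set p := (α : ℝ) + lam with hpdef
  set q : ℝ := (2 : ℝ) ^ (-(1 / p)) with hq
  have hq0 : 0 < q := Real.rpow_pos_of_pos two_pos _
  have hq1 : q < 1 := Real.rpow_lt_one_of_one_lt_of_neg one_lt_two (by
    have : 0 < 1 / p := by positivity
    linarith)
  have hqi : 1 / q = (2 : ℝ) ^ (1 / p) := by
    rw [hq, one_div, ← Real.rpow_neg two_pos.le, neg_neg]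
  have h21 : 0 < (2 : ℝ) ^ (1 / p) - 1 := sub_pos.2 (Real.one_lt_rpow one_lt_two (by positivity))
  have hqp : ∀ l : ℕ, (q ^ (l + 1)) ^ p = (2 : ℝ)⁻¹ ^ (l + 1) := fun l => by
    rw [← Real.rpow_natCast, ← Real.rpow_mul hq0.le, hq, ← Real.rpow_mul two_pos.le,
      mul_comm ((l + 1 : ℕ) : ℝ), ← mul_assoc, neg_mul, one_div_mul_cancel hp.ne',
      neg_one_mul, Real.rpow_neg two_pos.le, Real.rpow_natCast, inv_pow]
  refine (sum_upTo_le α N fun o => count_nonneg hlam _ m o).trans ?_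
  rw [add_comm]
  refine add_le_add ?_ ?_
  · have e : ∀ l, ∑ T ∈ (Finset.Ico (l + 1) N).powersetCard α, count lam p m (T, some l)
        ≤ if l < m then constA α lam else 0 := by
      intro l
      simp only [count]
      split_ifs with h
      · rw [← Finset.mul_sum]
        simp only [size_some_rpow]
        rw [← Finset.sum_mul]
        calc _ ≤ 2 ^ l * ((q ^ (l + 1)) ^ α / ((α ! : ℝ) * (1 / q - 1) ^ α)
              * (q ^ (l + 1)) ^ lam) := by
              gcongr
              exact sum_powersetCard_geom_le hq0 hq1 _ _ _
          _ = 2 ^ l * ((q ^ (l + 1)) ^ α * (q ^ (l + 1)) ^ lam)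
              / ((α ! : ℝ) * (1 / q - 1) ^ α) := by ring
          _ ≤ 1 / ((α ! : ℝ) * (1 / q - 1) ^ α) := by
              rw [geom_pow_mul hq0, ← hpdef, hqp]
              have : (2 : ℝ) ^ l * (2 : ℝ)⁻¹ ^ (l + 1) ≤ 1 := by
                rw [pow_succ, ← mul_assoc, ← mul_pow]; norm_num
              have hpos : 0 < (α ! : ℝ) * (1 / q - 1) ^ α := by rw [hqi]; positivity
              gcongr
          _ = _ := by rw [constA, hqi]
      · simp
    have hA : 0 ≤ constA α lam := by rw [constA, ← hpdef]; positivity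
    calc _ ≤ ∑ l ∈ Finset.range N, if l < m then constA α lam else 0 :=
          Finset.sum_le_sum fun l _ => e l
      _ = ∑ l ∈ (Finset.range N).filter (· < m), constA α lam := by rw [Finset.sum_filter]
      _ ≤ ∑ l ∈ Finset.range m, constA α lam := by
          refine Finset.sum_le_sum_of_subset_of_nonneg (fun l hl => ?_) fun _ _ _ => hA
          exact Finset.mem_range.2 (Finset.mem_filter.1 hl).2
      _ = _ := by rw [Finset.sum_const, Finset.card_range, nsmul_eq_mul, mul_comm]
  · rw [constB]
    refine Finset.sum_le_sum fun a _ => ?_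
    simp only [count, size_none_rpow]
    have := sum_powersetCard_geom_le hq0 hq1 0 N a
    rwa [pow_zero, one_pow, hqi] at this

end Lead

/-! ### Few small frequencies and a small tail -/

/-- The Walsh coefficient of `f` at the frequency `k`. -/
noncomputable def coeff {s : ℕ} (f : (Fin s → ℝ) → ℝ) (k : Fin s → Finset ℕ) : ℝ :=
  ∫ x, f x * ∏ j, wal (k j) (x j) ∂(cubeMeasure (Fin s))

/-- The frequencies that involve only the first `N` digits of each coordinate. -/
def freqs (s N : ℕ) : Finset (Fin s → Finset ℕ) :=
  Fintype.piFinset fun _ => (Finset.range N).powerset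

/-- The coordinates that a frequency involves. -/
def freqSupp {s : ℕ} (k : Fin s → Finset ℕ) : Finset (Fin s) :=
  Finset.univ.filter fun j => k j ≠ ∅

theorem freqSupp_eq_empty {s : ℕ} {k : Fin s → Finset ℕ} : freqSupp k = ∅ ↔ k = fun _ => ∅ := by
  simp only [freqSupp, Finset.filter_eq_empty_iff, Finset.mem_univ, true_implies, not_not, funext_iff]

/-- The leading digits of the frequencies that involve exactly the coordinates in `u`. -/
def leads {s : ℕ} (α N : ℕ) (u : Finset (Fin s)) : Finset (Fin s → Lead) :=
  Fintype.piFinset fun j => if j ∈ u then Lead.upTo α N else {(∅, none)}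

theorem valid_of_mem_leads {s α N : ℕ} {u : Finset (Fin s)} {o : Fin s → Lead}
    (h : o ∈ leads α N u) (j : Fin s) : (o j).Valid α := by
  have hj := Fintype.mem_piFinset.1 h j
  split_ifs at hj with hu
  · exact Lead.valid_of_mem_upTo hj
  · rw [Finset.mem_singleton.1 hj]; simp [Lead.Valid]

theorem mem_iff_of_mem_leads {s α N : ℕ} {u : Finset (Fin s)} {o : Fin s → Lead}
    (h : o ∈ leads α N u) (j : Fin s) : j ∈ u ↔ o j ≠ (∅, none) := by
  have hj := Fintype.mem_piFinset.1 h j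
  split_ifs at hj with hu
  · exact ⟨fun _ => Lead.ne_of_mem_upTo hj, fun _ => hu⟩
  · exact ⟨fun h => absurd h hu, fun h => absurd (Finset.mem_singleton.1 hj) h⟩

theorem sum_leads_prod_le {s α N : ℕ} (u : Finset (Fin s)) (g : Lead → ℝ) (hg : ∀ o, 0 ≤ g o)
    (h1 : g (∅, none) = 1) {c : ℝ} (hc : ∑ o ∈ Lead.upTo α N, g o ≤ c) :
    ∑ o ∈ leads α N u, ∏ j, g (o j) ≤ c ^ u.card := by
  rw [leads, ← Finset.prod_univ_sum]
  calc _ ≤ ∏ j, if j ∈ u then c else 1 := by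
        refine Finset.prod_le_prod (fun j _ => Finset.sum_nonneg fun _ _ => hg _) fun j _ => ?_
        split_ifs with h
        · exact hc
        · rw [Finset.sum_singleton, h1]
    _ = _ := by rw [Finset.prod_ite_mem, Finset.univ_inter, Finset.prod_const]

theorem exists_leads {s α N : ℕ} {k : Fin s → Finset ℕ} (hk : k ∈ freqs s N) :
    ∃ o ∈ leads α N (freqSupp k), ∃ R ∈ Fintype.piFinset fun j => (o j).rests,
      ∀ j, (o j).join (R j) = k j := by
  have h : ∀ j, ∃ o ∈ (if j ∈ freqSupp k then Lead.upTo α N else {(∅, none)}),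
      ∃ R ∈ Lead.rests o, o.join R = k j := by
    intro j
    have hkj := Finset.mem_powerset.1 (Fintype.mem_piFinset.1 hk j)
    split_ifs with hj
    · exact Lead.exists_join_eq α hkj (Finset.nonempty_iff_ne_empty.2 (Finset.mem_filter.1 hj).2)
    · have : k j = ∅ := by
        by_contra h
        exact hj (Finset.mem_filter.2 ⟨Finset.mem_univ _, h⟩)
      exact ⟨(∅, none), Finset.mem_singleton_self _, ∅, by simp [Lead.rests],
        by simp [Lead.join, Lead.rem, this]⟩
  choose o ho R hR hj using h
  exact ⟨o, Fintype.mem_piFinset.2 ho, R, Fintype.mem_piFinset.2 hR, hj⟩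

/-- A choice of leading digits turns sums over frequencies into sums over leading digits followed
by sums over the nonleading ones. -/
theorem exists_leading (s α N : ℕ) : ∃ d : (Fin s → Finset ℕ) → (Fin s → Lead),
    ∀ (u : Finset (Fin s)) (G : (Fin s → Lead) → (Fin s → Finset ℕ) → ℝ), (∀ o k, 0 ≤ G o k) →
      ∑ k ∈ (freqs s N).filter (fun k => freqSupp k = u), G (d k) k
        ≤ ∑ o ∈ leads α N u, ∑ R ∈ Fintype.piFinset fun j => (o j).rests,
          G o (fun j => (o j).join (R j)) := by
  classical
  choose! o ho R hR hj using fun k (hk : k ∈ freqs s N) => exists_leads (α := α) hk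
  refine ⟨o, fun u G hG => ?_⟩
  rw [Finset.sum_sigma']
  have hinj : Set.InjOn (fun k => (⟨o k, R k⟩ : (_ : Fin s → Lead) × (Fin s → Finset ℕ)))
      ((freqs s N).filter (fun k => freqSupp k = u)) := by
    intro k hk k' hk' h
    have h1 := hj k (Finset.mem_filter.1 hk).1
    have h2 := hj k' (Finset.mem_filter.1 hk').1
    obtain ⟨e1, e2⟩ := Sigma.mk.inj h
    have e2 := eq_of_heq e2
    funext j
    rw [← h1, ← h2, e1, e2]
  calc _ = ∑ k ∈ (freqs s N).filter (fun k => freqSupp k = u),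
        G (o k) (fun j => (o k j).join (R k j)) := by
        refine Finset.sum_congr rfl fun k hk => ?_
        rw [funext (hj k (Finset.mem_filter.1 hk).1)]
    _ = ∑ q ∈ ((freqs s N).filter (fun k => freqSupp k = u)).image
          (fun k => (⟨o k, R k⟩ : (_ : Fin s → Lead) × (Fin s → Finset ℕ))),
          G q.1 (fun j => (q.1 j).join (q.2 j)) := by rw [Finset.sum_image hinj]
    _ ≤ _ := by
        refine Finset.sum_le_sum_of_subset_of_nonneg (fun q hq => ?_) fun _ _ _ => hG _ _
        obtain ⟨k, hk, rfl⟩ := Finset.mem_image.1 hq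
        have hk := Finset.mem_filter.1 hk
        refine Finset.mem_sigma.2 ⟨?_, hR k hk.1⟩
        rw [← hk.2]
        exact ho k hk.1

theorem Lead.pow_le_size {α : ℕ} {lam : ℝ} {T : Finset ℕ} {l : ℕ}
    (h : Lead.Valid α (T, some l)) : ((2 : ℝ) ^ (l + 1)) ^ ((α : ℝ) + lam) ≤ Lead.size lam (T, some l) := by
  have h2 : (T.card = α ∧ ∀ t ∈ T, l < t) := h
  simp only [Lead.size]
  rw [Real.rpow_add (by positivity), Real.rpow_natCast, ← h2.1, ← Finset.prod_const]
  refine mul_le_mul_of_nonneg_right ?_ (by positivity)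
  refine Finset.prod_le_prod (fun _ _ => by positivity) fun t ht => ?_
  exact pow_le_pow_right₀ one_le_two (by have := h2.2 t ht; omega)

/-- The size of a frequency is at least `2^{(α + λ)(l + 1)}` when its pivot is `l`, so the pivot of a
small frequency is below `m` and `count` does not discard it. -/
theorem Lead.card_rests_le {α m : ℕ} {lam R : ℝ} (hlam : 0 < lam) {o : Lead} (ho : o.Valid α)
    (hR : R ≤ ((2 : ℝ) ^ m) ^ ((α : ℝ) + lam)) (hoR : o.size lam ≤ R) :
    (o.rests.card : ℝ) = o.count lam ((α : ℝ) + lam) m * o.size lam ^ (1 / ((α : ℝ) + lam)) := by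
  have hs : 0 < o.size lam := zero_lt_one.trans_le (Lead.one_le_size hlam o)
  have hp : 0 < (α : ℝ) + lam := by positivity
  have h1 : o.size lam ^ (-(1 / ((α : ℝ) + lam))) * o.size lam ^ (1 / ((α : ℝ) + lam)) = 1 := by
    rw [← Real.rpow_add hs, neg_add_cancel, Real.rpow_zero]
  obtain ⟨T, q⟩ := o
  cases q with
  | none => simp only [Lead.count, Lead.rests, h1]; simp
  | some l =>
    have h2 := (Lead.pow_le_size ho).trans (hoR.trans hR)
    have h3 : (2 : ℝ) ^ (l + 1) ≤ 2 ^ m := (Real.rpow_le_rpow_iff (by positivity) (by positivity) hp).1 h2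
    have h4 : l + 1 ≤ m := (pow_le_pow_iff_right₀ one_lt_two).1 h3
    simp only [Lead.count, Lead.rests, if_pos (show l < m by omega), mul_assoc, h1]
    simp

section

variable {s α : ℕ} {lam : ℝ} {f : (Fin s → ℝ) → ℝ}

theorem componentNorm_le (u : Finset (Fin s)) :
    componentNorm α lam f u ≤ variationNorm α lam f := le_iSup (componentNorm α lam f) u

theorem relVar_nonneg (u : Finset (Fin s)) : 0 ≤ relVar α lam f u := ENNReal.toReal_nonneg

theorem relVar_le_one (u : Finset (Fin s)) : relVar α lam f u ≤ 1 := by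
  rw [relVar]
  refine ENNReal.toReal_le_of_le_ofReal zero_le_one ?_
  rw [ENNReal.ofReal_one]
  exact ENNReal.div_le_of_le_mul (by rw [one_mul]; exact componentNorm_le u)

theorem toReal_componentNorm (hV : variationNorm α lam f < ⊤) (u : Finset (Fin s)) :
    (componentNorm α lam f u).toReal = relVar α lam f u * (variationNorm α lam f).toReal := by
  rw [relVar, ENNReal.toReal_div]
  by_cases h : (variationNorm α lam f).toReal = 0
  · have h0 : variationNorm α lam f = 0 := by
      rcases (ENNReal.toReal_eq_zero_iff _).1 h with h | h
      · exact h
      · exact absurd h hV.ne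
    have : componentNorm α lam f u = 0 := le_antisymm (h0 ▸ componentNorm_le u) bot_le
    rw [h, mul_zero, this, ENNReal.toReal_zero]
  · rw [div_mul_cancel₀ _ h]

theorem two_rpow_sub_pos (hlam : 0 < lam) : 0 < (2 : ℝ) ^ (1 / ((α : ℝ) + lam)) - 1 :=
  sub_pos.2 (Real.one_lt_rpow one_lt_two (by positivity))

theorem constA_nonneg (hlam : 0 < lam) : 0 ≤ constA α lam := by
  have := two_rpow_sub_pos (α := α) hlam
  rw [constA]; positivity

theorem constB_nonneg (hlam : 0 < lam) : 0 ≤ constB α lam := by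
  have := two_rpow_sub_pos (α := α) hlam
  rw [constB]
  exact Finset.sum_nonneg fun _ _ => by positivity

theorem constC_nonneg (hlam : 0 < lam) {θ : ℝ} (hθ : θ < 1) : 0 ≤ constC α lam θ := by
  have h1 : 0 < (4 : ℝ) ^ (1 - θ) - 1 := sub_pos.2 (Real.one_lt_rpow (by norm_num) (by linarith))
  have h2 : 0 < (4 : ℝ) ^ (((α : ℝ) + lam) * (1 - θ)) - 1 :=
    sub_pos.2 (Real.one_lt_rpow (by norm_num) (mul_pos (by positivity) (by linarith)))
  rw [constC]
  exact add_nonneg (by positivity) (Finset.sum_nonneg fun _ _ => by positivity)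

theorem one_le_gammaM (hlam : 0 < lam) {γ : Finset (Fin s) → ℝ} (hγ : ∀ u, 0 ≤ γ u) (m : ℕ) :
    1 ≤ gammaM α lam γ m := by
  rw [gammaM, le_add_iff_nonneg_right]
  have h1 := constA_nonneg (α := α) hlam
  have h2 := constB_nonneg (α := α) hlam
  exact Finset.sum_nonneg fun u _ => mul_nonneg (Real.rpow_nonneg (hγ u) _) (by positivity)

/-- The number of frequencies on `u` whose size is at most `Q ^ (α + λ)`, up to a factor that
depends on the relative variation. -/
theorem card_small_le (hlam : 0 < lam) {γ Q : ℝ} (hγ0 : 0 ≤ γ) (hγ1 : γ ≤ 1) (hQ : 0 ≤ Q) {m : ℕ}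
    (hQm : Q ≤ 2 ^ m) (N : ℕ) (u : Finset (Fin s)) :
    ∑ o ∈ leads α N u, ∑ _R ∈ Fintype.piFinset fun j => (o j).rests,
      (if ∏ j, (o j).size lam ≤ Q ^ ((α : ℝ) + lam) *
          γ ^ (((α : ℝ) + lam) / ((α : ℝ) + lam + 1 / 2)) then (1 : ℝ) else 0)
      ≤ Q * (γ ^ (1 / ((α : ℝ) + lam + 1 / 2)) * (constA α lam * m + constB α lam) ^ u.card) := by
  have hp : 0 < (α : ℝ) + lam := by positivity
  set p := (α : ℝ) + lam with hpd
  set R := Q ^ p * γ ^ (p / (p + 1 / 2)) with hR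
  have hR0 : 0 ≤ R := by positivity
  have hRm : R ≤ ((2 : ℝ) ^ m) ^ p := by
    rw [hR, ← mul_one (((2 : ℝ) ^ m) ^ p)]
    exact mul_le_mul (Real.rpow_le_rpow hQ hQm hp.le)
      (Real.rpow_le_one hγ0 hγ1 (by positivity)) (by positivity) (by positivity)
  have hRp : R ^ (1 / p) = Q * γ ^ (1 / (p + 1 / 2)) := by
    rw [hR, Real.mul_rpow (by positivity) (by positivity), ← Real.rpow_mul hQ, ← Real.rpow_mul hγ0,
      mul_one_div_cancel hp.ne', Real.rpow_one]
    congr 2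
    field_simp
  have key : ∀ o ∈ leads α N u, ∑ _R ∈ Fintype.piFinset fun j => (o j).rests,
      (if ∏ j, (o j).size lam ≤ R then (1 : ℝ) else 0)
        ≤ R ^ (1 / p) * ∏ j, (o j).count lam p m := by
    intro o ho
    have hc : 0 ≤ ∏ j, (o j).count lam p m :=
      Finset.prod_nonneg fun j _ => Lead.count_nonneg hlam _ _ _
    rw [Finset.sum_const, Fintype.card_piFinset, nsmul_eq_mul]
    split_ifs with h
    · rw [mul_one, Nat.cast_prod]
      have hsz : ∀ j, (o j).size lam ≤ R := fun j => by
        refine le_trans ?_ h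
        rw [← Finset.mul_prod_erase _ _ (Finset.mem_univ j)]
        refine le_mul_of_one_le_right (zero_le_one.trans (Lead.one_le_size hlam _)) ?_
        exact Finset.prod_induction _ (fun x => (1 : ℝ) ≤ x)
          (fun _ _ => one_le_mul_of_one_le_of_one_le) le_rfl fun _ _ => Lead.one_le_size hlam _
      rw [Finset.prod_congr rfl fun j _ =>
        Lead.card_rests_le hlam (valid_of_mem_leads ho j) hRm (hsz j), Finset.prod_mul_distrib,
        mul_comm]
      refine mul_le_mul_of_nonneg_right ?_ hc
      rw [Real.finsetProd_rpow _ _ fun j _ => zero_le_one.trans (Lead.one_le_size hlam _)]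
      exact Real.rpow_le_rpow
        (Finset.prod_nonneg fun j _ => zero_le_one.trans (Lead.one_le_size hlam _)) h (by positivity)
    · rw [mul_zero]
      exact mul_nonneg (Real.rpow_nonneg hR0 _) hc
  refine (Finset.sum_le_sum key).trans ?_
  rw [← Finset.mul_sum, hRp, mul_assoc]
  refine mul_le_mul_of_nonneg_left (mul_le_mul_of_nonneg_left ?_ (by positivity)) hQ
  refine sum_leads_prod_le u _ (fun o => Lead.count_nonneg hlam _ _ _) ?_
    (Lead.sum_count_le α N m hlam)
  simp [Lead.count, Lead.size]

/-- The coefficients of the frequencies on `u` whose size exceeds the threshold: as `size / threshold`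
is at least one there, inserting its power `2 θ` makes the sum over the leading digits converge. -/
theorem sum_tail_le (hf : MixedSmooth α f) (hV : variationNorm α lam f < ⊤) (hlam : 0 < lam)
    {θ Q : ℝ} (hθ0 : 0 < θ) (hθ1 : θ < 1) (hQ : 0 < Q) (N : ℕ) {u : Finset (Fin s)}
    (hu : u.Nonempty) :
    ∑ o ∈ leads α N u, ∑ R ∈ Fintype.piFinset fun j => (o j).rests,
      (if ∏ j, (o j).size lam ≤ Q ^ ((α : ℝ) + lam) *
          relVar α lam f u ^ (((α : ℝ) + lam) / ((α : ℝ) + lam + 1 / 2)) then (0 : ℝ) else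
        coeff f (fun j => (o j).join (R j)) ^ 2)
      ≤ (variationNorm α lam f).toReal ^ 2 * Q ^ (-(2 * θ * ((α : ℝ) + lam))) *
        (relVar α lam f u ^ ((1 + 2 * (1 - θ) * ((α : ℝ) + lam)) / ((α : ℝ) + lam + 1 / 2)) *
          constC α lam θ ^ u.card) := by
  have hp : 0 < (α : ℝ) + lam := by positivity
  set p := (α : ℝ) + lam with hpd
  set γ := relVar α lam f u with hγ
  have hγ0 : 0 ≤ γ := relVar_nonneg u
  set V := (variationNorm α lam f).toReal with hVd
  set R0 := Q ^ p * γ ^ (p / (p + 1 / 2)) with hR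
  have hR0 : 0 ≤ R0 := by positivity
  have hC := constC_nonneg (α := α) hlam hθ1
  have hw : ∀ o : Fin s → Lead, 0 ≤ ∏ j, (o j).weight lam := fun o =>
    Finset.prod_nonneg fun j _ => Lead.weight_nonneg lam _
  have h1 : ∀ o ∈ leads α N u, ∑ R ∈ Fintype.piFinset fun j => (o j).rests,
      coeff f (fun j => (o j).join (R j)) ^ 2 ≤ (γ * V) ^ 2 * ∏ j, (o j).weight lam := by
    intro o ho
    have := sum_sq_coeff_le hf ((componentNorm_le u).trans_lt hV) (valid_of_mem_leads ho)
      (mem_iff_of_mem_leads ho) hu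
    rwa [toReal_componentNorm hV] at this
  rcases hγ0.eq_or_lt with h0 | hpos
  · -- If `γ_u = 0` then the threshold is zero, but all the coefficients vanish.
    refine le_trans ?_ (by positivity : (0 : ℝ) ≤ _)
    refine Finset.sum_nonpos fun o ho => ?_
    have h2 := h1 o ho
    rw [← h0] at h2
    simp only [zero_mul, ne_eq, OfNat.ofNat_ne_zero, not_false_eq_true, zero_pow] at h2
    refine le_trans (Finset.sum_le_sum fun R _ => ?_) h2
    split_ifs
    · positivity
    · exact le_rfl
  · have hRpos : 0 < R0 := by positivity
    have key : ∀ o ∈ leads α N u, ∑ R ∈ Fintype.piFinset fun j => (o j).rests,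
        (if ∏ j, (o j).size lam ≤ R0 then (0 : ℝ) else coeff f (fun j => (o j).join (R j)) ^ 2)
        ≤ (γ * V) ^ 2 * R0 ^ (-(2 * θ)) *
          ∏ j, ((o j).weight lam * (o j).size lam ^ (2 * θ)) := by
      intro o ho
      have hs : 0 ≤ ∏ j, (o j).size lam :=
        Finset.prod_nonneg fun j _ => zero_le_one.trans (Lead.one_le_size hlam _)
      rw [Finset.prod_mul_distrib,
        Real.finsetProd_rpow _ _ fun j _ => zero_le_one.trans (Lead.one_le_size hlam _)]
      by_cases h : ∏ j, (o j).size lam ≤ R0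
      · simp only [if_pos h, Finset.sum_const_zero]
        have := hw o
        positivity
      · simp only [if_neg h]
        refine (h1 o ho).trans ?_
        have h2 : 1 ≤ R0 ^ (-(2 * θ)) * (∏ j, (o j).size lam) ^ (2 * θ) := by
          rw [Real.rpow_neg hR0, inv_mul_eq_div, ← Real.div_rpow hs hR0]
          refine Real.one_le_rpow ?_ (by positivity)
          rw [one_le_div hRpos]
          exact (not_le.1 h).le
        calc _ = (γ * V) ^ 2 * (∏ j, (o j).weight lam) * 1 := by rw [mul_one]
          _ ≤ (γ * V) ^ 2 * (∏ j, (o j).weight lam) *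
              (R0 ^ (-(2 * θ)) * (∏ j, (o j).size lam) ^ (2 * θ)) :=
            mul_le_mul_of_nonneg_left h2 (mul_nonneg (sq_nonneg _) (hw o))
          _ = _ := by ring
    refine (Finset.sum_le_sum key).trans ?_
    rw [← Finset.mul_sum]
    have hsum : ∑ o ∈ leads α N u, ∏ j, ((o j).weight lam * (o j).size lam ^ (2 * θ))
        ≤ constC α lam θ ^ u.card := by
      refine sum_leads_prod_le u (fun o => o.weight lam * o.size lam ^ (2 * θ))
        (fun o => mul_nonneg (Lead.weight_nonneg _ _)
          (Real.rpow_nonneg (zero_le_one.trans (Lead.one_le_size hlam _)) _)) ?_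
        (Lead.sum_weight_mul_size_le α N hlam hθ1)
      simp [Lead.weight, Lead.size]
    refine (mul_le_mul_of_nonneg_left hsum (by positivity)).trans (le_of_eq ?_)
    have e1 : R0 ^ (-(2 * θ)) = Q ^ (-(2 * θ * p)) * γ ^ (-(2 * θ * p) / (p + 1 / 2)) := by
      rw [hR, Real.mul_rpow (by positivity) (by positivity), ← Real.rpow_mul hQ.le,
        ← Real.rpow_mul hγ0]
      congr 2 <;> ring
    have e2 : γ ^ ((1 + 2 * (1 - θ) * p) / (p + 1 / 2))
        = γ ^ 2 * γ ^ (-(2 * θ * p) / (p + 1 / 2)) := by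
      rw [← Real.rpow_natCast γ 2, ← Real.rpow_add hpos]
      congr 1
      field_simp
      push_cast
      ring
    rw [e1, e2]
    ring

/-- At each resolution there are at most `2 ^ m / 16` frequencies outside of which the squared
coefficients of `f` sum to a small number: the frequencies whose size is below a threshold that
depends on the coordinates they involve. -/
theorem exists_small_freqs (hf : MixedSmooth α f) (hV : variationNorm α lam f < ⊤) (hlam : 0 < lam)
    (m N : ℕ) {θ : ℝ} (hθ0 : 0 < θ) (hθ1 : θ < 1) : ∃ K : Finset (Fin s → Finset ℕ),
      (K.card : ℝ) ≤ 2 ^ m / 16 ∧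
      ∑ k ∈ (freqs s N).erase (fun _ => ∅), (if k ∈ K then 0 else coeff f k ^ 2)
        ≤ (variationNorm α lam f).toReal ^ 2 *
          (2 ^ m / (16 * gammaM α lam (relVar α lam f) m)) ^ (-(2 * θ * ((α : ℝ) + lam))) *
          ∑ u ∈ Finset.univ.filter (fun u : Finset (Fin s) => u ≠ ∅),
            relVar α lam f u ^ ((1 + 2 * (1 - θ) * ((α : ℝ) + lam)) / ((α : ℝ) + lam + 1 / 2)) *
              constC α lam θ ^ u.card := by
  classical
  set Γ := gammaM α lam (relVar α lam f) m with hΓ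
  have hΓ1 : 1 ≤ Γ := one_le_gammaM hlam relVar_nonneg m
  set Q : ℝ := 2 ^ m / (16 * Γ) with hQ
  have hQ0 : 0 < Q := by positivity
  have hQm : Q ≤ 2 ^ m := by
    rw [hQ]
    exact div_le_self (by positivity) (by linarith)
  obtain ⟨d, hd⟩ := exists_leading s α N
  set thr : Finset (Fin s) → ℝ := fun u => Q ^ ((α : ℝ) + lam) *
    relVar α lam f u ^ (((α : ℝ) + lam) / ((α : ℝ) + lam + 1 / 2)) with hthr
  set E := (freqs s N).erase (fun _ => ∅) with hE
  set U := Finset.univ.filter (fun u : Finset (Fin s) => u ≠ ∅) with hU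
  have hmaps : ∀ k ∈ E, freqSupp k ∈ U := fun k hk =>
    Finset.mem_filter.2 ⟨Finset.mem_univ _, fun h => (Finset.mem_erase.1 hk).1 (freqSupp_eq_empty.1 h)⟩
  have hfib : ∀ u ∈ U, E.filter (fun k => freqSupp k = u)
      = (freqs s N).filter (fun k => freqSupp k = u) := by
    intro u hu
    ext k
    simp only [hE, Finset.mem_filter, Finset.mem_erase]
    refine ⟨fun h => ⟨h.1.2, h.2⟩, fun h => ⟨⟨fun h0 => ?_, h.1⟩, h.2⟩⟩
    exact (Finset.mem_filter.1 hu).2 (h.2 ▸ freqSupp_eq_empty.2 h0)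
  set K := E.filter (fun k => ∏ j, (d k j).size lam ≤ thr (freqSupp k)) with hK
  refine ⟨K, ?_, ?_⟩
  · have h1 : (K.card : ℝ) = ∑ u ∈ U, ∑ k ∈ (freqs s N).filter (fun k => freqSupp k = u),
        if ∏ j, (d k j).size lam ≤ thr u then (1 : ℝ) else 0 := by
      rw [hK, Finset.card_filter, Nat.cast_sum, ← Finset.sum_fiberwise_of_maps_to hmaps]
      refine Finset.sum_congr rfl fun u hu => ?_
      rw [hfib u hu]
      refine Finset.sum_congr rfl fun k hk => ?_
      rw [(Finset.mem_filter.1 hk).2]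
      push_cast
      rfl
    rw [h1]
    calc _ ≤ ∑ u ∈ U, Q * (relVar α lam f u ^ (1 / ((α : ℝ) + lam + 1 / 2)) *
          (constA α lam * m + constB α lam) ^ u.card) := by
          refine Finset.sum_le_sum fun u _ => ?_
          refine (hd u (fun o _ => if ∏ j, (o j).size lam ≤ thr u then (1 : ℝ) else 0)
            (fun o _ => by split_ifs <;> norm_num)).trans ?_
          exact card_small_le hlam (relVar_nonneg u) (relVar_le_one u) hQ0.le hQm N u
      _ = Q * (Γ - 1) := by rw [← Finset.mul_sum, hΓ, gammaM, add_sub_cancel_left]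
      _ ≤ Q * Γ := by gcongr; linarith
      _ = _ := by rw [hQ]; field_simp
  · rw [← Finset.sum_fiberwise_of_maps_to hmaps, Finset.mul_sum]
    refine Finset.sum_le_sum fun u hu => ?_
    refine le_trans (le_of_eq ?_) ((hd u (fun o k => if ∏ j, (o j).size lam ≤ thr u then (0 : ℝ)
      else coeff f k ^ 2) (fun o k => by split_ifs <;> positivity)).trans
      (sum_tail_le hf hV hlam hθ0 hθ1 hQ0 N
        (Finset.nonempty_iff_ne_empty.2 (Finset.mem_filter.1 hu).2)))
    rw [← hfib u hu]
    refine Finset.sum_congr rfl fun k hk => ?_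
    have hk := Finset.mem_filter.1 hk
    simp only [hK, Finset.mem_filter, hk.1, true_and, hk.2]

end

/-! ### Independent fair bits -/

/-- The sign `(-1)^b` of a bit `b`. -/
def sgn (b : Bool) : ℝ := if b then -1 else 1

theorem abs_sgn (b : Bool) : |sgn b| = 1 := by cases b <;> simp [sgn]

theorem measurable_sgn : Measurable sgn := measurable_from_top

section Bits

variable {Ω ι : Type*} [MeasurableSpace Ω] {P : Measure Ω} [IsProbabilityMeasure P]
  {X : ι → Ω → Bool}

theorem bddMeas_sgn {Y : Ω → Bool} (hY : Measurable Y) : BddMeas fun ω => sgn (Y ω) :=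
  ⟨measurable_sgn.comp hY, 1, fun _ => (abs_sgn _).le⟩

theorem integral_sgn {Y : Ω → Bool} (hY : Measurable Y) (hf : ∀ b, P {ω | Y ω = b} = 1 / 2) :
    ∫ ω, sgn (Y ω) ∂P = 0 := by
  have hs : ∀ b, MeasurableSet {ω | Y ω = b} := fun b => hY (measurableSet_singleton b)
  have e : ∀ ω, sgn (Y ω) = {ω | Y ω = false}.indicator (fun _ => 1) ω
      - {ω | Y ω = true}.indicator (fun _ => 1) ω := by
    intro ω
    cases h : Y ω <;> simp [sgn, h]
  simp only [e]
  rw [integral_sub ((integrable_const (1 : ℝ)).indicator (hs _))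
    ((integrable_const (1 : ℝ)).indicator (hs _)), integral_indicator_const _ (hs _),
    integral_indicator_const _ (hs _), measureReal_def, measureReal_def, hf, hf, sub_self]

/-- Products of signs over different sets of independent fair bits are orthonormal. -/
theorem integral_prod_sgn_mul_prod_sgn [DecidableEq ι] (hX : iIndepFun X P)
    (hm : ∀ i, Measurable (X i))
    (hf : ∀ i b, P {ω | X i ω = b} = 1 / 2) (S S' : Finset ι) :
    ∫ ω, (∏ i ∈ S, sgn (X i ω)) * ∏ i ∈ S', sgn (X i ω) ∂P = if S = S' then 1 else 0 := by
  set U := S ∪ S' with hU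
  set g : ι → Bool → ℝ := fun i b => (if i ∈ S then sgn b else 1) * (if i ∈ S' then sgn b else 1)
    with hg
  have e : ∀ ω, (∏ i ∈ S, sgn (X i ω)) * ∏ i ∈ S', sgn (X i ω) = ∏ i : U, g i (X i ω) := by
    intro ω
    rw [Finset.prod_coe_sort U fun i => g i (X i ω)]
    simp only [hg]
    rw [Finset.prod_mul_distrib, Finset.prod_ite_mem, Finset.prod_ite_mem,
      Finset.union_inter_cancel_left, Finset.union_inter_cancel_right]
  simp only [e]
  rw [(hX.precomp (g := ((↑) : U → ι)) Subtype.coe_injective).integral_fun_prod_comp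
    (f := fun i : U => g i) (fun i => (hm i).aemeasurable)
    (fun i => (measurable_from_top (f := g i)).aestronglyMeasurable)]
  split_ifs with h
  · subst h
    refine Finset.prod_eq_one fun i _ => ?_
    have hi : (i : ι) ∈ S := by simpa [hU] using i.2
    have : ∀ ω, g i (X i ω) = 1 := fun ω => by
      simp only [hg, if_pos hi]
      cases X i ω <;> simp [sgn]
    simp [this]
  · have : ∃ i ∈ U, ¬ (i ∈ S ↔ i ∈ S') := by
      by_contra hcon
      push Not at hcon
      refine h (Finset.ext fun i => ⟨fun hi => ?_, fun hi => ?_⟩)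
      · exact (hcon i (Finset.mem_union_left _ hi)).1 hi
      · exact (hcon i (Finset.mem_union_right _ hi)).2 hi
    obtain ⟨i, hi, hne⟩ := this
    refine Finset.prod_eq_zero (Finset.mem_univ (⟨i, hi⟩ : U)) ?_
    rw [← integral_sgn (hm i) (hf i)]
    refine integral_congr_ae (Filter.Eventually.of_forall fun ω => ?_)
    by_cases h1 : i ∈ S <;> by_cases h2 : i ∈ S' <;> simp_all

/-- Events that are determined by disjoint finite blocks of independent bits are independent. -/
theorem measure_iInter_blocks_le {κ : Type*} [DecidableEq ι] [DecidableEq κ] (hX : iIndepFun X P)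
    (hm : ∀ i, Measurable (X i)) (F : κ → Finset ι) (hF : ∀ t t', t ≠ t' → Disjoint (F t) (F t'))
    (B : κ → Set Ω) (hB : ∀ t ω ω', (∀ i ∈ F t, X i ω = X i ω') → ω ∈ B t → ω' ∈ B t)
    {c : ℝ≥0∞} (hc : ∀ t, P (B t) ≤ c) (S : Finset κ) :
    P (⋂ t ∈ S, B t) ≤ c ^ S.card := by
  have key : ∀ (U : Finset ι) (E : Set Ω),
      (∀ ω ω', (∀ i ∈ U, X i ω = X i ω') → ω ∈ E → ω' ∈ E) →
      ∃ A : Set (U → Bool), E = (fun ω (i : U) => X i ω) ⁻¹' A := by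
    intro U E hE
    refine ⟨(fun ω (i : U) => X i ω) '' E, (Set.subset_preimage_image _ _).antisymm ?_⟩
    rintro ω ⟨ω', hω', h⟩
    exact hE ω' ω (fun i hi => congrFun h ⟨i, hi⟩) hω'
  induction S using Finset.induction_on with
  | empty => simp
  | insert t S ht ih =>
    rw [Finset.set_biInter_insert, Finset.card_insert_of_notMem ht, pow_succ']
    obtain ⟨A, hA⟩ := key (F t) (B t) (hB t)
    obtain ⟨A', hA'⟩ := key (S.biUnion F) (⋂ t' ∈ S, B t') (by
      intro ω ω' h hω
      simp only [Set.mem_iInter] at hω ⊢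
      exact fun t' ht' => hB t' ω ω' (fun i hi => h i (Finset.mem_biUnion.2 ⟨t', ht', hi⟩)) (hω t' ht'))
    have hdis : Disjoint (F t) (S.biUnion F) := by
      rw [Finset.disjoint_biUnion_right]
      exact fun t' ht' => hF t t' fun h => ht (h ▸ ht')
    have hind := hX.indepFun_finset (F t) (S.biUnion F) hdis hm
    have := hind.measure_inter_preimage_eq_mul A A' (Set.toFinite A).measurableSet
      (Set.toFinite A').measurableSet
    rw [← hA, ← hA'] at this
    rw [this]
    exact mul_le_mul' (hc t) ih

end Bits

/-- A random variable whose second moment is small compared to `T` is unlikely to have a square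
above `T`, also for `T = 0`. -/
theorem measure_sq_gt_le {Ω : Type*} [MeasurableSpace Ω] {P : Measure Ω} [IsProbabilityMeasure P]
    {Z : Ω → ℝ} (hZ : BddMeas Z) {T : ℝ} (hT : 0 ≤ T) (h : 16 * ∫ ω, Z ω ^ 2 ∂P ≤ T) :
    P {ω | T < Z ω ^ 2} ≤ ENNReal.ofReal (1 / 16) := by
  have hi : Integrable (fun ω => Z ω ^ 2) P := by
    simp only [pow_two]; exact (hZ.mul hZ).integrable P
  have h0 : 0 ≤ᵐ[P] fun ω => Z ω ^ 2 := Filter.Eventually.of_forall fun ω => sq_nonneg _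
  rcases hT.eq_or_lt with rfl | hpos
  · have h1 : ∫ ω, Z ω ^ 2 ∂P = 0 := le_antisymm (by linarith) (integral_nonneg_of_ae h0)
    have h2 := (integral_eq_zero_iff_of_nonneg_ae h0 hi).1 h1
    have h3 : P {ω | (0 : ℝ) < Z ω ^ 2} = 0 := by
      rw [← compl_compl {ω | (0 : ℝ) < Z ω ^ 2}]
      refine mem_ae_iff.1 ?_
      filter_upwards [h2] with ω hω
      simpa using hω
    rw [h3]; simp
  · have h1 := mul_meas_ge_le_integral_of_nonneg h0 hi T
    have h2 : P.real {ω | T ≤ Z ω ^ 2} ≤ 1 / 16 := by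
      have : T * P.real {ω | T ≤ Z ω ^ 2} ≤ T * (1 / 16) := h1.trans (by linarith)
      exact le_of_mul_le_mul_left this hpos
    have h3 : P {ω | T < Z ω ^ 2} ≤ P {ω | T ≤ Z ω ^ 2} := measure_mono fun ω (hω : T < Z ω ^ 2) =>
      (le_of_lt hω : T ≤ Z ω ^ 2)
    refine h3.trans ?_
    rw [← ENNReal.ofReal_toReal (measure_ne_top P {ω | T ≤ Z ω ^ 2})]
    exact ENNReal.ofReal_le_ofReal h2

/-! ### Walsh averages of a net -/

/-- The value of the Walsh function `k` at the point `i` of the net. -/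
noncomputable def netWal {s m : ℕ} (C : Fin s → ℕ → Fin m → Bool) (D : Fin s → ℕ → Bool)
    (k : Fin s → Finset ℕ) (i : ℕ) : ℝ :=
  ∏ j, ∏ l ∈ k j, (-1 : ℝ) ^ netDigit C D i j l

/-- The average of the Walsh function `k` over the net. -/
noncomputable def netAvg {s m : ℕ} (C : Fin s → ℕ → Fin m → Bool) (D : Fin s → ℕ → Bool)
    (k : Fin s → Finset ℕ) : ℝ :=
  1 / (2 : ℝ) ^ m * ∑ i ∈ Finset.range (2 ^ m), netWal C D k i

/-- The entries of the matrices and of the shifts, as one family of bits. -/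
def bits {Ω : Type*} {s m : ℕ} (C : Fin s → ℕ → Fin m → Ω → Bool) (D : Fin s → ℕ → Ω → Bool) :
    (Fin s × ℕ × Fin m) ⊕ (Fin s × ℕ) → Ω → Bool
  | Sum.inl (j, l, q) => C j l q
  | Sum.inr (j, l) => D j l

/-- The bits that determine the value of the Walsh function `k` at the point `i` of the net. -/
def bitSet {s m : ℕ} (k : Fin s → Finset ℕ) (i : ℕ) :
    Finset ((Fin s × ℕ × Fin m) ⊕ (Fin s × ℕ)) :=
  ((Finset.univ.sigma k).product (Finset.univ.filter fun q : Fin m => i.testBit q)).map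
    ⟨fun p => (p.1.1, p.1.2, p.2), fun p p' h => by
      obtain ⟨⟨a, b⟩, c⟩ := p
      obtain ⟨⟨a', b'⟩, c'⟩ := p'
      simp only [Prod.mk.injEq] at h
      obtain ⟨rfl, rfl, rfl⟩ := h
      rfl⟩ |>.disjSum
    ((Finset.univ.sigma k).map ⟨fun p => (p.1, p.2), fun p p' h => by
      obtain ⟨a, b⟩ := p
      obtain ⟨a', b'⟩ := p'
      simp only [Prod.mk.injEq] at h
      obtain ⟨rfl, rfl⟩ := h
      rfl⟩)

theorem neg_one_pow_toNat (b : Bool) : (-1 : ℝ) ^ b.toNat = sgn b := by cases b <;> simp [sgn]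

theorem neg_one_pow_netDigit {s m : ℕ} (C : Fin s → ℕ → Fin m → Bool) (D : Fin s → ℕ → Bool)
    (i : ℕ) (j : Fin s) (l : ℕ) :
    (-1 : ℝ) ^ netDigit C D i j l
      = (∏ q ∈ Finset.univ.filter fun q : Fin m => i.testBit q, sgn (C j l q)) * sgn (D j l) := by
  rw [netDigit, ← neg_one_pow_eq_pow_mod_two, pow_add, neg_one_pow_toNat, ← Finset.prod_pow_eq_pow_sum,
    Finset.prod_filter]
  congr 1
  refine Finset.prod_congr rfl fun q _ => ?_
  cases i.testBit q <;> simp [neg_one_pow_toNat]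

theorem netWal_eq_prod_bitSet {Ω : Type*} {s m : ℕ} (C : Fin s → ℕ → Fin m → Ω → Bool)
    (D : Fin s → ℕ → Ω → Bool) (k : Fin s → Finset ℕ) (i : ℕ) (ω : Ω) :
    netWal (fun j l q => C j l q ω) (fun j l => D j l ω) k i
      = ∏ b ∈ bitSet k i, sgn (bits C D b ω) := by
  simp only [netWal, neg_one_pow_netDigit, Finset.prod_mul_distrib]
  rw [bitSet, Finset.prod_disjSum, Finset.prod_map, Finset.prod_map]
  congr 1
  · rw [show (Finset.univ.sigma k).product _ = (Finset.univ.sigma k) ×ˢ _ from rfl,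
      Finset.prod_product, Finset.prod_sigma]
    rfl
  · rw [Finset.prod_sigma]
    rfl

theorem bitSet_inr {s m : ℕ} {k : Fin s → Finset ℕ} {i : ℕ} {j : Fin s} {l : ℕ} :
    (Sum.inr (j, l) : (Fin s × ℕ × Fin m) ⊕ (Fin s × ℕ)) ∈ bitSet k i ↔ l ∈ k j := by
  simp only [bitSet, Finset.inr_mem_disjSum, Finset.mem_map,
    Finset.mem_sigma, Finset.mem_univ, true_and]
  constructor
  · rintro ⟨⟨a, b⟩, h, h'⟩
    obtain rfl : a = j := congrArg Prod.fst h'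
    obtain rfl : b = l := congrArg Prod.snd h'
    exact h
  · exact fun h => ⟨⟨j, l⟩, h, rfl⟩

theorem bitSet_inl {s m : ℕ} {k : Fin s → Finset ℕ} {i : ℕ} {j : Fin s} {l : ℕ} {q : Fin m} :
    (Sum.inl (j, l, q) : (Fin s × ℕ × Fin m) ⊕ (Fin s × ℕ)) ∈ bitSet k i
      ↔ l ∈ k j ∧ i.testBit q := by
  simp only [bitSet, Finset.inl_mem_disjSum, Finset.mem_map]
  constructor
  · rintro ⟨⟨⟨a, b⟩, c⟩, h, h'⟩
    obtain rfl : a = j := congrArg Prod.fst h'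
    obtain rfl : b = l := congrArg (fun p => p.2.1) h'
    obtain rfl : c = q := congrArg (fun p => p.2.2) h'
    have := Finset.mem_product.1 h
    exact ⟨(Finset.mem_sigma.1 this.1).2, (Finset.mem_filter.1 this.2).2⟩
  · rintro ⟨h, h'⟩
    exact ⟨⟨⟨j, l⟩, q⟩, Finset.mem_product.2 ⟨Finset.mem_sigma.2 ⟨Finset.mem_univ _, h⟩,
      Finset.mem_filter.2 ⟨Finset.mem_univ _, h'⟩⟩, rfl⟩

theorem eq_of_bitSet_eq {s m : ℕ} {k k' : Fin s → Finset ℕ} {i i' : ℕ}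
    (h : bitSet (m := m) k i = bitSet k' i') : k = k' := by
  funext j
  ext l
  rw [← bitSet_inr (m := m) (i := i), h, bitSet_inr]

theorem bitSet_injOn {s m : ℕ} {k : Fin s → Finset ℕ} (hk : k ≠ fun _ => ∅) {i i' : ℕ}
    (hi : i < 2 ^ m) (hi' : i' < 2 ^ m) (h : bitSet (m := m) k i = bitSet k i') : i = i' := by
  obtain ⟨j, hj⟩ := Function.ne_iff.1 hk
  obtain ⟨l, hl⟩ := Finset.nonempty_iff_ne_empty.2 hj
  refine Nat.eq_of_testBit_eq fun q => ?_
  by_cases hq : q < m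
  · have : l ∈ k j ∧ i.testBit q ↔ l ∈ k j ∧ i'.testBit q := by
      have h1 := bitSet_inl (k := k) (i := i) (j := j) (l := l) (q := (⟨q, hq⟩ : Fin m))
      have h2 := bitSet_inl (k := k) (i := i') (j := j) (l := l) (q := (⟨q, hq⟩ : Fin m))
      rw [h] at h1
      exact h1.symm.trans h2
    simp only [hl, true_and] at this
    exact Bool.eq_iff_iff.2 this
  · have hq' : 2 ^ m ≤ 2 ^ q := Nat.pow_le_pow_right two_pos (not_lt.1 hq)
    rw [Nat.testBit_lt_two_pow (hi.trans_le hq'), Nat.testBit_lt_two_pow (hi'.trans_le hq')]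

/-- Summing the products of all subfamilies of `a 0, …, a (m - 1)`, the subfamilies being
enumerated by binary digits. -/
theorem sum_prod_testBit (m : ℕ) (a : ℕ → ℝ) :
    ∑ i ∈ Finset.range (2 ^ m), ∏ q ∈ Finset.range m, (if i.testBit q then a q else 1)
      = ∏ q ∈ Finset.range m, (1 + a q) := by
  induction m with
  | zero => simp
  | succ m ih =>
    rw [pow_succ, mul_two, Finset.sum_range_add, Finset.prod_range_succ, ← ih, mul_one_add,
      Finset.sum_mul]
    congr 1
    · refine Finset.sum_congr rfl fun i hi => ?_
      rw [Finset.prod_range_succ, Nat.testBit_lt_two_pow (Finset.mem_range.1 hi)]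
      simp
    · refine Finset.sum_congr rfl fun i hi => ?_
      rw [Finset.prod_range_succ, Nat.testBit_two_pow_add_eq,
        Nat.testBit_lt_two_pow (Finset.mem_range.1 hi)]
      simp only [Bool.not_false, if_true]
      congr 1
      refine Finset.prod_congr rfl fun q hq => ?_
      rw [Nat.testBit_two_pow_add_gt (Finset.mem_range.1 hq)]

/-- The points of the net without shift form a group, on which a Walsh function is a character;
hence its average is zero or of modulus one. -/
theorem one_le_sq_netAvg {s m : ℕ} (C : Fin s → ℕ → Fin m → Bool) (D : Fin s → ℕ → Bool)
    (k : Fin s → Finset ℕ) (h : netAvg C D k ≠ 0) : 1 ≤ netAvg C D k ^ 2 := by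
  set a : ℕ → ℝ := fun q => if hq : q < m then ∏ j, ∏ l ∈ k j, sgn (C j l ⟨q, hq⟩) else 1 with ha
  set d : ℝ := ∏ j, ∏ l ∈ k j, sgn (D j l) with hd
  have hd1 : d ^ 2 = 1 := by
    rw [← sq_abs, hd, Finset.abs_prod]
    simp [Finset.abs_prod, abs_sgn]
  have ha1 : ∀ q, a q = 1 ∨ a q = -1 := fun q => by
    have : |a q| = 1 := by
      simp only [ha]
      split_ifs
      · simp [Finset.abs_prod, abs_sgn]
      · simp
    exact (abs_eq zero_le_one).1 this
  have e : ∀ i, netWal C D k i = d * ∏ q ∈ Finset.range m, (if i.testBit q then a q else 1) := by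
    intro i
    simp only [netWal, neg_one_pow_netDigit, Finset.prod_mul_distrib]
    rw [mul_comm, ← hd]
    congr 1
    rw [Finset.prod_range]
    simp only [ha, Fin.is_lt, dite_true, Fin.eta]
    rw [← Finset.prod_filter, Finset.prod_comm]
    rw [Finset.prod_congr rfl fun j _ => Finset.prod_comm, Finset.prod_comm]
  have h2 : netAvg C D k = 1 / 2 ^ m * (d * ∏ q ∈ Finset.range m, (1 + a q)) := by
    simp only [netAvg, e, ← Finset.mul_sum, sum_prod_testBit]
  have h3 : ∏ q ∈ Finset.range m, (1 + a q) ≠ 0 := by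
    intro h0
    rw [h2, h0] at h
    simp at h
  have h4 : ∏ q ∈ Finset.range m, (1 + a q) = 2 ^ m := by
    rw [Finset.prod_ne_zero_iff] at h3
    rw [Finset.prod_congr rfl fun q hq => (show 1 + a q = 2 by
      rcases ha1 q with h | h
      · rw [h]; norm_num
      · exact absurd (by rw [h]; norm_num) (h3 q hq))]
    simp
  rw [h2, h4]
  have : 1 / 2 ^ m * (d * 2 ^ m) = d := by field_simp
  rw [this, hd1]

section NetAvg

variable {Ω : Type*} [MeasurableSpace Ω] {P : Measure Ω} [IsProbabilityMeasure P] {s m : ℕ}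
  {C : Fin s → ℕ → Fin m → Ω → Bool} {D : Fin s → ℕ → Ω → Bool}

theorem bddMeas_netWal (hm : ∀ b, Measurable (bits C D b)) (k : Fin s → Finset ℕ) (i : ℕ) :
    BddMeas fun ω => netWal (fun j l q => C j l q ω) (fun j l => D j l ω) k i := by
  simp only [netWal_eq_prod_bitSet]
  exact BddMeas.prod _ fun b _ => bddMeas_sgn (hm b)

theorem bddMeas_netAvg (hm : ∀ b, Measurable (bits C D b)) (k : Fin s → Finset ℕ) :
    BddMeas fun ω => netAvg (fun j l q => C j l q ω) (fun j l => D j l ω) k :=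
  (BddMeas.const _).mul (BddMeas.sum _ fun i _ => bddMeas_netWal hm k i)

/-- The Walsh averages of a random net are uncorrelated. -/
theorem integral_netAvg_mul_netAvg (hX : iIndepFun (bits C D) P)
    (hm : ∀ b, Measurable (bits C D b)) (hf : ∀ b v, P {ω | bits C D b ω = v} = 1 / 2)
    {k : Fin s → Finset ℕ} (hk : k ≠ fun _ => ∅) (k' : Fin s → Finset ℕ) :
    ∫ ω, netAvg (fun j l q => C j l q ω) (fun j l => D j l ω) k *
        netAvg (fun j l q => C j l q ω) (fun j l => D j l ω) k' ∂P
      = if k = k' then 1 / (2 : ℝ) ^ m else 0 := by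
  classical
  have e : ∀ ω, netAvg (fun j l q => C j l q ω) (fun j l => D j l ω) k *
        netAvg (fun j l q => C j l q ω) (fun j l => D j l ω) k'
      = (1 / (2 : ℝ) ^ m * (1 / (2 : ℝ) ^ m)) * ∑ i ∈ Finset.range (2 ^ m),
        ∑ i' ∈ Finset.range (2 ^ m), (∏ b ∈ bitSet k i, sgn (bits C D b ω)) *
          ∏ b ∈ bitSet k' i', sgn (bits C D b ω) := by
    intro ω
    simp only [netAvg, netWal_eq_prod_bitSet]
    rw [mul_mul_mul_comm, Finset.sum_mul_sum]
  simp only [e]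
  have hI : ∀ i i', Integrable (fun ω => (∏ b ∈ bitSet k i, sgn (bits C D b ω)) *
      ∏ b ∈ bitSet k' i', sgn (bits C D b ω)) P := fun i i' =>
    ((BddMeas.prod _ fun b _ => bddMeas_sgn (hm b)).mul
      (BddMeas.prod _ fun b _ => bddMeas_sgn (hm b))).integrable P
  rw [integral_const_mul, integral_finsetSum _ fun i _ => integrable_finsetSum _ fun i' _ => hI i i']
  simp only [integral_finsetSum _ fun i' _ => hI _ i',
    integral_prod_sgn_mul_prod_sgn hX hm hf]
  split_ifs with h
  · subst h
    have : ∀ i ∈ Finset.range (2 ^ m), ∑ i' ∈ Finset.range (2 ^ m),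
        (if bitSet (m := m) k i = bitSet k i' then (1 : ℝ) else 0) = 1 := by
      intro i hi
      rw [Finset.sum_eq_single_of_mem i hi, if_pos rfl]
      intro i' hi' hne
      exact if_neg fun h => hne (bitSet_injOn hk (Finset.mem_range.1 hi) (Finset.mem_range.1 hi') h).symm
    rw [Finset.sum_congr rfl this]
    simp
  · rw [Finset.sum_eq_zero, mul_zero]
    exact fun i _ => Finset.sum_eq_zero fun i' _ => if_neg fun h' => h (eq_of_bitSet_eq h')

/-- As a nonzero average has square at least one, the second moment bounds the probability that the
average does not vanish. -/
theorem measure_netAvg_ne_zero_le (hX : iIndepFun (bits C D) P)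
    (hm : ∀ b, Measurable (bits C D b)) (hf : ∀ b v, P {ω | bits C D b ω = v} = 1 / 2)
    {k : Fin s → Finset ℕ} (hk : k ≠ fun _ => ∅) :
    P {ω | netAvg (fun j l q => C j l q ω) (fun j l => D j l ω) k ≠ 0}
      ≤ ENNReal.ofReal (1 / 2 ^ m) := by
  have hb := bddMeas_netAvg hm k
  have h1 := mul_meas_ge_le_integral_of_nonneg (μ := P)
    (Filter.Eventually.of_forall fun ω => mul_self_nonneg _) ((hb.mul hb).integrable P) 1
  rw [integral_netAvg_mul_netAvg hX hm hf hk, if_pos rfl, one_mul] at h1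
  refine (measure_mono fun ω hω => ?_).trans
    ((ENNReal.ofReal_toReal (measure_ne_top P _)).symm.le.trans (ENNReal.ofReal_le_ofReal h1))
  have := one_le_sq_netAvg _ _ _ hω
  rwa [pow_two] at this

/-- If all but few coefficients are small, so is a random combination of Walsh averages, with
large probability. -/
theorem measure_sum_netAvg_le (hX : iIndepFun (bits C D) P)
    (hm : ∀ b, Measurable (bits C D b)) (hf : ∀ b v, P {ω | bits C D b ω = v} = 1 / 2)
    {E : Finset (Fin s → Finset ℕ)} (hE : (fun _ => ∅) ∉ E) (a : (Fin s → Finset ℕ) → ℝ)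
    {K : Finset (Fin s → Finset ℕ)} (hK : (K.card : ℝ) ≤ 2 ^ m / 16) {T : ℝ}
    (hT : 16 * (1 / 2 ^ m * ∑ k ∈ E, if k ∈ K then 0 else a k ^ 2) ≤ T) :
    P {ω | T < (∑ k ∈ E, a k * netAvg (fun j l q => C j l q ω) (fun j l => D j l ω) k) ^ 2}
      ≤ 1 / 8 := by
  classical
  set Y : (Fin s → Finset ℕ) → Ω → ℝ :=
    fun k ω => netAvg (fun j l q => C j l q ω) (fun j l => D j l ω) k with hY
  set Z : Ω → ℝ := fun ω => ∑ k ∈ E, (if k ∈ K then 0 else a k) * Y k ω with hZ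
  have hE0 : ∀ k ∈ E, k ≠ fun _ => ∅ := fun k hk h => hE (h ▸ hk)
  have hT0 : 0 ≤ T := le_trans (by
    have : 0 ≤ ∑ k ∈ E, (if k ∈ K then 0 else a k ^ 2) :=
      Finset.sum_nonneg fun k _ => by split_ifs <;> positivity
    positivity) hT
  have hZb : BddMeas Z := BddMeas.sum _ fun k _ => (BddMeas.const _).mul (bddMeas_netAvg hm k)
  have hZ2 : ∫ ω, Z ω ^ 2 ∂P = 1 / 2 ^ m * ∑ k ∈ E, if k ∈ K then 0 else a k ^ 2 := by
    have e : ∀ ω, Z ω ^ 2 = ∑ k ∈ E, ∑ k' ∈ E,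
        ((if k ∈ K then 0 else a k) * (if k' ∈ K then 0 else a k')) * (Y k ω * Y k' ω) := by
      intro ω
      rw [pow_two, hZ, Finset.sum_mul_sum]
      refine Finset.sum_congr rfl fun k _ => Finset.sum_congr rfl fun k' _ => by ring
    simp only [e]
    have hI : ∀ k k', Integrable (fun ω => ((if k ∈ K then 0 else a k) *
        (if k' ∈ K then 0 else a k')) * (Y k ω * Y k' ω)) P := fun k k' =>
      ((BddMeas.const _).mul ((bddMeas_netAvg hm k).mul (bddMeas_netAvg hm k'))).integrable P
    rw [integral_finsetSum _ fun k _ => integrable_finsetSum _ fun k' _ => hI k k', Finset.mul_sum]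
    refine Finset.sum_congr rfl fun k hk => ?_
    rw [integral_finsetSum _ fun k' _ => hI k k', Finset.sum_eq_single_of_mem k hk]
    · rw [integral_const_mul, hY, integral_netAvg_mul_netAvg hX hm hf (hE0 k hk), if_pos rfl]
      split_ifs <;> ring
    · intro k' _ hne
      rw [integral_const_mul, hY, integral_netAvg_mul_netAvg hX hm hf (hE0 k hk), if_neg hne.symm,
        mul_zero]
  have hsub : {ω | T < (∑ k ∈ E, a k * Y k ω) ^ 2}
      ⊆ (⋃ k ∈ E.filter (· ∈ K), {ω | Y k ω ≠ 0}) ∪ {ω | T < Z ω ^ 2} := by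
    intro ω hω
    by_cases h : ∃ k ∈ E.filter (· ∈ K), Y k ω ≠ 0
    · left
      obtain ⟨k, hk, h⟩ := h
      exact Set.mem_biUnion hk h
    · right
      push Not at h
      have : Z ω = ∑ k ∈ E, a k * Y k ω := by
        refine Finset.sum_congr rfl fun k hk => ?_
        split_ifs with hkK
        · rw [h k (Finset.mem_filter.2 ⟨hk, hkK⟩)]; simp
        · rfl
      change T < Z ω ^ 2
      rw [this]
      exact hω
  have h1 : P (⋃ k ∈ E.filter (· ∈ K), {ω | Y k ω ≠ 0}) ≤ ENNReal.ofReal (1 / 16) := by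
    refine (measure_biUnion_finset_le _ _).trans ?_
    refine (Finset.sum_le_sum fun k hk => measure_netAvg_ne_zero_le hX hm hf
      (hE0 k (Finset.mem_filter.1 hk).1)).trans ?_
    rw [Finset.sum_const, nsmul_eq_mul, ← ENNReal.ofReal_natCast, ← ENNReal.ofReal_mul (by positivity)]
    refine ENNReal.ofReal_le_ofReal ?_
    have h2 : ((E.filter (· ∈ K)).card : ℝ) ≤ K.card := by
      exact_mod_cast Finset.card_le_card fun k hk => (Finset.mem_filter.1 hk).2
    calc _ ≤ 2 ^ m / 16 * (1 / 2 ^ m : ℝ) := by gcongr; exact h2.trans hK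
      _ = _ := by field_simp
  calc _ ≤ _ := measure_mono hsub
    _ ≤ _ := measure_union_le _ _
    _ ≤ ENNReal.ofReal (1 / 16) + ENNReal.ofReal (1 / 16) :=
      add_le_add h1 (measure_sq_gt_le hZb hT0 (by rw [hZ2]; exact hT))
    _ = ENNReal.ofReal (1 / 8) := by rw [← ENNReal.ofReal_add (by norm_num) (by norm_num)]; norm_num
    _ = 1 / 8 := by
      rw [ENNReal.ofReal_div_of_pos (by norm_num)]; simp

end NetAvg

/-! ### Truncating the digits of a net -/

/-- The number with binary digits `z 0, z 1, …` after the point is close to its truncations. -/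
theorem tsum_digits_mem {z : ℕ → ℕ} (hz : ∀ l, z l ≤ 1) (N : ℕ) :
    ∑' l, (z l : ℝ) / 2 ^ (l + 1) ∈
      Set.Icc (∑ l ∈ Finset.range N, (z l : ℝ) / 2 ^ (l + 1))
        (∑ l ∈ Finset.range N, (z l : ℝ) / 2 ^ (l + 1) + (2 : ℝ)⁻¹ ^ N) := by
  have hle : ∀ l, (z l : ℝ) / 2 ^ (l + 1) ≤ 1 / 2 / 2 ^ l := fun l => by
    have h1 : (z l : ℝ) ≤ 1 := by exact_mod_cast hz l
    rw [pow_succ', div_div]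
    gcongr
  have hs : Summable fun l => (z l : ℝ) / 2 ^ (l + 1) :=
    Summable.of_nonneg_of_le (fun l => by positivity) hle (summable_geometric_two' 1)
  have hs2 := (summable_nat_add_iff N).2 hs
  rw [← hs.sum_add_tsum_nat_add N]
  refine ⟨le_add_of_nonneg_right (tsum_nonneg fun l => by positivity), ?_⟩
  refine add_le_add_right ?_ _
  rw [← tsum_geometric_two' ((2 : ℝ)⁻¹ ^ N)]
  refine hs2.tsum_le_tsum (fun l => ?_) (summable_geometric_two' _)
  have h1 : (z (l + N) : ℝ) ≤ 1 := by exact_mod_cast hz _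
  calc _ ≤ (1 : ℝ) / 2 ^ (l + N + 1) := by gcongr
    _ = _ := by rw [inv_pow, pow_succ, pow_add]; field_simp

/-- The first digits of a number are read off from its Rademacher functions. -/
theorem digits_near {z : ℕ → ℕ} (hz : ∀ l, z l ≤ 1) {y : ℝ} (hy0 : 0 ≤ y) (hy1 : y < 1) (N : ℕ)
    (h : ∀ l < N, rad l y = (-1) ^ z l) :
    |y - ∑' l, (z l : ℝ) / 2 ^ (l + 1)| ≤ (2 : ℝ)⁻¹ ^ N := by
  have key : ∀ M ≤ N, (∃ n : ℤ, ∑ l ∈ Finset.range M, (z l : ℝ) / 2 ^ (l + 1) = n / 2 ^ M) ∧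
      ∑ l ∈ Finset.range M, (z l : ℝ) / 2 ^ (l + 1) ≤ y ∧
      y < ∑ l ∈ Finset.range M, (z l : ℝ) / 2 ^ (l + 1) + (2 : ℝ)⁻¹ ^ M := by
    intro M
    induction M with
    | zero => exact fun _ => ⟨⟨0, by simp⟩, by simpa using hy0, by simpa using hy1⟩
    | succ M ih =>
      intro hM
      obtain ⟨⟨n, hn⟩, h1, h2⟩ := ih (by omega)
      rw [Finset.sum_range_succ, hn]
      rw [hn] at h1 h2
      have hp : (0 : ℝ) < 2 ^ M := by positivity
      have h3 : (2 * n : ℝ) ≤ 2 ^ (M + 1) * y := by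
        rw [div_le_iff₀ hp] at h1
        rw [pow_succ]; linarith
      have h4 : 2 ^ (M + 1) * y < 2 * n + 2 := by
        have : y * 2 ^ M < n + 1 := by
          calc y * 2 ^ M < (n / 2 ^ M + (2 : ℝ)⁻¹ ^ M) * 2 ^ M := by gcongr
            _ = n + 1 := by rw [inv_pow]; field_simp
        rw [pow_succ]; linarith
      have h5 : 2 * n ≤ ⌊(2 : ℝ) ^ (M + 1) * y⌋ := Int.le_floor.2 (by push_cast; exact h3)
      have h6 : ⌊(2 : ℝ) ^ (M + 1) * y⌋ < 2 * n + 2 := Int.floor_lt.2 (by push_cast; exact h4)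
      have h7 := Int.floor_le ((2 : ℝ) ^ (M + 1) * y)
      have h8 := Int.lt_floor_add_one ((2 : ℝ) ^ (M + 1) * y)
      have h9 := h M (by omega)
      rw [rad] at h9
      have h10 : ⌊(2 : ℝ) ^ (M + 1) * y⌋ = 2 * n + z M := by
        have hz1 := hz M
        have hc : ⌊(2 : ℝ) ^ (M + 1) * y⌋ = 2 * n ∨ ⌊(2 : ℝ) ^ (M + 1) * y⌋ = 2 * n + 1 := by omega
        have hev : (-1 : ℝ) ^ (2 * n) = 1 := (even_two_mul n).neg_one_zpow
        have hz2 : z M = 0 ∨ z M = 1 := by omega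
        rcases hc with hc | hc <;> rcases hz2 with hz2 | hz2 <;> rw [hc, hz2] at h9 ⊢
        · simp
        · rw [hev] at h9; norm_num at h9
        · rw [zpow_add_one₀ (by norm_num), hev] at h9; norm_num at h9
        · simp
      rw [h10] at h7 h8
      push_cast at h7 h8
      have e : (n : ℝ) / 2 ^ M + z M / 2 ^ (M + 1) = (2 * n + z M) / 2 ^ (M + 1) := by
        rw [pow_succ]; field_simp
      refine ⟨⟨2 * n + z M, by rw [e]; push_cast; rfl⟩, ?_, ?_⟩
      · rw [e, div_le_iff₀ (by positivity)]; linarith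
      · rw [e, inv_pow, ← one_div, ← add_div, lt_div_iff₀ (by positivity)]; linarith
  obtain ⟨-, h1, h2⟩ := key N le_rfl
  have h3 := tsum_digits_mem hz N
  rw [abs_le]
  constructor <;> linarith [h3.1, h3.2]

theorem ae_mem_Ico_cube {ι : Type*} [Fintype ι] :
    ∀ᵐ x ∂(cubeMeasure ι), ∀ i, 0 ≤ x i ∧ x i < 1 := by
  have h : cubeMeasure ι = volume.restrict (Set.univ.pi fun _ : ι => Set.Ico (0 : ℝ) 1) := by
    rw [cubeMeasure, volume_pi, Measure.restrict_pi_pi]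
    simp only [unitMeasure, restrict_Ico_eq_restrict_Icc]
  rw [h]
  filter_upwards [ae_restrict_mem (MeasurableSet.univ_pi fun _ => measurableSet_Ico)] with x hx i
  exact hx i (Set.mem_univ i)

section Kernel

variable {s : ℕ}

/-- The Walsh kernel of the dyadic cell with digits `z j 0, …, z j (N - 1)` in coordinate `j`. -/
noncomputable def cellKernel (z : Fin s → ℕ → ℕ) (N : ℕ) (y : Fin s → ℝ) : ℝ :=
  ∏ j, ∏ l ∈ Finset.range N, (1 + (-1 : ℝ) ^ z j l * rad l (y j))

theorem cellKernel_eq (z : Fin s → ℕ → ℕ) (N : ℕ) (y : Fin s → ℝ) :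
    cellKernel z N y
      = ∑ k ∈ freqs s N, (∏ j, ∏ l ∈ k j, (-1 : ℝ) ^ z j l) * ∏ j, wal (k j) (y j) := by
  simp only [cellKernel, Finset.prod_one_add, freqs]
  rw [Finset.prod_univ_sum]
  simp only [wal, Finset.prod_mul_distrib]

theorem sum_coeff_eq {f : (Fin s → ℝ) → ℝ} (hf : ContinuousOn f (Set.Icc 0 1))
    (z : Fin s → ℕ → ℕ) (N : ℕ) :
    ∑ k ∈ freqs s N, coeff f k * ∏ j, ∏ l ∈ k j, (-1 : ℝ) ^ z j l
      = ∫ y, f y * cellKernel z N y ∂(cubeMeasure (Fin s)) := by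
  simp only [cellKernel_eq, Finset.mul_sum]
  rw [integral_finsetSum]
  · refine Finset.sum_congr rfl fun k _ => ?_
    rw [coeff, ← integral_mul_const]
    refine integral_congr_ae (Filter.Eventually.of_forall fun y => ?_)
    simp only []
    ring
  · intro k _
    exact integrable_mul_of_continuousOn hf
      ((BddMeas.const _).mul (bddMeas_tensor fun j => bddMeas_wal (k j)))

theorem bddMeas_cellKernel (z : Fin s → ℕ → ℕ) (N : ℕ) : BddMeas (cellKernel z N) := by
  rw [funext (cellKernel_eq z N)]
  exact BddMeas.sum _ fun k _ => (BddMeas.const _).mul (bddMeas_tensor fun j => bddMeas_wal (k j))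

theorem integral_cellKernel (z : Fin s → ℕ → ℕ) (N : ℕ) :
    ∫ y, cellKernel z N y ∂(cubeMeasure (Fin s)) = 1 := by
  have h := sum_coeff_eq (s := s) (f := fun _ => 1) continuousOn_const z N
  simp only [one_mul] at h
  rw [← h, Finset.sum_eq_single_of_mem (fun _ => ∅)]
  · simp [coeff, wal]
  · exact Fintype.mem_piFinset.2 fun _ => Finset.mem_powerset.2 (Finset.empty_subset _)
  · intro k _ hk
    obtain ⟨j, hj⟩ := Function.ne_iff.1 hk
    have : coeff (fun _ => 1) k = 0 := by
      simp only [coeff, one_mul, cubeMeasure]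
      rw [integral_fintype_prod_eq_prod]
      refine Finset.prod_eq_zero (Finset.mem_univ j) ?_
      rw [integral_unitMeasure]
      exact integral_wal_eq_zero (Finset.nonempty_iff_ne_empty.2 hj)
    rw [this, zero_mul]

theorem one_add_sign_mul_rad (n l : ℕ) (x : ℝ) :
    0 ≤ 1 + (-1 : ℝ) ^ n * rad l x ∧ (1 + (-1 : ℝ) ^ n * rad l x ≠ 0 → rad l x = (-1) ^ n) := by
  rcases neg_one_pow_eq_or ℝ n with h | h <;> rcases rad_eq_or l x with h' | h' <;>
    rw [h, h'] <;> norm_num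

theorem cellKernel_nonneg (z : Fin s → ℕ → ℕ) (N : ℕ) (y : Fin s → ℝ) : 0 ≤ cellKernel z N y :=
  Finset.prod_nonneg fun _ _ => Finset.prod_nonneg fun _ _ => (one_add_sign_mul_rad _ _ _).1

theorem dist_le_of_cellKernel_ne_zero {z : Fin s → ℕ → ℕ} (hz : ∀ j l, z j l ≤ 1) {N : ℕ}
    {y : Fin s → ℝ} (hy : ∀ j, 0 ≤ y j ∧ y j < 1) (h : cellKernel z N y ≠ 0) :
    dist y (fun j => ∑' l, (z j l : ℝ) / 2 ^ (l + 1)) ≤ (2 : ℝ)⁻¹ ^ N := by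
  rw [dist_pi_le_iff (by positivity)]
  intro j
  rw [Real.dist_eq]
  refine digits_near (hz j) (hy j).1 (hy j).2 N fun l hl => ?_
  have h1 := Finset.prod_ne_zero_iff.1 h j (Finset.mem_univ j)
  exact (one_add_sign_mul_rad _ _ _).2 (Finset.prod_ne_zero_iff.1 h1 l (Finset.mem_range.2 hl))

/-- The dyadic partial sums of the Walsh series of a continuous function are averages over dyadic
cells, hence they converge along the digits of every point. -/
theorem tendsto_sum_coeff {f : (Fin s → ℝ) → ℝ} (hf : ContinuousOn f (Set.Icc 0 1))
    {z : Fin s → ℕ → ℕ} (hz : ∀ j l, z j l ≤ 1) :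
    Filter.Tendsto (fun N => ∑ k ∈ freqs s N, coeff f k * ∏ j, ∏ l ∈ k j, (-1 : ℝ) ^ z j l)
      Filter.atTop (nhds (f fun j => ∑' l, (z j l : ℝ) / 2 ^ (l + 1))) := by
  set x : Fin s → ℝ := fun j => ∑' l, (z j l : ℝ) / 2 ^ (l + 1) with hx
  have hxm : x ∈ Set.Icc (0 : Fin s → ℝ) 1 :=
    ⟨fun j => by simpa using (tsum_digits_mem (hz j) 0).1,
      fun j => by simpa using (tsum_digits_mem (hz j) 0).2⟩
  rw [Metric.tendsto_atTop]
  intro ε hε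
  obtain ⟨δ, hδ, hfδ⟩ := Metric.continuousOn_iff.1 hf x hxm (ε / 2) (by positivity)
  obtain ⟨N₀, hN₀⟩ := exists_pow_lt_of_lt_one hδ (show (2 : ℝ)⁻¹ < 1 by norm_num)
  refine ⟨N₀, fun N hN => ?_⟩
  have hNδ : (2 : ℝ)⁻¹ ^ N < δ := (pow_le_pow_of_le_one (by norm_num) (by norm_num) hN).trans_lt hN₀
  have hW := bddMeas_cellKernel z N
  have hi1 := integrable_mul_of_continuousOn hf hW
  have hi2 := hW.integrable (cubeMeasure (Fin s))
  have e : (∑ k ∈ freqs s N, coeff f k * ∏ j, ∏ l ∈ k j, (-1 : ℝ) ^ z j l) - f x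
      = ∫ y, (f y - f x) * cellKernel z N y ∂(cubeMeasure (Fin s)) := by
    rw [sum_coeff_eq hf]
    simp only [sub_mul]
    rw [integral_sub hi1 (hi2.const_mul _), integral_const_mul, integral_cellKernel, mul_one]
  rw [Real.dist_eq, e, ← Real.norm_eq_abs]
  refine (norm_integral_le_of_norm_le (hi2.const_mul (ε / 2)) ?_).trans_lt ?_
  · filter_upwards [ae_mem_cube, ae_mem_Ico_cube] with y hy hy'
    rw [norm_mul, Real.norm_eq_abs, Real.norm_eq_abs, abs_of_nonneg (cellKernel_nonneg _ _ _)]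
    by_cases h : cellKernel z N y = 0
    · rw [h]; simp
    · refine mul_le_mul_of_nonneg_right ?_ (cellKernel_nonneg _ _ _)
      have := hfδ y hy ((dist_le_of_cellKernel_ne_zero hz hy' h).trans_lt hNδ)
      rw [Real.dist_eq] at this
      exact this.le
  · rw [integral_const_mul, integral_cellKernel]; linarith

variable {m : ℕ}

/-- The error of the estimator, seen at the first `N` digits. -/
noncomputable def netErr (f : (Fin s → ℝ) → ℝ) (N : ℕ) (C : Fin s → ℕ → Fin m → Bool)
    (D : Fin s → ℕ → Bool) : ℝ :=
  ∑ k ∈ (freqs s N).erase (fun _ => ∅), coeff f k * netAvg C D k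

theorem tendsto_netErr {f : (Fin s → ℝ) → ℝ} (hf : ContinuousOn f (Set.Icc 0 1))
    (C : Fin s → ℕ → Fin m → Bool) (D : Fin s → ℕ → Bool) :
    Filter.Tendsto (fun N => netErr f N C D) Filter.atTop
      (nhds (netEstimator f C D - ∫ x in Set.Icc (0 : Fin s → ℝ) 1, f x)) := by
  have h0 : ∀ N, (fun _ => ∅) ∈ freqs s N := fun N =>
    Fintype.mem_piFinset.2 fun _ => Finset.mem_powerset.2 (Finset.empty_subset _)
  have h1 : netAvg C D (fun _ => ∅) = 1 := by
    simp [netAvg, netWal]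
  have h2 : coeff f (fun _ => ∅) = ∫ x in Set.Icc (0 : Fin s → ℝ) 1, f x := by
    simp [coeff, wal, restrict_cube]
  have e : ∀ N, netErr f N C D = 1 / (2 : ℝ) ^ m * ∑ i ∈ Finset.range (2 ^ m),
      (∑ k ∈ freqs s N, coeff f k * ∏ j, ∏ l ∈ k j, (-1 : ℝ) ^ netDigit C D i j l)
        - ∫ x in Set.Icc (0 : Fin s → ℝ) 1, f x := by
    intro N
    have h3 := Finset.add_sum_erase _ (fun k => coeff f k * netAvg C D k) (h0 N)
    rw [netErr, eq_sub_iff_add_eq', ← h2]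
    simp only [h1, mul_one] at h3
    rw [h3, Finset.sum_comm, Finset.mul_sum]
    refine Finset.sum_congr rfl fun k _ => ?_
    simp only [netAvg, netWal]
    rw [← Finset.mul_sum]
    ring
  simp only [e]
  refine Filter.Tendsto.sub_const (Filter.Tendsto.const_mul _ (tendsto_finsetSum _ fun i _ => ?_)) _
  exact tendsto_sum_coeff hf fun j l => Nat.lt_succ_iff.1 (Nat.mod_lt _ two_pos)

theorem netErr_congr (f : (Fin s → ℝ) → ℝ) (N : ℕ) {C C' : Fin s → ℕ → Fin m → Bool}
    {D D' : Fin s → ℕ → Bool} (hC : ∀ j, ∀ l < N, ∀ q, C j l q = C' j l q)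
    (hD : ∀ j, ∀ l < N, D j l = D' j l) : netErr f N C D = netErr f N C' D' := by
  refine Finset.sum_congr rfl fun k hk => ?_
  have hk := Fintype.mem_piFinset.1 (Finset.mem_erase.1 hk).2
  congr 1
  simp only [netAvg, netWal]
  congr 1
  refine Finset.sum_congr rfl fun i _ => Finset.prod_congr rfl fun j _ =>
    Finset.prod_congr rfl fun l hl => ?_
  have hl := Finset.mem_range.1 (Finset.mem_powerset.1 (hk j) hl)
  simp only [netDigit, hC j l hl, hD j l hl]

end Kernel

/-! ### The median of independent replicates -/

/-- If the median is off then at least half of the sample is. -/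
theorem exists_card_of_median {r : ℕ} (hr : 1 ≤ r) (y : Fin (2 * r - 1) → ℝ) (μ : ℝ) {T : ℝ}
    (h : T < |sampleMedian r hr y - μ| ^ 2) :
    ∃ S : Finset (Fin (2 * r - 1)), S.card = r ∧ ∀ t ∈ S, T < (y t - μ) ^ 2 := by
  set σ := Tuple.sort y with hσ
  have hmono : Monotone (y ∘ σ) := Tuple.monotone_sort y
  set c : Fin (2 * r - 1) := ⟨r - 1, by omega⟩ with hc
  have hmed : sampleMedian r hr y = y (σ c) := rfl
  rw [hmed, sq_abs] at h
  rcases le_total μ (y (σ c)) with hle | hle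
  · refine ⟨(Finset.Ici c).map σ.toEmbedding, ?_, ?_⟩
    · rw [Finset.card_map, Fin.card_Ici]; simp only [hc]; omega
    · intro t ht
      obtain ⟨i, hi, rfl⟩ := Finset.mem_map.1 ht
      have h1 : y (σ c) ≤ y (σ i) := hmono (Finset.mem_Ici.1 hi)
      refine h.trans_le (pow_le_pow_left₀ (by linarith) ?_ 2)
      exact sub_le_sub_right h1 _
  · refine ⟨(Finset.Iic c).map σ.toEmbedding, ?_, ?_⟩
    · rw [Finset.card_map, Fin.card_Iic]; simp only [hc]; omega
    · intro t ht
      obtain ⟨i, hi, rfl⟩ := Finset.mem_map.1 ht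
      have h1 : y (σ i) ≤ y (σ c) := hmono (Finset.mem_Iic.1 hi)
      rw [← neg_sq (y (σ c) - μ), neg_sub] at h
      rw [← neg_sq (y _ - μ), neg_sub]
      refine h.trans_le (pow_le_pow_left₀ (by linarith) ?_ 2)
      exact sub_le_sub_left h1 _

/-- The place of a bit of replicate `t` in the family of all bits. -/
def replicateBit {s m R : ℕ} (t : Fin R) :
    (Fin s × ℕ × Fin m) ⊕ (Fin s × ℕ) → (Fin R × Fin s × ℕ × Fin m) ⊕ (Fin R × Fin s × ℕ)
  | Sum.inl p => Sum.inl (t, p)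
  | Sum.inr p => Sum.inr (t, p)

theorem replicateBit_injective {s m R : ℕ} (t : Fin R) :
    Function.Injective (replicateBit (s := s) (m := m) t) := by
  rintro (p | p) (p' | p') h <;> simp_all [replicateBit]

theorem replicateBit_disjoint {s m R : ℕ} {t t' : Fin R} (h : t ≠ t')
    (b b' : (Fin s × ℕ × Fin m) ⊕ (Fin s × ℕ)) : replicateBit t b ≠ replicateBit t' b' := by
  rcases b with p | p <;> rcases b' with p' | p' <;> simp [replicateBit, h]

theorem bits_eq_designBits {Ω : Type*} {s m R : ℕ} (C : Fin R → Fin s → ℕ → Fin m → Ω → Bool)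
    (D : Fin R → Fin s → ℕ → Ω → Bool) (t : Fin R) (b : (Fin s × ℕ × Fin m) ⊕ (Fin s × ℕ)) :
    bits (C t) (D t) b = designBits C D (replicateBit t b) := by
  rcases b with ⟨j, l, q⟩ | ⟨j, l⟩ <;> rfl

theorem choose_mul_le {r : ℕ} (hr : 1 ≤ r) :
    (((2 * r - 1).choose r : ℕ) : ℝ≥0∞) * (1 / 8) ^ r ≤ (1 / 2) ^ r := by
  have h1 : (2 * r - 1).choose r ≤ 4 ^ r := by
    refine (Nat.choose_le_two_pow _ _).trans ?_
    rw [show (4 : ℕ) = 2 ^ 2 by norm_num, ← pow_mul]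
    exact Nat.pow_le_pow_right two_pos (by omega)
  calc _ ≤ ((4 : ℝ≥0∞) ^ r) * (1 / 8) ^ r := by gcongr; exact_mod_cast h1
    _ = (1 / 2) ^ r := by
      rw [← mul_pow]
      congr 1
      rw [show (8 : ℝ≥0∞) = 4 * 2 by norm_num, one_div, ENNReal.mul_inv (by simp) (by simp),
        ← mul_assoc, ENNReal.mul_inv_cancel (by simp) (by simp), one_mul, one_div]

/-- If at each resolution all but `2 ^ m / 16` coefficients have a small sum of squares, then the
median of the replicates is accurate: a single replicate fails with probability at most `1 / 8`. -/
theorem medianSqErrorBound_of_coeff {s m r : ℕ} (hr : 1 ≤ r) {f : (Fin s → ℝ) → ℝ}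
    (hf : ContinuousOn f (Set.Icc 0 1)) {T : ℝ}
    (hT : ∀ N, ∃ K : Finset (Fin s → Finset ℕ), (K.card : ℝ) ≤ 2 ^ m / 16 ∧
      16 * (1 / 2 ^ m * ∑ k ∈ (freqs s N).erase (fun _ => ∅), if k ∈ K then 0 else coeff f k ^ 2)
        ≤ T) :
    MedianSqErrorBound.{u} f m r hr T := by
  classical
  intro Ω _ P _ C D hdes
  set μ := ∫ x in Set.Icc (0 : Fin s → ℝ) 1, f x with hμ
  set err : ℕ → Fin (2 * r - 1) → Ω → ℝ := fun N t ω =>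
    netErr f N (fun j l q => C t j l q ω) (fun j l => D t j l ω) with herr
  set B : ℕ → Fin (2 * r - 1) → Set Ω := fun N t => {ω | T < err N t ω ^ 2} with hB
  have hm : ∀ t b, Measurable (bits (C t) (D t) b) := fun t b => by
    rw [bits_eq_designBits]; exact hdes.measurable _
  have hfair : ∀ t b v, P {ω | bits (C t) (D t) b ω = v} = 1 / 2 := fun t b v => by
    rw [bits_eq_designBits]; exact hdes.fair _ _
  have hind : ∀ t, iIndepFun (bits (C t) (D t)) P := fun t => by
    have := hdes.indep.precomp (replicateBit_injective t)
    rwa [← funext (bits_eq_designBits C D t)] at this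
  have hB8 : ∀ N t, P (B N t) ≤ 1 / 8 := by
    intro N t
    obtain ⟨K, hK, hKT⟩ := hT N
    exact measure_sum_netAvg_le (hind t) (hm t) (hfair t) (Finset.notMem_erase _ _) (coeff f) hK hKT
  -- At a fixed resolution the replicates depend on disjoint finite blocks of bits.
  have hinter : ∀ N (S : Finset (Fin (2 * r - 1))), P (⋂ t ∈ S, B N t) ≤ (1 / 8) ^ S.card := by
    intro N S
    set F : Fin (2 * r - 1) → Finset ((Fin (2 * r - 1) × Fin s × ℕ × Fin m) ⊕
        (Fin (2 * r - 1) × Fin s × ℕ)) := fun t =>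
      ((Finset.univ ×ˢ Finset.range N ×ˢ Finset.univ).disjSum
        (Finset.univ ×ˢ Finset.range N)).image (replicateBit t) with hF
    refine measure_iInter_blocks_le hdes.indep hdes.measurable F ?_ (B N) ?_ (hB8 N) S
    · intro t t' hne
      rw [Finset.disjoint_left]
      intro b hb hb'
      obtain ⟨a, -, rfl⟩ := Finset.mem_image.1 hb
      obtain ⟨a', -, h⟩ := Finset.mem_image.1 hb'
      exact replicateBit_disjoint hne a a' h.symm
    · intro t ω ω' h hω
      have : err N t ω = err N t ω' := by
        refine netErr_congr f N (fun j l hl q => ?_) (fun j l hl => ?_)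
        · exact h (Sum.inl (t, j, l, q)) (Finset.mem_image.2 ⟨Sum.inl (j, l, q), by simp [hl], rfl⟩)
        · exact h (Sum.inr (t, j, l)) (Finset.mem_image.2 ⟨Sum.inr (j, l), by simp [hl], rfl⟩)
      change T < err N t ω' ^ 2
      rw [← this]
      exact hω
  -- An error above the threshold is seen at all sufficiently fine resolutions.
  have hsub : {ω | |sampleMedian r hr (fun t =>
        netEstimator f (fun j l q => C t j l q ω) (fun j l => D t j l ω)) - μ| ^ 2 > T}
      ⊆ ⋃ S ∈ (Finset.univ : Finset (Fin (2 * r - 1))).powersetCard r,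
        ⋃ M : ℕ, ⋂ N : Set.Ici M, ⋂ t ∈ S, B N t := by
    intro ω hω
    obtain ⟨S, hS, hST⟩ := exists_card_of_median hr _ μ hω
    refine Set.mem_biUnion (x := S) (Finset.mem_powersetCard.2 ⟨Finset.subset_univ _, hS⟩) ?_
    have hev : ∀ᶠ N in Filter.atTop, ∀ t ∈ S, ω ∈ B N t := by
      rw [Filter.eventually_all_finset]
      intro t ht
      have h1 := (tendsto_netErr hf (fun j l q => C t j l q ω) (fun j l => D t j l ω)).pow 2
      exact h1.eventually (lt_mem_nhds (hST t ht))
    obtain ⟨M, hM⟩ := Filter.eventually_atTop.1 hev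
    exact Set.mem_iUnion.2 ⟨M, Set.mem_iInter.2 fun N => Set.mem_iInter₂.2 fun t ht => hM N N.2 t ht⟩
  refine (measure_mono hsub).trans ((measure_biUnion_finset_le _ _).trans ?_)
  have hS : ∀ S ∈ (Finset.univ : Finset (Fin (2 * r - 1))).powersetCard r,
      P (⋃ M : ℕ, ⋂ N : Set.Ici M, ⋂ t ∈ S, B N t) ≤ (1 / 8) ^ r := by
    intro S hS
    rw [Monotone.measure_iUnion]
    · refine iSup_le fun M => (measure_mono (Set.iInter_subset _ ⟨M, Set.mem_Ici.2 le_rfl⟩)).trans ?_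
      have h := hinter M S
      rwa [(Finset.mem_powersetCard.1 hS).2] at h
    · intro M M' hMM' ω hω
      rw [Set.mem_iInter] at hω ⊢
      exact fun N => hω ⟨N, Set.mem_Ici.2 (hMM'.trans N.2)⟩
  refine (Finset.sum_le_sum hS).trans ?_
  rw [Finset.sum_const, Finset.card_powersetCard, Finset.card_univ, Fintype.card_fin, nsmul_eq_mul]
  exact choose_mul_le hr

/-! ### The error bounds -/

section

variable {s α : ℕ} {lam : ℝ} {f : (Fin s → ℝ) → ℝ}

theorem MedianSqErrorBound.mono {m r : ℕ} {hr : 1 ≤ r} {b b' : ℝ} (hb : b ≤ b')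
    (h : MedianSqErrorBound.{u} f m r hr b) : MedianSqErrorBound.{u} f m r hr b' := by
  intro Ω _ P _ C D hdes
  exact (measure_mono fun ω hω => lt_of_le_of_lt hb hω).trans (h Ω P C D hdes)

theorem medianSqErrorBound_gammaTheta (hlam : 0 < lam) (hf : MixedSmooth α f)
    (hV : variationNorm α lam f < ⊤) (m r : ℕ) (hr : 1 ≤ r) {θ : ℝ} (hθ0 : 0 < θ) (hθ1 : θ < 1) :
    MedianSqErrorBound.{u} f m r hr
      (gammaTheta α lam (relVar α lam f) θ * (variationNorm α lam f).toReal ^ 2 *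
        (gammaM α lam (relVar α lam f) m ^ (2 * θ * ((α : ℝ) + lam)) /
          (2 : ℝ) ^ ((2 * θ * ((α : ℝ) + lam) + 1) * (m : ℝ)))) := by
  have hc : ContinuousOn f (Set.Icc 0 1) := by
    have := hf.continuousOn (fun _ => 0) fun _ => Nat.zero_le _
    rwa [show (fun _ : Fin s => 0) = 0 from rfl, mixedDeriv_zero] at this
  refine medianSqErrorBound_of_coeff hr hc fun N => ?_
  obtain ⟨K, hK, hKT⟩ := exists_small_freqs hf hV hlam m N hθ0 hθ1
  refine ⟨K, hK, ?_⟩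
  refine (mul_le_mul_of_nonneg_left (mul_le_mul_of_nonneg_left hKT (by positivity))
    (by norm_num)).trans (le_of_eq ?_)
  have hΓ : 0 < gammaM α lam (relVar α lam f) m :=
    zero_lt_one.trans_le (one_le_gammaM hlam relVar_nonneg m)
  rw [gammaTheta]
  generalize gammaM α lam (relVar α lam f) m = Γ at hΓ ⊢
  generalize 2 * θ * ((α : ℝ) + lam) = p
  generalize (∑ u ∈ Finset.univ.filter (fun u : Finset (Fin s) => u ≠ ∅),
    relVar α lam f u ^ ((1 + 2 * (1 - θ) * ((α : ℝ) + lam)) / ((α : ℝ) + lam + 1 / 2)) *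
      constC α lam θ ^ u.card) = S
  rw [Real.rpow_neg (by positivity), Real.div_rpow (by positivity) (by positivity),
    Real.mul_rpow (by norm_num) hΓ.le, add_one_mul, Real.rpow_add two_pos, Real.rpow_natCast,
    Real.rpow_add_one (by norm_num), mul_comm p, Real.rpow_mul two_pos.le, Real.rpow_natCast]
  field_simp

/-- Under product weights a sum over sets of coordinates factorizes. -/
theorem sum_prod_le_prod {w : ℕ → ℝ} (hw : ∀ j, 0 ≤ w j) {γ : Finset (Fin s) → ℝ}
    (hγ0 : ∀ u, 0 ≤ γ u) (hγ : ∀ u, γ u ≤ ∏ j ∈ u, w j) {e : ℝ} (he : 0 ≤ e) {c : ℝ} (hc : 0 ≤ c) :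
    1 + ∑ u ∈ Finset.univ.filter (fun u : Finset (Fin s) => u ≠ ∅), γ u ^ e * c ^ u.card
      ≤ ∏ j ∈ Finset.range s, (1 + w j ^ e * c) := by
  have h1 : ∀ u : Finset (Fin s), γ u ^ e * c ^ u.card ≤ ∏ j ∈ u, (w j ^ e * c) := by
    intro u
    rw [Finset.prod_mul_distrib, Finset.prod_const, Real.finsetProd_rpow u (fun j => w j) fun j _ => hw j]
    exact mul_le_mul_of_nonneg_right (Real.rpow_le_rpow (hγ0 u) (hγ u) he) (by positivity)
  rw [Finset.prod_range fun j => 1 + w j ^ e * c, Finset.prod_one_add, Finset.powerset_univ,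
    ← Finset.add_sum_erase _ _ (Finset.mem_univ (∅ : Finset (Fin s))), Finset.prod_empty,
    Finset.filter_ne']
  exact add_le_add_right (Finset.sum_le_sum fun u _ => h1 u) _

/-- Infinite products with summable terms grow more slowly than any exponential. -/
theorem exists_prod_le_exp {v : ℕ → ℝ} (hv : ∀ j, 0 ≤ v j) (hs : Summable v) {δ : ℝ} (hδ : 0 < δ) :
    ∃ c : ℝ, ∀ (n : ℕ) (t : ℝ), 0 ≤ t →
      ∏ j ∈ Finset.range n, (1 + v j * t) ≤ Real.exp (c + 2 * δ * t) := by
  obtain ⟨S, hS⟩ := summable_iff_vanishing_norm.1 hs δ hδ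
  set κ : ℝ := δ / (S.card + 1) with hκ
  have hκ0 : 0 < κ := by positivity
  set d : ℕ → ℝ := fun j => if j ∈ S then κ else v j with hd
  refine ⟨(∑' j, v j) / κ, fun n t ht => ?_⟩
  have h1 : ∀ j, 1 + v j * t ≤ Real.exp (v j / κ + d j * t) := by
    intro j
    have hvj := hv j
    simp only [hd]
    split_ifs
    · -- `(1 + v / κ) (1 + κ t)` dominates `1 + v t`.
      rw [Real.exp_add]
      have e1 := Real.add_one_le_exp (v j / κ)
      have e2 := Real.add_one_le_exp (κ * t)
      calc 1 + v j * t ≤ (v j / κ + 1) * (κ * t + 1) := by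
            have : (v j / κ + 1) * (κ * t + 1) = 1 + v j * t + (v j / κ + κ * t) := by
              field_simp; ring
            rw [this]
            exact le_add_of_nonneg_right (by positivity)
        _ ≤ _ := by gcongr
    · have e1 := Real.add_one_le_exp (v j / κ + v j * t)
      have : 0 ≤ v j / κ := by positivity
      linarith
  have h2 : ∑ j ∈ Finset.range n, d j ≤ 2 * δ := by
    rw [← Finset.sum_filter_add_sum_filter_not (Finset.range n) (· ∈ S), two_mul]
    refine add_le_add ?_ ?_
    · calc _ = ∑ j ∈ (Finset.range n).filter (· ∈ S), κ :=
            Finset.sum_congr rfl fun j hj => if_pos (Finset.mem_filter.1 hj).2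
        _ = ((Finset.range n).filter (· ∈ S)).card * κ := by rw [Finset.sum_const, nsmul_eq_mul]
        _ ≤ (S.card + 1) * κ := by
            have : (((Finset.range n).filter (· ∈ S)).card : ℝ) ≤ S.card := by
              exact_mod_cast Finset.card_le_card fun j hj => (Finset.mem_filter.1 hj).2
            gcongr
            linarith
        _ = δ := by rw [hκ]; field_simp
    · calc _ = ∑ j ∈ (Finset.range n).filter (¬ · ∈ S), v j :=
            Finset.sum_congr rfl fun j hj => if_neg (Finset.mem_filter.1 hj).2
        _ ≤ ‖∑ j ∈ (Finset.range n).filter (¬ · ∈ S), v j‖ := le_abs_self _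
        _ ≤ δ := (hS _ (Finset.disjoint_left.2 fun j hj => (Finset.mem_filter.1 hj).2)).le
  calc _ ≤ ∏ j ∈ Finset.range n, Real.exp (v j / κ + d j * t) :=
        Finset.prod_le_prod (fun j _ => by have := hv j; positivity) fun j _ => h1 j
    _ = Real.exp ((∑ j ∈ Finset.range n, v j) / κ + (∑ j ∈ Finset.range n, d j) * t) := by
        rw [← Real.exp_sum, Finset.sum_add_distrib, Finset.sum_div, Finset.sum_mul]
    _ ≤ _ := by
        refine Real.exp_le_exp.2 (add_le_add ?_ (mul_le_mul_of_nonneg_right h2 ht))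
        exact div_le_div_of_nonneg_right (hs.sum_le_tsum _ fun j _ => hv j) hκ0.le

/-- Under summable weights `gammaM` grows more slowly than any exponential, uniformly in the
dimension. -/
theorem exists_gammaM_le (α : ℕ) (hlam : 0 < lam) {w : ℕ → ℝ} (hw : ∀ j, 0 ≤ w j)
    (hs : Summable fun j => w j ^ (1 / ((α : ℝ) + lam + 1 / 2))) {ε : ℝ} (hε : 0 < ε) :
    ∃ c : ℝ, 0 < c ∧ ∀ (s : ℕ) (γ : Finset (Fin s) → ℝ), (∀ u, 0 ≤ γ u) →
      (∀ u, γ u ≤ ∏ j ∈ u, w j) → ∀ m : ℕ, gammaM α lam γ m ≤ c * (2 : ℝ) ^ (ε * m) := by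
  have hA := constA_nonneg (α := α) hlam
  have hB := constB_nonneg (α := α) hlam
  have hl2 : 0 < Real.log 2 := Real.log_pos one_lt_two
  set A := constA α lam
  set B := constB α lam
  set δ : ℝ := ε * Real.log 2 / (2 * (A + 1)) with hδ
  have hδ0 : 0 < δ := by positivity
  obtain ⟨c, hc⟩ := exists_prod_le_exp (fun j => Real.rpow_nonneg (hw j) _) hs hδ0
  refine ⟨Real.exp (c + 2 * δ * B), Real.exp_pos _, fun s γ hγ0 hγ m => ?_⟩
  have ht : 0 ≤ A * m + B := by positivity
  refine (sum_prod_le_prod hw hγ0 hγ (by positivity) ht).trans ((hc s _ ht).trans ?_)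
  rw [Real.rpow_def_of_pos two_pos, ← Real.exp_add]
  refine Real.exp_le_exp.2 ?_
  have h1 : 2 * δ * A ≤ Real.log 2 * ε := by
    have : 2 * δ * (A + 1) = Real.log 2 * ε := by rw [hδ]; field_simp
    nlinarith
  have h2 := mul_le_mul_of_nonneg_right h1 (Nat.cast_nonneg (α := ℝ) m)
  nlinarith

/-- Under summable weights `gammaTheta` is bounded uniformly in the dimension. -/
theorem exists_gammaTheta_le (α : ℕ) (hlam : 0 < lam) {w : ℕ → ℝ} (hw : ∀ j, 0 ≤ w j)
    (hs : Summable fun j => w j ^ (1 / ((α : ℝ) + lam + 1 / 2))) {θ : ℝ} (hθ1 : θ < 1) :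
    ∃ c : ℝ, ∀ (s : ℕ) (γ : Finset (Fin s) → ℝ), (∀ u, 0 ≤ γ u) → (∀ u, γ u ≤ 1) →
      (∀ u, γ u ≤ ∏ j ∈ u, w j) → gammaTheta α lam γ θ ≤ c := by
  have hC := constC_nonneg (α := α) hlam hθ1
  obtain ⟨c, hc⟩ := exists_prod_le_exp (fun j => Real.rpow_nonneg (hw j) _) hs one_pos
  refine ⟨16 ^ (2 * θ * ((α : ℝ) + lam) + 1) * Real.exp (c + 2 * 1 * constC α lam θ),
    fun s γ hγ0 hγ1 hγ => ?_⟩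
  rw [gammaTheta]
  refine mul_le_mul_of_nonneg_left ?_ (by positivity)
  refine le_trans ?_ (hc s _ hC)
  refine le_trans ?_ (sum_prod_le_prod hw hγ0 hγ (by positivity) hC)
  refine le_add_of_nonneg_of_le zero_le_one (Finset.sum_le_sum fun u _ => ?_)
  refine mul_le_mul_of_nonneg_right ?_ (by positivity)
  refine Real.rpow_le_rpow_of_exponent_ge' (hγ0 u) (hγ1 u) (by positivity) ?_
  have : 0 ≤ (1 - θ) * ((α : ℝ) + lam) := mul_nonneg (by linarith) (by positivity)
  gcongr
  linarith

/-- The rate of convergence under summable product weights, with a constant that does not depend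
on the dimension. -/
theorem exists_medianSqErrorBound (α : ℕ) (hlam : 0 < lam) {w : ℕ → ℝ} (hw : ∀ j, 0 ≤ w j)
    (hs : Summable fun j => w j ^ (1 / ((α : ℝ) + lam + 1 / 2))) {η : ℝ} (hη : 0 < η) :
    ∃ K : ℝ, ∀ (s : ℕ) (f : (Fin s → ℝ) → ℝ), MixedSmooth α f → variationNorm α lam f < ⊤ →
      (∀ u : Finset (Fin s), relVar α lam f u ≤ ∏ j ∈ u, w j) →
      ∀ (m r : ℕ) (hr : 1 ≤ r), MedianSqErrorBound.{u} f m r hr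
        (K * (variationNorm α lam f).toReal ^ 2 *
          (2 : ℝ) ^ (-(2 * (α : ℝ) + 2 * lam + 1 - 2 * η) * (m : ℝ))) := by
  have hp : 0 < (α : ℝ) + lam := by positivity
  set p := (α : ℝ) + lam with hpd
  -- `θ` loses `η` in the exponent, and the growth of `gammaM` loses another `η`.
  set θ : ℝ := max (1 - η / (2 * p)) (1 / 2) with hθ
  have hθ0 : 0 < θ := lt_max_of_lt_right (by norm_num)
  have hθ1 : θ < 1 := max_lt (by have : 0 < η / (2 * p) := by positivity
                                 linarith) (by norm_num)
  have hθp : 2 * p - η ≤ 2 * θ * p := by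
    have h1 : 1 - η / (2 * p) ≤ θ := le_max_left _ _
    have h2 : (1 - η / (2 * p)) * (2 * p) = 2 * p - η := by field_simp
    nlinarith
  obtain ⟨c, hc0, hc⟩ := exists_gammaM_le α hlam hw hs (ε := η / (2 * p)) (by positivity)
  obtain ⟨K, hK⟩ := exists_gammaTheta_le α hlam hw hs hθ1
  refine ⟨K * c ^ (2 * θ * p), fun s f hf hV hγ m r hr => ?_⟩
  refine (medianSqErrorBound_gammaTheta hlam hf hV m r hr hθ0 hθ1).mono ?_
  have h1 := hK s _ (relVar_nonneg (f := f)) relVar_le_one hγ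
  have h2 := hc s _ (relVar_nonneg (f := f)) hγ m
  have hΓ := one_le_gammaM (α := α) (m := m) hlam (relVar_nonneg (α := α) (lam := lam) (f := f))
  set Γ := gammaM α lam (relVar α lam f) m
  have hG0 : 0 ≤ gammaTheta α lam (relVar α lam f) θ := by
    rw [gammaTheta]
    have hC := constC_nonneg (α := α) hlam hθ1
    refine mul_nonneg (by positivity) (Finset.sum_nonneg fun u _ => ?_)
    exact mul_nonneg (Real.rpow_nonneg (relVar_nonneg u) _) (by positivity)
  have h3 : Γ ^ (2 * θ * p) ≤ c ^ (2 * θ * p) * (2 : ℝ) ^ (η * m) := by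
    refine (Real.rpow_le_rpow (by linarith) h2 (by positivity)).trans ?_
    rw [Real.mul_rpow hc0.le (by positivity), ← Real.rpow_mul two_pos.le]
    refine mul_le_mul_of_nonneg_left (Real.rpow_le_rpow_of_exponent_le one_le_two ?_)
      (by positivity)
    have e : η / (2 * p) * m * (2 * θ * p) = η * m * θ := by field_simp
    rw [e]
    exact mul_le_of_le_one_right (by positivity) hθ1.le
  have h4 : Γ ^ (2 * θ * p) / (2 : ℝ) ^ ((2 * θ * p + 1) * (m : ℝ))
      ≤ c ^ (2 * θ * p) * (2 : ℝ) ^ (-(2 * (α : ℝ) + 2 * lam + 1 - 2 * η) * (m : ℝ)) := by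
    calc _ ≤ c ^ (2 * θ * p) * (2 : ℝ) ^ (η * m) / (2 : ℝ) ^ ((2 * θ * p + 1) * (m : ℝ)) := by
          gcongr
      _ = c ^ (2 * θ * p) * (2 : ℝ) ^ (η * m - (2 * θ * p + 1) * (m : ℝ)) := by
          rw [Real.rpow_sub two_pos, mul_div_assoc]
      _ ≤ _ := by
          refine mul_le_mul_of_nonneg_left (Real.rpow_le_rpow_of_exponent_le one_le_two ?_)
            (by positivity)
          rw [← sub_mul]
          refine mul_le_mul_of_nonneg_right ?_ (Nat.cast_nonneg m)
          rw [hpd] at hθp ⊢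
          linarith
  calc _ ≤ K * (variationNorm α lam f).toReal ^ 2 *
        (c ^ (2 * θ * p) * (2 : ℝ) ^ (-(2 * (α : ℝ) + 2 * lam + 1 - 2 * η) * (m : ℝ))) := by
        refine mul_le_mul (mul_le_mul_of_nonneg_right h1 (sq_nonneg _)) h4 ?_
          (mul_nonneg (hG0.trans h1) (sq_nonneg _))
        have : 0 ≤ Γ := by linarith
        positivity
    _ = _ := by ring

end

end MedianNet

theorem theorem4p1 (α : ℕ) (lam : ℝ) (hlam₀ : 0 < lam) (hlam₁ : lam ≤ 1) :
    -- the explicit error bound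
    (∀ (s : ℕ) (f : (Fin s → ℝ) → ℝ), MedianNet.MixedSmooth α f →
      MedianNet.variationNorm α lam f < ⊤ →
      ∀ (m : ℕ), 1 ≤ m → ∀ (r : ℕ) (hr : 1 ≤ r) (θ : ℝ), 0 < θ → θ < 1 →
        MedianNet.MedianSqErrorBound.{u} f m r hr
          (MedianNet.gammaTheta α lam (MedianNet.relVar α lam f) θ *
            (MedianNet.variationNorm α lam f).toReal ^ 2 *
            (MedianNet.gammaM α lam (MedianNet.relVar α lam f) m ^ (2 * θ * ((α : ℝ) + lam)) /
              (2 : ℝ) ^ ((2 * θ * ((α : ℝ) + lam) + 1) * (m : ℝ))))) ∧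
    -- the rate in a fixed dimension
    (∀ (s : ℕ) (η : ℝ), 0 < η → ∃ K : ℝ, ∀ f : (Fin s → ℝ) → ℝ, MedianNet.MixedSmooth α f →
      MedianNet.variationNorm α lam f < ⊤ →
      ∀ (m : ℕ), 1 ≤ m → ∀ (r : ℕ) (hr : 1 ≤ r),
        MedianNet.MedianSqErrorBound.{u} f m r hr
          (K * (MedianNet.variationNorm α lam f).toReal ^ 2 *
            (2 : ℝ) ^ (-(2 * (α : ℝ) + 2 * lam + 1 - 2 * η) * (m : ℝ)))) ∧
    -- the dimension-independent rate under summable product weights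
    (∀ w : ℕ → ℝ, (∀ j, 0 ≤ w j) → Summable (fun j => w j ^ (1 / ((α : ℝ) + lam + 1 / 2))) →
      ∀ η : ℝ, 0 < η → ∃ K : ℝ, ∀ (s : ℕ) (f : (Fin s → ℝ) → ℝ), MedianNet.MixedSmooth α f →
      MedianNet.variationNorm α lam f < ⊤ →
      (∀ u : Finset (Fin s), MedianNet.relVar α lam f u ≤ ∏ j ∈ u, w j) →
      ∀ (m : ℕ), 1 ≤ m → ∀ (r : ℕ) (hr : 1 ≤ r),
        MedianNet.MedianSqErrorBound.{u} f m r hr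
          (K * (MedianNet.variationNorm α lam f).toReal ^ 2 *
            (2 : ℝ) ^ (-(2 * (α : ℝ) + 2 * lam + 1 - 2 * η) * (m : ℝ)))) := by
  refine ⟨fun s f hf hV m _ r hr θ hθ0 hθ1 =>
    MedianNet.medianSqErrorBound_gammaTheta hlam₀ hf hV m r hr hθ0 hθ1, fun s η hη => ?_,
    fun w hw hs η hη => ?_⟩
  · -- In a fixed dimension all relative variations are at most a product of unit weights.
    obtain ⟨K, hK⟩ := MedianNet.exists_medianSqErrorBound.{u} α hlam₀
      (w := fun j => if j < s then 1 else 0) (fun j => by split_ifs <;> norm_num) (by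
        refine summable_of_ne_finset_zero (s := Finset.range s) fun j hj => ?_
        rw [if_neg (by simpa using hj), Real.zero_rpow (by positivity)]) hη
    refine ⟨K, fun f hf hV m _ r hr => hK s f hf hV (fun u => ?_) m r hr⟩
    simpa using MedianNet.relVar_le_one u
  · obtain ⟨K, hK⟩ := MedianNet.exists_medianSqErrorBound.{u} α hlam₀ hw hs hη
    exact ⟨K, fun s f hf hV hγ m _ r hr => hK s f hf hV hγ m r hr⟩
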